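/- **Setup.** For a real binary quartic form $f=ax^4+bx^3y+cx^2y^2+dxy^3+ey^4$ put $I(f)=12ae-3bd+c^2$, $J(f)=72ace+9bcd-27ad^2-27eb^2-2c^3$, and $\Delta(I,J)=(4I^3-J^2)/27$. Let $\gamma\in\mathrm{GL}_2(\mathbb R)$ act by $(\gamma\cdot f)(x,y)=f((x,y)\gamma)/\det(\gamma)^2$; this induces an action of $\mathrm{PGL}_2(\mathbb R)$. Fix a type $i\in\{0,1,2+,2-\}$, with $(-1)^{2\pm}=1$. Let $\mathcal I^{(i)}=\{(I,J):(-1)^i\Delta(I,J)>0\}$ and $\mathcal J^{(i)}=\{(I,J)\in\mathcal I^{(i)}:|I|<1,\ |J|<2\}$. Let $L^{(i)}$ be the fundamental sets of Bhargava and Shankar: $$L^{(0)}=\{x^3y-\tfrac13xy^3-\tfrac J{27}y^4:-2<J<2\},$$ $$L^{(1)}=\{x^3y-\tfrac I3xy^3\pm\tfrac2{27}y^4:-1\le I<1\}\cup\{x^3y+\tfrac13xy^3-\tfrac J{27}y^4:-2<J<2\},$$ $$L^{(2+)}=\Big\{\tfrac1{16}x^4-\sqrt{\tfrac{2-J}{27}}\,x^3y+\tfrac12x^2y^2+y^4:-2<J<2\Big\},\qquad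 L^{(2-)}=-L^{(2+)}.$$ For $(I,J)\in\mathcal I^{(i)}$ let $\kappa(I,J)$ be the unique form in $\mathbb R^+\cdot L^{(i)}$ with invariants $(I,J)$. Fix a smooth compactly supported function $\eta:\mathrm{PGL}_2(\mathbb R)\to\mathbb R$ and a smooth function $\omega:\mathbb R^2\to\mathbb R$ with compact support contained in $\mathcal J^{(i)}$, and put $$\Psi(f)=\Big(\sum_{\substack{(g,p)\in \mathrm{PGL}_2(\mathbb R)\times\mathcal J^{(i)}\\ g\cdot\kappa(p)=f}}\eta(g)\Big)\,\omega(I(f),J(f)).$$ For $|u|\le\frac12$ let $n=\begin{pmatrix}1&0\\u&1\end{pmatrix}$, and for $a\ne0$ let $\psi_n(a,b,c,R,I)=\Psi(n^{-1}\cdot f)$, where $f$ is the form with coefficients $\big(a,b,c,d,\frac{I+3bd-c^2}{12a}\big)$ and $d=\frac{R-b^3+4abc}{8a^2}$. Fix constants $C,M,\delta_s>0$ and $0<\delta<1/28$. Write $H=8ac-3b^2$. For $X\geq 1$ let $B'_{X,\delta}$ be the set of $(a,b,c)\in\mathbb Z^3$ with $$X^{1/2-6\delta}\le|a|,|c|\le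 MX^{1/2},\qquad MX^{1/2-2\delta}\le|b|\le MX^{1/2},\qquad H\ne0,\qquad |H|\ge X^{1-28\delta}.$$ For integers $a\neq 0$, $b$, $c$ let $$\Lambda_{(a,b,c)}=\Big\{(R,I)\in\mathbb Z^2:\ R\equiv b^3-4abc\ (\mathrm{mod}\ 8a^2),\quad I\equiv-3b\,\tfrac{R-b^3+4abc}{8a^2}+c^2\ (\mathrm{mod}\ 12a)\Big\}.$$ Define $\Gamma(a,b,c,R)$ by $\frac{4aC}{3H}\Gamma=\frac{27R^2}{48a^2H}+\frac{H^2}{48a^2}$, and define $R_0=R_0(a,b,c)$ as follows. If $H>0$, then $R_0=\sqrt{\frac{48a^2H}{27}\big(X-\frac{H^2}{48a^2}\big)}$ when $X-\frac{H^2}{48a^2}>\frac{4C}3\big|\frac{aX}H\big|$, and $R_0=1$ otherwise. If $H<0$, then $R_0=\sqrt{\big|\frac{48a^2H}{27}\big(X+\frac{H^2}{48a^2}\big)\big|}$. Let $\chi$ be the characteristic function of $(-1,1)$. Let $A>0$ and $D_0,D_1,\dots$ be fixed constants. A *good $\varepsilon$-approximation* (with implied constants $A,D_k$) is a smooth function $\phi:\mathbb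 R\to\mathbb R$ supported in $[-A,A]$ such that 1. $\{x:|\phi(x)-\chi(x)|>4\varepsilon\}$ is contained in a union of two intervals of length at most $A\varepsilon$; 2. $\big|\int\phi(x)e^{-imx^2}e^{-i\alpha x}\,dx\big|\le A\,\frac{1+|\alpha/m|}{\varepsilon\sqrt{|m|}}$ for all $m\ge A$ and all real $\alpha$; 3. $|\phi^{(k)}(x)|\le D_k\varepsilon^{-2k}$ for all $k\ge0$ and all $x$. For such $\phi$ with $\varepsilon=X^{-\delta_s}$, and with $\lambda=X^{1/2}$, put $$\theta_{(a,b,c)}(R,I)=\psi_n\Big(\frac{at^4}\lambda,\frac{bt^2}\lambda,\frac c\lambda,\frac{Rt^6}{\lambda^3},\frac I{\lambda^2}\Big)\,\phi\Big(\frac R{R_0}\Big)\,\phi\Big(\frac{3HI}{4aCX}-X^{-1}\Gamma(a,b,c,R)\Big).$$ **Theorem.** There are constants $K$ and $X_0\ge1$, depending only on $i,\eta,\omega,C,M,\delta,\delta_s,A,(D_k)_{k\ge0}$, such that for all $X\ge X_0$, all good $X^{-\delta_s}$-approximations $\phi$, all $t\in[\sqrt[4]3/\sqrt2,\,X^\delta]$,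 all $u\in[-\frac12,\frac12]$ and all $(a,b,c)\in B'_{X,\delta}$, the sum below converges absolutely, $\theta_{(a,b,c)}$ is integrable on $\mathbb R^2$, and $$\Big|\sum_{(R,I)\in\Lambda_{(a,b,c)}}\theta_{(a,b,c)}(R,I)-\frac1{|8a^2\cdot12a|}\iint\theta_{(a,b,c)}(R,I)\,dR\,dI\Big|\le K\,X^{1/4+12\delta_s+50\delta}.$$ -/

import Mathlib

open scoped MatrixGroups ContDiff

noncomputable section

namespace BinaryQuartic

/-! ### Binary quartic forms, invariants, and the twisted action -/

/-- The real binary quartic form `a x⁴ + b x³y + c x²y² + d xy³ + e y⁴`. -/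
@[ext]
structure Quartic where
  a : ℝ
  b : ℝ
  c : ℝ
  d : ℝ
  e : ℝ

/-- The value of the form at `(x, y)`. -/
def Quartic.eval (f : Quartic) (x y : ℝ) : ℝ :=
  f.a * x ^ 4 + f.b * x ^ 3 * y + f.c * x ^ 2 * y ^ 2 + f.d * x * y ^ 3 + f.e * y ^ 4

/-- The invariant `I` of degree two. -/
def Quartic.invI (f : Quartic) : ℝ := 12 * f.a * f.e - 3 * f.b * f.d + f.c ^ 2

/-- The invariant `J` of degree three. -/
def Quartic.invJ (f : Quartic) : ℝ :=
  72 * f.a * f.c * f.e + 9 * f.b * f.c * f.d - 27 * f.a * f.d ^ 2 - 27 * f.e * f.b ^ 2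
    - 2 * f.c ^ 3

/-- Multiplication of a form by a real number. -/
def Quartic.scale (r : ℝ) (f : Quartic) : Quartic :=
  ⟨r * f.a, r * f.b, r * f.c, r * f.d, r * f.e⟩

/-- The coefficients of `f ((x, y) · g)` where `(x, y)` is a row vector. -/
def Quartic.subst (g : Matrix (Fin 2) (Fin 2) ℝ) (f : Quartic) : Quartic :=
  let p := g 0 0
  let q := g 0 1
  let r := g 1 0
  let s := g 1 1
  { a := f.a * p ^ 4 + f.b * p ^ 3 * q + f.c * p ^ 2 * q ^ 2 + f.d * p * q ^ 3 + f.e * q ^ 4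
    b := 4 * f.a * p ^ 3 * r + f.b * (3 * p ^ 2 * q * r + p ^ 3 * s)
      + f.c * (2 * p * q ^ 2 * r + 2 * p ^ 2 * q * s)
      + f.d * (q ^ 3 * r + 3 * p * q ^ 2 * s) + 4 * f.e * q ^ 3 * s
    c := 6 * f.a * p ^ 2 * r ^ 2 + f.b * (3 * p * q * r ^ 2 + 3 * p ^ 2 * r * s)
      + f.c * (q ^ 2 * r ^ 2 + 4 * p * q * r * s + p ^ 2 * s ^ 2)
      + f.d * (3 * q ^ 2 * r * s + 3 * p * q * s ^ 2) + 6 * f.e * q ^ 2 * s ^ 2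
    d := 4 * f.a * p * r ^ 3 + f.b * (q * r ^ 3 + 3 * p * r ^ 2 * s)
      + f.c * (2 * q * r ^ 2 * s + 2 * p * r * s ^ 2)
      + f.d * (3 * q * r * s ^ 2 + p * s ^ 3) + 4 * f.e * q * s ^ 3
    e := f.a * r ^ 4 + f.b * r ^ 3 * s + f.c * r ^ 2 * s ^ 2 + f.d * r * s ^ 3 + f.e * s ^ 4 }

theorem Quartic.eval_subst (g : Matrix (Fin 2) (Fin 2) ℝ) (f : Quartic) (x y : ℝ) :
    (f.subst g).eval x y = f.eval (x * g 0 0 + y * g 1 0) (x * g 0 1 + y * g 1 1) := by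
  simp only [Quartic.eval, Quartic.subst]
  ring

theorem Quartic.subst_mul (g h : Matrix (Fin 2) (Fin 2) ℝ) (f : Quartic) :
    f.subst (g * h) = (f.subst h).subst g := by
  ext <;> simp only [Quartic.subst, Matrix.mul_apply, Fin.sum_univ_two] <;> ring

theorem Quartic.subst_scale (g : Matrix (Fin 2) (Fin 2) ℝ) (r : ℝ) (f : Quartic) :
    (f.scale r).subst g = (f.subst g).scale r := by
  ext <;> simp only [Quartic.subst, Quartic.scale] <;> ring

theorem Quartic.scale_scale (r s : ℝ) (f : Quartic) :
    (f.scale s).scale r = f.scale (r * s) := by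
  ext <;> simp only [Quartic.scale] <;> ring

/-- The twisted action of `GL₂(ℝ)`: `(γ • f)(x, y) = f ((x, y) γ) / det(γ)²`. -/
instance : MulAction (GL (Fin 2) ℝ) Quartic where
  smul g f := (f.subst g.1).scale ((g.1.det ^ 2)⁻¹)
  one_smul f := by
    change (f.subst (1 : GL (Fin 2) ℝ).1).scale (((1 : GL (Fin 2) ℝ).1.det ^ 2)⁻¹) = f
    ext <;> simp [Quartic.subst, Quartic.scale]
  mul_smul g h f := by
    change (f.subst (g * h).1).scale (((g * h).1.det ^ 2)⁻¹)
      = (((f.subst h.1).scale ((h.1.det ^ 2)⁻¹)).subst g.1).scale ((g.1.det ^ 2)⁻¹)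
    rw [Quartic.subst_scale, Quartic.scale_scale, Units.val_mul, Quartic.subst_mul,
      Matrix.det_mul, mul_pow, mul_inv]

theorem Quartic.scalar_smul (u : ℝˣ) (f : Quartic) :
    (Matrix.GeneralLinearGroup.scalar (Fin 2) u) • f = f := by
  change (f.subst (Matrix.GeneralLinearGroup.scalar (Fin 2) u).1).scale
    (((Matrix.GeneralLinearGroup.scalar (Fin 2) u).1.det ^ 2)⁻¹) = f
  have hu : (u : ℝ) ≠ 0 := u.ne_zero
  ext <;> simp [Quartic.subst, Quartic.scale] <;> field_simp

/-- The action of `PGL₂(ℝ)` induced by the twisted action. -/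
instance : MulAction PGL(2, ℝ) Quartic :=
  Matrix.ProjGenLinGroup.mulActionOfGL Quartic.scalar_smul

/-! ### Fundamental sets and the smoothed weight on the space of forms -/

/-- The four types of forms: four real roots, two real roots, positive definite,
negative definite. -/
inductive Kind
  | zero
  | one
  | twoPos
  | twoNeg

/-- The sign `(-1)^i` of the discriminant. -/
def Kind.sign : Kind → ℝ
  | .zero => 1
  | .one => -1
  | .twoPos => 1
  | .twoNeg => 1

/-- The discriminant in terms of the invariants. -/
def disc (p : ℝ × ℝ) : ℝ := (4 * p.1 ^ 3 - p.2 ^ 2) / 27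

/-- The pairs `(I, J)` with `(-1)^i Δ(I, J) > 0`. -/
def invariantRegion (i : Kind) : Set (ℝ × ℝ) := {p | 0 < i.sign * disc p}

/-- The pairs `(I, J)` with `(-1)^i Δ(I, J) > 0`, `|I| < 1` and `|J| < 2`. -/
def unitRegion (i : Kind) : Set (ℝ × ℝ) :=
  {p | p ∈ invariantRegion i ∧ |p.1| < 1 ∧ |p.2| < 2}

/-- The fundamental sets `L⁽ⁱ⁾` of Bhargava and Shankar. -/
def fundamentalSet : Kind → Set Quartic
  | .zero => {f | ∃ J : ℝ, -2 < J ∧ J < 2 ∧ f = ⟨0, 1, 0, -1 / 3, -J / 27⟩}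
  | .one => {f | (∃ I : ℝ, -1 ≤ I ∧ I < 1 ∧
        (f = ⟨0, 1, 0, -I / 3, 2 / 27⟩ ∨ f = ⟨0, 1, 0, -I / 3, -2 / 27⟩)) ∨
      ∃ J : ℝ, -2 < J ∧ J < 2 ∧ f = ⟨0, 1, 0, 1 / 3, -J / 27⟩}
  | .twoPos => {f | ∃ J : ℝ, -2 < J ∧ J < 2 ∧
      f = ⟨1 / 16, -√((2 - J) / 27), 1 / 2, 0, 1⟩}
  | .twoNeg => {f | ∃ J : ℝ, -2 < J ∧ J < 2 ∧
      f = Quartic.scale (-1) ⟨1 / 16, -√((2 - J) / 27), 1 / 2, 0, 1⟩}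

/-- The element of `fundamentalSet i` with invariants `(I, J)`, for `(I, J)` in
`invariantRegion i` of naive height one, that is, with `max (|I|³) (J² / 4) = 1`. -/
def baseForm : Kind → ℝ × ℝ → Quartic
  | .zero, p => ⟨0, 1, 0, -p.1 / 3, -p.2 / 27⟩
  | .one, p => ⟨0, 1, 0, -p.1 / 3, -p.2 / 27⟩
  | .twoPos, p => ⟨1 / 16, -√((2 - p.2) / 27), 1 / 2, 0, 1⟩
  | .twoNeg, p => Quartic.scale (-1) ⟨1 / 16, -√((2 + p.2) / 27), 1 / 2, 0, 1⟩

/-- The `m ≥ 0` such that `(I, J) = (m² I₀, m³ J₀)` with `(I₀, J₀)` of naive height one. -/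
def dilation (p : ℝ × ℝ) : ℝ := max √|p.1| ((|p.2| / 2) ^ ((1 : ℝ) / 3))

/-- The section `κ⁽ⁱ⁾` of the invariant map: it sends `(m² I₀, m³ J₀)`, with `(I₀, J₀)` of
naive height one, to `m` times the element of `fundamentalSet i` with invariants `(I₀, J₀)`. -/
def kappa (i : Kind) (p : ℝ × ℝ) : Quartic :=
  (baseForm i (p.1 / dilation p ^ 2, p.2 / dilation p ^ 3)).scale (dilation p)

theorem dilation_pos {i : Kind} {p : ℝ × ℝ} (hp : p ∈ invariantRegion i) : 0 < dilation p := by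
  by_contra h
  push Not at h
  have h1 : √|p.1| ≤ 0 := (le_max_left _ _).trans h
  have h2 : (|p.2| / 2) ^ ((1 : ℝ) / 3) ≤ 0 := (le_max_right _ _).trans h
  have h3 : p.1 = 0 := by
    have := Real.sqrt_eq_zero'.1 (le_antisymm h1 (Real.sqrt_nonneg _))
    exact abs_nonpos_iff.1 this
  have h4 : p.2 = 0 := by
    by_contra h5
    have : 0 < (|p.2| / 2) ^ ((1 : ℝ) / 3) := Real.rpow_pos_of_pos (by positivity) _
    linarith
  simp [invariantRegion, disc, h3, h4] at hp

theorem dilation_bounds {p : ℝ × ℝ} :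
    |p.1| ≤ dilation p ^ 2 ∧ |p.2| ≤ 2 * dilation p ^ 3 ∧
      (|p.1| = dilation p ^ 2 ∨ |p.2| = 2 * dilation p ^ 3) := by
  have e1 : √|p.1| ^ 2 = |p.1| := Real.sq_sqrt (abs_nonneg _)
  have e2 : ((|p.2| / 2) ^ ((1 : ℝ) / 3)) ^ 3 = |p.2| / 2 := by
    rw [← Real.rpow_natCast, ← Real.rpow_mul (by positivity)]
    norm_num
  have n1 : 0 ≤ √|p.1| := Real.sqrt_nonneg _
  have n2 : 0 ≤ (|p.2| / 2) ^ ((1 : ℝ) / 3) := by positivity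
  have l1 : √|p.1| ≤ dilation p := le_max_left _ _
  have l2 : (|p.2| / 2) ^ ((1 : ℝ) / 3) ≤ dilation p := le_max_right _ _
  have m1 := pow_le_pow_left₀ n1 l1 2
  have m2 := pow_le_pow_left₀ n2 l2 3
  refine ⟨by linarith, by linarith, ?_⟩
  rcases max_choice √|p.1| ((|p.2| / 2) ^ ((1 : ℝ) / 3)) with h | h
  · left
    rw [dilation, h, e1]
  · right
    rw [dilation, h, e2]
    ring

/-- `kappa i p` is the element of `ℝ⁺ · fundamentalSet i` with invariants `p`. -/
theorem kappa_spec {i : Kind} {p : ℝ × ℝ} (hp : p ∈ invariantRegion i) :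
    (kappa i p).invI = p.1 ∧ (kappa i p).invJ = p.2 ∧
      ∃ m > 0, ∃ f ∈ fundamentalSet i, kappa i p = f.scale m := by
  have hm := dilation_pos hp
  obtain ⟨b1, b2, b3⟩ := dilation_bounds (p := p)
  obtain ⟨I, J⟩ := p
  simp only at b1 b2 b3
  set m := dilation (I, J) with hmdef
  have hpos : 0 < i.sign * disc (I, J) := hp
  have hk : kappa i (I, J) = (baseForm i (I / m ^ 2, J / m ^ 3)).scale m := rfl
  rw [hk]
  have hm2 : 0 < m ^ 2 := by positivity
  have hm3 : 0 < m ^ 3 := by positivity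
  have key : 0 < disc (I, J) → I = m ^ 2 ∧ |J| < 2 * m ^ 3 := by
    intro h
    have h' : J ^ 2 < 4 * I ^ 3 := by
      simp only [disc] at h
      linarith
    have hI : 0 < I := by
      by_contra h0
      have : I ^ 3 ≤ 0 := by
        have h1 : I ≤ 0 := not_lt.1 h0
        nlinarith [sq_nonneg I]
      nlinarith [sq_nonneg J]
    rw [abs_of_pos hI] at b1 b3
    have c1 : I ^ 3 ≤ m ^ 6 := by
      calc I ^ 3 ≤ (m ^ 2) ^ 3 := pow_le_pow_left₀ hI.le b1 3
        _ = m ^ 6 := by ring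
    have c2 : |J| < 2 * m ^ 3 := abs_lt_of_sq_lt_sq (by nlinarith) (by positivity)
    exact ⟨b3.resolve_right c2.ne, c2⟩
  have key2 : 0 < disc (I, J) → I / m ^ 2 = 1 ∧ -2 < J / m ^ 3 ∧ J / m ^ 3 < 2 := by
    intro h
    obtain ⟨h1, h2⟩ := key h
    rw [abs_lt] at h2
    refine ⟨by rw [h1]; field_simp, ?_, ?_⟩
    · rw [lt_div_iff₀ hm3]; linarith
    · rw [div_lt_iff₀ hm3]; linarith
  cases i with
  | zero =>
    obtain ⟨k1, k2, k3⟩ := key2 (by simpa [Kind.sign] using hpos)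
    refine ⟨?_, ?_, m, hm, baseForm .zero (I / m ^ 2, J / m ^ 3), ⟨J / m ^ 3, k2, k3, ?_⟩, rfl⟩
    · simp only [baseForm, Quartic.scale, Quartic.invI]; field_simp; ring
    · simp only [baseForm, Quartic.scale, Quartic.invJ]; field_simp; ring
    · simp [baseForm, k1]
  | one =>
    have hneg : disc (I, J) < 0 := by simpa [Kind.sign] using hpos
    refine ⟨?_, ?_, m, hm, baseForm .one (I / m ^ 2, J / m ^ 3), ?_, rfl⟩
    · simp only [baseForm, Quartic.scale, Quartic.invI]; field_simp; ring
    · simp only [baseForm, Quartic.scale, Quartic.invJ]; field_simp; ring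
    · have hd : 4 * I ^ 3 < J ^ 2 := by
        simp only [disc] at hneg
        linarith
      by_cases hJ : |J| = 2 * m ^ 3
      · left
        refine ⟨I / m ^ 2, ?_, ?_, ?_⟩
        · rw [le_div_iff₀ hm2]; linarith [(abs_le.1 b1).1]
        · rw [div_lt_one hm2]
          by_contra h0
          have h1 : (m ^ 2) ^ 3 ≤ I ^ 3 := pow_le_pow_left₀ hm2.le (not_lt.1 h0) 3
          have h2 : J ^ 2 = 4 * m ^ 6 := by rw [← sq_abs, hJ]; ring
          nlinarith
        · rcases abs_eq (by positivity : 0 ≤ 2 * m ^ 3) |>.1 hJ with h | h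
          · right
            have : J / m ^ 3 = 2 := by rw [h]; field_simp
            simp [baseForm, this]
          · left
            have : J / m ^ 3 = -2 := by rw [h]; field_simp
            simp [baseForm, this]
      · right
        have hI := b3.resolve_right hJ
        have hJ' : |J| < 2 * m ^ 3 := lt_of_le_of_ne b2 hJ
        have hJsq : J ^ 2 < 4 * m ^ 6 := by
          have := pow_lt_pow_left₀ hJ' (abs_nonneg J) two_ne_zero
          rw [sq_abs] at this
          nlinarith
        have hI' : I / m ^ 2 = -1 := by
          rcases abs_eq hm2.le |>.1 hI with h | h
          · exfalso
            rw [h] at hd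
            nlinarith
          · rw [h]; field_simp
        rw [abs_lt] at hJ'
        refine ⟨J / m ^ 3, ?_, ?_, ?_⟩
        · rw [lt_div_iff₀ hm3]; linarith
        · rw [div_lt_iff₀ hm3]; linarith
        · simp [baseForm, hI']
  | twoPos =>
    have hd : 0 < disc (I, J) := by simpa [Kind.sign] using hpos
    obtain ⟨k1, k2, k3⟩ := key2 hd
    have hI := (key hd).1
    have hs : √((2 - J / m ^ 3) / 27) ^ 2 = (2 - J / m ^ 3) / 27 :=
      Real.sq_sqrt (by linarith)
    refine ⟨?_, ?_, m, hm, baseForm .twoPos (I / m ^ 2, J / m ^ 3), ⟨J / m ^ 3, k2, k3, rfl⟩, rfl⟩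
    · simp only [baseForm, Quartic.scale, Quartic.invI]; rw [hI]; ring
    · have : J = m ^ 3 * (J / m ^ 3) := by field_simp
      simp only [baseForm, Quartic.scale, Quartic.invJ]
      linear_combination (-27) * m ^ 3 * hs - this
  | twoNeg =>
    have hd : 0 < disc (I, J) := by simpa [Kind.sign] using hpos
    obtain ⟨k1, k2, k3⟩ := key2 hd
    have hI := (key hd).1
    have hs : √((2 + J / m ^ 3) / 27) ^ 2 = (2 + J / m ^ 3) / 27 :=
      Real.sq_sqrt (by linarith)
    refine ⟨?_, ?_, m, hm, baseForm .twoNeg (I / m ^ 2, J / m ^ 3),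
      ⟨-(J / m ^ 3), by linarith, by linarith, by simp [baseForm]⟩, rfl⟩
    · simp only [baseForm, Quartic.scale, Quartic.invI]; rw [hI]; ring
    · have : J = m ^ 3 * (J / m ^ 3) := by field_simp
      simp only [baseForm, Quartic.scale, Quartic.invJ]
      linear_combination 27 * m ^ 3 * hs - this

/-- Smoothness of a function on `PGL₂(ℝ)`, tested on its lift to the open set of invertible
matrices. -/
def SmoothOnPGL (η : PGL(2, ℝ) → ℝ) : Prop :=
  ContDiffOn ℝ ∞
    (fun m : Fin 2 → Fin 2 → ℝ =>
      if h : (Matrix.of m).det ≠ 0 then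
        η (Matrix.ProjGenLinGroup.mk (Matrix.GeneralLinearGroup.mkOfDetNeZero (Matrix.of m) h))
      else 0)
    {m | (Matrix.of m).det ≠ 0}

/-- A function on `PGL₂(ℝ)` has compact support: its support lies in the image of a compact
set of invertible matrices. -/
def CompactlySupportedOnPGL (η : PGL(2, ℝ) → ℝ) : Prop :=
  ∃ K : Set (Fin 2 → Fin 2 → ℝ), IsCompact K ∧ (∀ m ∈ K, (Matrix.of m).det ≠ 0) ∧
    ∀ g : PGL(2, ℝ), η g ≠ 0 →
      ∃ γ : GL (Fin 2) ℝ, Matrix.ProjGenLinGroup.mk γ = g ∧ (fun i j => γ.1 i j) ∈ K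

/-- The function `Ψ[w](f) = (∑ η(g)) · w(I(f), J(f))`, where the (finite) sum runs over the pairs
`(g, (I, J))` in `PGL₂(ℝ) × unitRegion i` with `g • κ(I, J) = f`. -/
def Psi (i : Kind) (η : PGL(2, ℝ) → ℝ) (w : ℝ × ℝ → ℝ) (f : Quartic) : ℝ :=
  (∑ᶠ (q : PGL(2, ℝ) × (ℝ × ℝ)) (_ : q.2 ∈ unitRegion i ∧ q.1 • kappa i q.2 = f), η q.1)
    * w (f.invI, f.invJ)

/-- The lower triangular unipotent matrix with lower left entry `u`. -/
def unip (u : ℝ) : GL (Fin 2) ℝ :=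
  Matrix.GeneralLinearGroup.mkOfDetNeZero !![1, 0; u, 1] (by simp)

/-! ### Semi-invariant coordinates -/

/-- The semi-invariant `H`. -/
def semiH (a b c : ℝ) : ℝ := 8 * a * c - 3 * b ^ 2

/-- The coefficient `d` of the form with first coefficients `a, b, c` and semi-invariant `R`. -/
def dCoeff (a b c R : ℝ) : ℝ := (R - b ^ 3 + 4 * a * b * c) / (8 * a ^ 2)

/-- The form with `a ≠ 0`, first coefficients `a, b, c`, and semi-invariants `R` and `I`. -/
def upsilonInv (a b c R I : ℝ) : Quartic :=
  ⟨a, b, c, dCoeff a b c R, (I + 3 * b * dCoeff a b c R - c ^ 2) / (12 * a)⟩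

/-- `ψ_n = (n · Ψ) ∘ υ⁻¹` where `n = unip u` and `(n · Ψ)(f) = Ψ(n⁻¹ • f)`. -/
def psi (i : Kind) (η : PGL(2, ℝ) → ℝ) (w : ℝ × ℝ → ℝ) (u a b c R I : ℝ) : ℝ :=
  Psi i η w ((unip u)⁻¹ • upsilonInv a b c R I)

/-- The function `Γ`, given by `(4aC / 3H) Γ = 27R² / (48a²H) + H² / (48a²)`. -/
def Gam (C a b c R : ℝ) : ℝ :=
  3 * semiH a b c / (4 * a * C) *
    (27 * R ^ 2 / (48 * a ^ 2 * semiH a b c) + semiH a b c ^ 2 / (48 * a ^ 2))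

open Classical in
/-- The range `R₀(a, b, c)` for the semi-invariant `R`. -/
def R0 (C X a b c : ℝ) : ℝ :=
  if 0 < semiH a b c then
    if 4 * C / 3 * |a * X / semiH a b c| < X - semiH a b c ^ 2 / (48 * a ^ 2) then
      √(48 * a ^ 2 * semiH a b c / 27 * (X - semiH a b c ^ 2 / (48 * a ^ 2)))
    else 1
  else √|48 * a ^ 2 * semiH a b c / 27 * (X + semiH a b c ^ 2 / (48 * a ^ 2))|

/-- The smooth approximation `h_(a,b,c)` to the height condition on the fibre. -/
def smoothHeight (C : ℝ) (φ : ℝ → ℝ) (X a b c R I : ℝ) : ℝ :=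
  φ (R / R0 C X a b c) *
    φ (3 * semiH a b c * I / (4 * a * C * X) - X⁻¹ * Gam C a b c R)

/-- The weight `θ(a, b, c, R, I)`, with `λ = X^(1/2)` and `n = unip u`. -/
def theta (i : Kind) (η : PGL(2, ℝ) → ℝ) (w : ℝ × ℝ → ℝ) (C : ℝ) (φ : ℝ → ℝ)
    (X t u a b c R I : ℝ) : ℝ :=
  psi i η w u (a * t ^ 4 / √X) (b * t ^ 2 / √X) (c / √X) (R * t ^ 6 / √X ^ 3) (I / √X ^ 2) *
    smoothHeight C φ X a b c R I

/-- A good `ε`-approximation `φ` to the characteristic function of `(-1, 1)`, with implied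
constants `A` and `D 0, D 1, D 2, …`. -/
structure GoodApprox (A : ℝ) (D : ℕ → ℝ) (ε : ℝ) (φ : ℝ → ℝ) : Prop where
  smooth : ContDiff ℝ ∞ φ
  support : ∀ x, A < |x| → φ x = 0
  close : ∃ p₁ q₁ p₂ q₂ : ℝ, q₁ - p₁ ≤ A * ε ∧ q₂ - p₂ ≤ A * ε ∧
    {x | 4 * ε < |φ x - (Set.Ioo (-1 : ℝ) 1).indicator 1 x|} ⊆ Set.Icc p₁ q₁ ∪ Set.Icc p₂ q₂
  fourier : ∀ m α : ℝ, A ≤ m →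
    ‖∫ x : ℝ, (φ x : ℂ) * Complex.exp (-Complex.I * m * x ^ 2) * Complex.exp (-Complex.I * α * x)‖
      ≤ A * ((1 + |α / m|) / (ε * √|m|))
  deriv_le : ∀ (k : ℕ) (x : ℝ), |iteratedDeriv k φ x| ≤ D k * (ε ^ (2 * k))⁻¹

/-! ### The box and the fibre lattice -/

/-- The box `B_{X,δ}`, with `δ_a = 6δ` and `δ_b = 2δ`. -/
def box (M X δ : ℝ) : Set (ℤ × ℤ × ℤ) :=
  {v | X ^ (1 / 2 - 6 * δ) ≤ |(v.1 : ℝ)| ∧ |(v.1 : ℝ)| ≤ M * X ^ (1 / 2 : ℝ) ∧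
    X ^ (1 / 2 - 6 * δ) ≤ |(v.2.2 : ℝ)| ∧ |(v.2.2 : ℝ)| ≤ M * X ^ (1 / 2 : ℝ) ∧
    M * X ^ (1 / 2 - 2 * δ) ≤ |(v.2.1 : ℝ)| ∧ |(v.2.1 : ℝ)| ≤ M * X ^ (1 / 2 : ℝ) ∧
    semiH v.1 v.2.1 v.2.2 ≠ 0}

/-- The restricted box `B'_{X,δ}`, with `δ_H = 28δ`. -/
def restrictedBox (M X δ : ℝ) : Set (ℤ × ℤ × ℤ) :=
  {v | v ∈ box M X δ ∧ X ^ (1 - 28 * δ) ≤ |semiH v.1 v.2.1 v.2.2|}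

/-- The lattice points `(R, I)` in the fibre over `(a, b, c)`; the integer division is exact by
the first congruence. -/
def fibreLattice (a b c : ℤ) : Set (ℤ × ℤ) :=
  {p | p.1 ≡ b ^ 3 - 4 * a * b * c [ZMOD 8 * a ^ 2] ∧
    p.2 ≡ -3 * b * ((p.1 - b ^ 3 + 4 * a * b * c) / (8 * a ^ 2)) + c ^ 2 [ZMOD 12 * a]}

end BinaryQuartic

end

open BinaryQuartic

/-! A form on the fibre over (a, b, c) is determined by its last two coefficients (d, e): put R = r
+ 8a²d with r = b³ - 4abc, and I = c² - 3bd + 12ae. This carries `ℤ × ℤ` bijectively onto the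
lattice and has Jacobian 8a²·12a, the normalising factor in front of the integral. In these
coordinates the weight is F(d/(t²√X), e/(t⁴√X)) · φ(A₁d + A₀) · φ(ρ(e - x(d))), with A₁ = 8a²/R₀, ρ
= 9H/(CX) and x a quadratic polynomial with leading coefficient α = 3a/H. The claim is therefore an
asymptotic count of integral points in a thin neighbourhood of a parabola. Up to powers of X^δ, the
strip has bounded width, d ranges over an interval of length X^(1/2) at most, and α has size
X^(-1/2).

Three comparisons are made (`LipBump.abs_tsum_sub_integral_le`). Replacing F at (d, e) by its value
at (d, x(d)) costs the Lipschitz constant times the width, both in the sum and in the integral. The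
sum over e is then the periodization of y ↦ φ(ρy), and Poisson summation expands it in frequencies
ν. Frequency zero gives ∫φ(ρy)dy times a sum over d of a function G, and that sum differs from ∫G by
at most the total variation of G. A frequency ν ≠ 0 gives a sum of G(d) against the phase -νx(d):
summation by parts reduces it to a quadratic exponential sum, for which Weyl's bound
(`norm_quadratic_sum_le`) is n√(ν|α|) + 1/√(ν|α|) up to a logarithm, and the decay 1/ν² of the
Fourier coefficients makes the sum over ν converge. Since n is about X^(1/2) and α about X^(-1/2),
this is the X^(1/4) of the theorem. Derivatives of φ cost powers of X^(δs); the departures of a and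
H from their maximal sizes cost powers of X^δ.

What remains is that F is bounded, Lipschitz and compactly supported uniformly in a, b, c, u, that
is, that `Psi` is Lipschitz with compact support in the five coefficients (`Psi_lipschitz`). The
section `kappa` is not smooth, so it is written as a diagonal matrix with locally Lipschitz entry
acting on a smooth slice transverse to the orbits. The orbit map (γ, q) ↦ (k(q)∘γ, det γ) goes
between spaces of dimension six and is a local diffeomorphism wherever the weight lives. Each
element of `PGL(2, ℝ)` has exactly two representatives ±γ with determinant ±1, so `Psi` is half the
sum of two fibre sums of a compactly supported Lipschitz weight along this map (`Psi_eq_fibreSum`),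
and such fibre sums are locally Lipschitz by the inverse function theorem. -/

noncomputable section

namespace BinaryQuartic

/-! ### Fibre sums along local homeomorphisms -/

section FibreSum

variable {E F : Type*} [MetricSpace E] [MetricSpace F]

/-- The sum of `ζ` over the fibres of `Θ`. -/
def fibreSum (Θ : E → F) (ζ : E → ℝ) (v : F) : ℝ := ∑ᶠ x ∈ {x | Θ x = v}, ζ x

/-- The fibre sums of `ζ` along `Θ` are finite and locally Lipschitz. -/
def FibreSummable (Θ : E → F) (ζ : E → ℝ) : Prop :=
  (∀ v, ({x | Θ x = v} ∩ Function.support ζ).Finite) ∧ LocallyLipschitz (fibreSum Θ ζ)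

/-- `Θ` restricts to a homeomorphism near `x`, with Lipschitz inverse. -/
def HasLipschitzInverseAt (Θ : E → F) (x : E) : Prop :=
  ∃ (e : OpenPartialHomeomorph E F) (C : NNReal), x ∈ e.source ∧ (∀ y ∈ e.source, e y = Θ y) ∧
    LipschitzOnWith C e.symm e.target

theorem LocallyLipschitz.add_real {f g : E → ℝ} (hf : LocallyLipschitz f)
    (hg : LocallyLipschitz g) : LocallyLipschitz (fun x => f x + g x) :=
  (ContDiff.locallyLipschitz (f := fun p : ℝ × ℝ => p.1 + p.2) (by fun_prop) (𝕂 := ℝ)).comp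
    (hf.prodMk hg)

theorem LocallyLipschitz.mul_real {f g : E → ℝ} (hf : LocallyLipschitz f)
    (hg : LocallyLipschitz g) : LocallyLipschitz (fun x => f x * g x) :=
  (ContDiff.locallyLipschitz (f := fun p : ℝ × ℝ => p.1 * p.2) (by fun_prop) (𝕂 := ℝ)).comp
    (hf.prodMk hg)

set_option linter.unusedSectionVars false in
theorem FibreSummable.add {Θ : E → F} {ζ ξ : E → ℝ} (hζ : FibreSummable Θ ζ)
    (hξ : FibreSummable Θ ξ) : FibreSummable Θ (fun x => ζ x + ξ x) := by
  refine ⟨fun v => ((hζ.1 v).union (hξ.1 v)).subset ?_, ?_⟩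
  · rintro x ⟨hx, hx'⟩
    by_cases h : ζ x = 0
    · refine Or.inr ⟨hx, fun h' => hx' ?_⟩
      simp [h, h']
    · exact Or.inl ⟨hx, h⟩
  · have : fibreSum Θ (fun x => ζ x + ξ x) = fun v => fibreSum Θ ζ v + fibreSum Θ ξ v := by
      ext v
      exact finsum_mem_add_distrib' (hζ.1 v) (hξ.1 v)
    rw [this]
    exact LocallyLipschitz.add_real hζ.2 hξ.2

/-- A fibre meets the support in at most one point, given by the inverse chart. So the fibre sum is
ζ composed with that inverse on the target, and zero off the compact image of the support; these two
open sets cover `F`. -/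
theorem fibreSummable_of_chart {Θ : E → F} {ζ : E → ℝ} (e : OpenPartialHomeomorph E F)
    {C : NNReal} (he : ∀ y ∈ e.source, e y = Θ y) (hC : LipschitzOnWith C e.symm e.target)
    (hζ : LocallyLipschitz ζ) (hc : HasCompactSupport ζ) (hs : tsupport ζ ⊆ e.source) :
    FibreSummable Θ ζ := by
  have key : ∀ v x, Θ x = v → ζ x ≠ 0 → v ∈ e.target ∧ x = e.symm v := by
    intro v x hx hx'
    have hxs : x ∈ e.source := hs (subset_tsupport _ hx')
    rw [← hx, ← he x hxs]
    exact ⟨e.map_source hxs, (e.left_inv hxs).symm⟩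
  have hS : ∀ v ∈ e.target, fibreSum Θ ζ v = ζ (e.symm v) := by
    intro v hv
    classical
    unfold fibreSum
    rw [finsum_eq_single _ (e.symm v)]
    · rw [finsum_eq_if, if_pos]
      have := e.map_target hv
      change Θ (e.symm v) = v
      rw [← he _ this, e.right_inv hv]
    · intro x hx
      rw [finsum_eq_if]
      split_ifs with h
      · by_contra h'
        exact hx (key v x h h').2
      · rfl
  have hS0 : ∀ v, v ∉ e '' (tsupport ζ) → fibreSum Θ ζ v = 0 := by
    intro v hv
    unfold fibreSum
    apply finsum_mem_eq_zero_of_forall_eq_zero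
    intro x hx
    by_contra h'
    exact hv ⟨x, subset_tsupport _ h', by rw [he x (hs (subset_tsupport _ h'))]; exact hx⟩
  have hK : IsCompact (e '' (tsupport ζ)) :=
    IsCompact.image_of_continuousOn hc (e.continuousOn.mono hs)
  refine ⟨fun v => ((Set.finite_singleton (e.symm v))).subset ?_, ?_⟩
  · rintro x ⟨hx, hx'⟩
    exact (key v x hx hx').2
  · intro v
    by_cases hv : v ∈ e.target
    · obtain ⟨K, s, hs, hK⟩ := hζ (e.symm v)
      refine ⟨K * C, e.target ∩ e.symm ⁻¹' s, ?_, ?_⟩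
      · exact Filter.inter_mem (e.open_target.mem_nhds hv)
          ((e.continuousAt_symm hv).preimage_mem_nhds hs)
      · intro x hx y hy
        rw [hS x hx.1, hS y hy.1]
        exact (hK.comp (hC.mono Set.inter_subset_left) (fun z hz => hz.2)) hx hy
    · have hv' : v ∈ (e '' (tsupport ζ))ᶜ := by
        rintro ⟨x, hx, rfl⟩
        exact hv (e.map_source (hs hx))
      refine ⟨0, (e '' (tsupport ζ))ᶜ, hK.isClosed.isOpen_compl.mem_nhds hv', ?_⟩
      intro x hx y hy
      rw [hS0 x hx, hS0 y hy]
      simp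

/-- A Lipschitz partition of unity built one ball at a time: ζ = ζb + ζ(1 - b) with b a tent equal
to 1 on the ball and 0 outside the doubled ball. The first summand lives in one chart; the second
vanishes on the ball and is left to the remaining ones. -/
theorem fibreSummable_of_cover {Θ : E → F} (r : E → ℝ) (t : Finset E)
    (ht : ∀ x ∈ t, 0 < r x ∧ ∃ (e : OpenPartialHomeomorph E F) (C : NNReal),
      Metric.closedBall x (2 * r x) ⊆ e.source ∧ (∀ y ∈ e.source, e y = Θ y) ∧
      LipschitzOnWith C e.symm e.target) (ζ : E → ℝ)
    (hζ : LocallyLipschitz ζ) (hc : HasCompactSupport ζ)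
    (hs : Function.support ζ ⊆ ⋃ x ∈ t, Metric.ball x (r x)) :
    FibreSummable Θ ζ := by
  classical
  induction t using Finset.induction_on generalizing ζ with
  | empty =>
    have h0 : ζ = fun _ => 0 := by
      ext x
      by_contra h
      simpa using hs h
    subst h0
    refine ⟨fun v => by simp, ?_⟩
    have : fibreSum Θ (fun _ => (0 : ℝ)) = fun _ => 0 := by
      ext v; simp [fibreSum]
    rw [this]
    exact LocallyLipschitz.const 0
  | insert x t hx ih =>
    obtain ⟨hr, e, C, he1, he2, he3⟩ := ht x (Finset.mem_insert_self _ _)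
    set b : E → ℝ := fun y => max 0 (min 1 (2 - dist y x * (r x)⁻¹)) with hb
    have hbL : LocallyLipschitz b := by
      have h1 : LocallyLipschitz (fun y : E => dist y x) :=
        (LipschitzWith.dist_left x).locallyLipschitz
      have h2 : LocallyLipschitz (fun s : ℝ => max 0 (min 1 (2 - s * (r x)⁻¹))) := by
        have : LocallyLipschitz (fun s : ℝ => 2 - s * (r x)⁻¹) :=
          ContDiff.locallyLipschitz (𝕂 := ℝ) (by fun_prop)
        exact (this.const_min 1).const_max 0
      exact h2.comp h1
    have hb1 : ∀ y ∈ Metric.ball x (r x), b y = 1 := by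
      intro y hy
      have : dist y x * (r x)⁻¹ ≤ 1 := by
        rw [← div_eq_mul_inv, div_le_one hr]; exact (Metric.mem_ball.1 hy).le
      simp only [hb]
      rw [min_eq_left (by linarith), max_eq_right zero_le_one]
    have hb0 : ∀ y, y ∉ Metric.closedBall x (2 * r x) → b y = 0 := by
      intro y hy
      have : 2 ≤ dist y x * (r x)⁻¹ := by
        rw [← div_eq_mul_inv, le_div_iff₀ hr]
        simpa using (le_of_lt (not_le.1 hy))
      simp only [hb]
      exact max_eq_left ((min_le_right _ _).trans (by linarith))
    have hsplit : ζ = fun y => ζ y * b y + ζ y * (1 - b y) := by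
      ext y; ring
    rw [hsplit]
    have h1b : LocallyLipschitz (fun y => 1 - b y) :=
      (ContDiff.locallyLipschitz (f := fun s : ℝ => 1 - s) (by fun_prop) (𝕂 := ℝ)).comp hbL
    apply FibreSummable.add
    · refine fibreSummable_of_chart e he2 he3 (LocallyLipschitz.mul_real hζ hbL)
        (hc.mul_right) ?_
      refine subset_trans ?_ he1
      apply closure_minimal _ Metric.isClosed_closedBall
      intro y hy
      by_contra h
      exact hy (by simp [hb0 y h])
    · refine ih (fun y hy => ht y (Finset.mem_insert_of_mem hy)) _
        (LocallyLipschitz.mul_real hζ h1b) hc.mul_right ?_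
      intro y hy
      have hy1 : ζ y ≠ 0 := left_ne_zero_of_mul hy
      have hy2 : 1 - b y ≠ 0 := right_ne_zero_of_mul hy
      have := hs hy1
      simp only [Finset.mem_insert, Set.iUnion_iUnion_eq_or_left, Set.mem_union] at this
      rcases this with h | h
      · exact absurd (by rw [hb1 y h, sub_self]) hy2
      · exact h

theorem fibreSummable {Θ : E → F} {ζ : E → ℝ} (hζ : LocallyLipschitz ζ)
    (hc : HasCompactSupport ζ) (h : ∀ x ∈ tsupport ζ, HasLipschitzInverseAt Θ x) :
    FibreSummable Θ ζ := by
  have h' : ∀ x : E, ∃ r : ℝ, x ∈ tsupport ζ → (0 < r ∧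
      ∃ (e : OpenPartialHomeomorph E F) (C : NNReal),
      Metric.closedBall x (2 * r) ⊆ e.source ∧ (∀ y ∈ e.source, e y = Θ y) ∧
      LipschitzOnWith C e.symm e.target) := by
    intro x
    by_cases hx : x ∈ tsupport ζ
    · obtain ⟨e, C, h1, h2, h3⟩ := h x hx
      obtain ⟨ε, hε, hε'⟩ := Metric.mem_nhds_iff.1 (e.open_source.mem_nhds h1)
      refine ⟨ε / 4, fun _ => ⟨by positivity, e, C, ?_, h2, h3⟩⟩
      exact (Metric.closedBall_subset_ball (by linarith)).trans hε'
    · exact ⟨0, fun h => absurd h hx⟩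
  choose r hr using h'
  obtain ⟨t, ht⟩ := hc.elim_nhds_subcover' (fun x _ => Metric.ball x (r x))
    (fun x hx => Metric.ball_mem_nhds x (hr x hx).1)
  classical
  refine fibreSummable_of_cover r (t.image Subtype.val) ?_ ζ hζ hc ?_
  · intro x hx
    simp only [Finset.mem_image, Subtype.exists, exists_and_right, exists_eq_right] at hx
    exact hr x hx.1
  · refine (subset_tsupport ζ).trans (ht.trans ?_)
    intro y hy
    simp only [Set.mem_iUnion, Finset.mem_image] at hy ⊢
    obtain ⟨x, hx, hy⟩ := hy
    exact ⟨x, ⟨x, hx, rfl⟩, hy⟩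
  
end FibreSum

/-! ### The orbit map -/

/-- A matrix together with the parameters of a form in a two-dimensional slice. -/
abbrev OrbitParam := (Fin 2 → Fin 2 → ℝ) × (ℝ × ℝ)

/-- The coefficient vector of a quartic form. -/
def Quartic.vec (f : Quartic) : Fin 5 → ℝ := ![f.a, f.b, f.c, f.d, f.e]

/-- The map `(γ, q) ↦ (k(q) ∘ γ, det γ)`. -/
def orbitMap (k : ℝ × ℝ → Quartic) (x : OrbitParam) : (Fin 5 → ℝ) × ℝ :=
  (((k x.2).subst (Matrix.of x.1)).vec, (Matrix.of x.1).det)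

theorem contDiff_orbitMap {k : ℝ × ℝ → Quartic} (ha : ContDiff ℝ 1 fun q => (k q).a)
    (hb : ContDiff ℝ 1 fun q => (k q).b) (hc : ContDiff ℝ 1 fun q => (k q).c)
    (hd : ContDiff ℝ 1 fun q => (k q).d) (he : ContDiff ℝ 1 fun q => (k q).e) :
    ContDiff ℝ 1 (orbitMap k) := by
  have ha' : ContDiff ℝ 1 fun x : OrbitParam => (k x.2).a := ha.comp contDiff_snd
  have hb' : ContDiff ℝ 1 fun x : OrbitParam => (k x.2).b := hb.comp contDiff_snd
  have hc' : ContDiff ℝ 1 fun x : OrbitParam => (k x.2).c := hc.comp contDiff_snd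
  have hd' : ContDiff ℝ 1 fun x : OrbitParam => (k x.2).d := hd.comp contDiff_snd
  have he' : ContDiff ℝ 1 fun x : OrbitParam => (k x.2).e := he.comp contDiff_snd
  refine ContDiff.prodMk ?_ ?_
  · rw [contDiff_pi]
    intro i
    fin_cases i <;> simp [Quartic.vec, Quartic.subst] <;> fun_prop
  · simp only [Matrix.det_fin_two, Matrix.of_apply]
    fun_prop

/-- The infinitesimal action at the identity. -/
theorem hasDerivAt_subst {a b c d e p q r s : ℝ → ℝ} {a' b' c' d' e' α β γ ε : ℝ}
    (ha : HasDerivAt a a' 0) (hb : HasDerivAt b b' 0) (hc : HasDerivAt c c' 0)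
    (hd : HasDerivAt d d' 0) (he : HasDerivAt e e' 0) (hp : HasDerivAt p α 0)
    (hq : HasDerivAt q β 0) (hr : HasDerivAt r γ 0) (hs : HasDerivAt s ε 0)
    (p0 : p 0 = 1) (q0 : q 0 = 0) (r0 : r 0 = 0) (s0 : s 0 = 1) :
    HasDerivAt (fun x => ((⟨a x, b x, c x, d x, e x⟩ : Quartic).subst
      (Matrix.of ![![p x, q x], ![r x, s x]])).a) (a' + 4 * a 0 * α + b 0 * β) 0 ∧
    HasDerivAt (fun x => ((⟨a x, b x, c x, d x, e x⟩ : Quartic).subst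
      (Matrix.of ![![p x, q x], ![r x, s x]])).b)
      (b' + 4 * a 0 * γ + b 0 * (3 * α + ε) + 2 * c 0 * β) 0 ∧
    HasDerivAt (fun x => ((⟨a x, b x, c x, d x, e x⟩ : Quartic).subst
      (Matrix.of ![![p x, q x], ![r x, s x]])).c)
      (c' + 3 * b 0 * γ + c 0 * (2 * α + 2 * ε) + 3 * d 0 * β) 0 ∧
    HasDerivAt (fun x => ((⟨a x, b x, c x, d x, e x⟩ : Quartic).subst
      (Matrix.of ![![p x, q x], ![r x, s x]])).d)
      (d' + 2 * c 0 * γ + d 0 * (α + 3 * ε) + 4 * e 0 * β) 0 ∧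
    HasDerivAt (fun x => ((⟨a x, b x, c x, d x, e x⟩ : Quartic).subst
      (Matrix.of ![![p x, q x], ![r x, s x]])).e) (e' + d 0 * γ + 4 * e 0 * ε) 0 := by
  simp only [Quartic.subst, Matrix.of_apply, Matrix.cons_val_zero, Matrix.cons_val_one]
  refine ⟨?_, ?_, ?_, ?_, ?_⟩
  · refine HasDerivAt.congr_deriv ((((((ha.mul (hp.pow 4)).add ((hb.mul (hp.pow 3)).mul hq)).add
      ((hc.mul (hp.pow 2)).mul (hq.pow 2))).add ((hd.mul hp).mul (hq.pow 3))).add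
      (he.mul (hq.pow 4)))) ?_
    simp [p0, q0]; ring
  · refine HasDerivAt.congr_deriv (((((((ha.const_mul 4).mul (hp.pow 3)).mul hr).add (hb.mul
      (((((hp.pow 2).const_mul 3).mul hq).mul hr).add ((hp.pow 3).mul hs)))).add (hc.mul
      ((((hp.const_mul 2).mul (hq.pow 2)).mul hr).add
        ((((hp.pow 2).const_mul 2).mul hq).mul hs)))).add (hd.mul (((hq.pow 3).mul hr).add
        (((hp.const_mul 3).mul (hq.pow 2)).mul hs)))).add
        (((he.const_mul 4).mul (hq.pow 3)).mul hs)) ?_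
    simp [p0, q0, r0, s0]; ring
  · refine HasDerivAt.congr_deriv (((((((ha.const_mul 6).mul (hp.pow 2)).mul (hr.pow 2)).add (hb.mul
      ((((hp.const_mul 3).mul hq).mul (hr.pow 2)).add
        ((((hp.pow 2).const_mul 3).mul hr).mul hs)))).add (hc.mul
      ((((hq.pow 2).mul (hr.pow 2)).add ((((hp.const_mul 4).mul hq).mul hr).mul hs)).add
        ((hp.pow 2).mul (hs.pow 2))))).add (hd.mul (((((hq.pow 2).const_mul 3).mul hr).mul hs).add
        (((hp.const_mul 3).mul hq).mul (hs.pow 2))))).add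
        (((he.const_mul 6).mul (hq.pow 2)).mul (hs.pow 2))) ?_
    simp [p0, q0, r0, s0]; ring
  · refine HasDerivAt.congr_deriv (((((((ha.const_mul 4).mul hp).mul (hr.pow 3)).add (hb.mul
      ((hq.mul (hr.pow 3)).add (((hp.const_mul 3).mul (hr.pow 2)).mul hs)))).add (hc.mul
      ((((hq.const_mul 2).mul (hr.pow 2)).mul hs).add
        (((hp.const_mul 2).mul hr).mul (hs.pow 2))))).add (hd.mul
        ((((hq.const_mul 3).mul hr).mul (hs.pow 2)).add
        (hp.mul (hs.pow 3))))).add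
        (((he.const_mul 4).mul hq).mul (hs.pow 3))) ?_
    simp [p0, q0, r0, s0]; ring
  · refine HasDerivAt.congr_deriv ((((((ha.mul (hr.pow 4)).add ((hb.mul (hr.pow 3)).mul hs)).add
      ((hc.mul (hr.pow 2)).mul (hs.pow 2))).add ((hd.mul hr).mul (hs.pow 3))).add
      (he.mul (hs.pow 4)))) ?_
    simp [r0, s0]; ring

/-- The coefficients after a fixed substitution are fixed linear combinations of the old ones. This
moves a stationary curve from an arbitrary matrix back to the identity. -/
theorem hasDerivAt_subst_const {F : ℝ → Quartic} (g : Matrix (Fin 2) (Fin 2) ℝ)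
    (ha : HasDerivAt (fun s => (F s).a) 0 0) (hb : HasDerivAt (fun s => (F s).b) 0 0)
    (hc : HasDerivAt (fun s => (F s).c) 0 0) (hd : HasDerivAt (fun s => (F s).d) 0 0)
    (he : HasDerivAt (fun s => (F s).e) 0 0) :
    HasDerivAt (fun s => ((F s).subst g).a) 0 0 ∧ HasDerivAt (fun s => ((F s).subst g).b) 0 0 ∧
    HasDerivAt (fun s => ((F s).subst g).c) 0 0 ∧ HasDerivAt (fun s => ((F s).subst g).d) 0 0 ∧
    HasDerivAt (fun s => ((F s).subst g).e) 0 0 := by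
  have key : ∀ u v w x y : ℝ, HasDerivAt (fun s => (F s).a * u + (F s).b * v + (F s).c * w
      + (F s).d * x + (F s).e * y) 0 0 := by
    intro u v w x y
    refine HasDerivAt.congr_deriv (((((ha.mul_const u).add (hb.mul_const v)).add
      (hc.mul_const w)).add (hd.mul_const x)).add (he.mul_const y)) ?_
    simp
  simp only [Quartic.subst]
  refine ⟨?_, ?_, ?_, ?_, ?_⟩
  · convert key (g 0 0 ^ 4) (g 0 0 ^ 3 * g 0 1) (g 0 0 ^ 2 * g 0 1 ^ 2) (g 0 0 * g 0 1 ^ 3)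
      (g 0 1 ^ 4) using 1
    ext s; ring
  · convert key (4 * g 0 0 ^ 3 * g 1 0) (3 * g 0 0 ^ 2 * g 0 1 * g 1 0 + g 0 0 ^ 3 * g 1 1)
      (2 * g 0 0 * g 0 1 ^ 2 * g 1 0 + 2 * g 0 0 ^ 2 * g 0 1 * g 1 1)
      (g 0 1 ^ 3 * g 1 0 + 3 * g 0 0 * g 0 1 ^ 2 * g 1 1) (4 * g 0 1 ^ 3 * g 1 1) using 1
    ext s; ring
  · convert key (6 * g 0 0 ^ 2 * g 1 0 ^ 2)
      (3 * g 0 0 * g 0 1 * g 1 0 ^ 2 + 3 * g 0 0 ^ 2 * g 1 0 * g 1 1)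
      (g 0 1 ^ 2 * g 1 0 ^ 2 + 4 * g 0 0 * g 0 1 * g 1 0 * g 1 1 + g 0 0 ^ 2 * g 1 1 ^ 2)
      (3 * g 0 1 ^ 2 * g 1 0 * g 1 1 + 3 * g 0 0 * g 0 1 * g 1 1 ^ 2)
      (6 * g 0 1 ^ 2 * g 1 1 ^ 2) using 1
    ext s; ring
  · convert key (4 * g 0 0 * g 1 0 ^ 3) (g 0 1 * g 1 0 ^ 3 + 3 * g 0 0 * g 1 0 ^ 2 * g 1 1)
      (2 * g 0 1 * g 1 0 ^ 2 * g 1 1 + 2 * g 0 0 * g 1 0 * g 1 1 ^ 2)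
      (3 * g 0 1 * g 1 0 * g 1 1 ^ 2 + g 0 0 * g 1 1 ^ 3) (4 * g 0 1 * g 1 1 ^ 3) using 1
    ext s; ring
  · convert key (g 1 0 ^ 4) (g 1 0 ^ 3 * g 1 1) (g 1 0 ^ 2 * g 1 1 ^ 2) (g 1 0 * g 1 1 ^ 3)
      (g 1 1 ^ 4) using 1
    ext s; ring

/-- The slice `k` is transverse to the orbits at `k q`: an infinitesimal motion of trace zero that
is compensated by a motion along the slice vanishes. -/
def TransverseAt (k : ℝ × ℝ → Quartic) (q : ℝ × ℝ) : Prop :=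
  ∀ (v : ℝ × ℝ) (α β γ a' b' c' d' e' : ℝ),
    HasDerivAt (fun s : ℝ => (k (q + s • v)).a) a' 0 →
    HasDerivAt (fun s : ℝ => (k (q + s • v)).b) b' 0 →
    HasDerivAt (fun s : ℝ => (k (q + s • v)).c) c' 0 →
    HasDerivAt (fun s : ℝ => (k (q + s • v)).d) d' 0 →
    HasDerivAt (fun s : ℝ => (k (q + s • v)).e) e' 0 →
    a' + 4 * (k q).a * α + (k q).b * β = 0 →
    b' + 4 * (k q).a * γ + 2 * (k q).b * α + 2 * (k q).c * β = 0 →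
    c' + 3 * (k q).b * γ + 3 * (k q).d * β = 0 →
    d' + 2 * (k q).c * γ - 2 * (k q).d * α + 4 * (k q).e * β = 0 →
    e' + (k q).d * γ - 4 * (k q).e * α = 0 →
    α = 0 ∧ β = 0 ∧ γ = 0 ∧ v = 0

/-- A kernel vector (B, v) at (G, q) makes the curve k(q + sv)∘(G + sB) stationary at s = 0.
Substituting G⁻¹ turns it into k(q + sv)∘(1 + sA) with A = G⁻¹B, and the determinant coordinate
forces tr A = 0. Transversality then gives A = 0 and v = 0. -/
theorem fderiv_orbitMap_ker {k : ℝ × ℝ → Quartic} (ha : ContDiff ℝ 1 fun q => (k q).a)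
    (hb : ContDiff ℝ 1 fun q => (k q).b) (hc : ContDiff ℝ 1 fun q => (k q).c)
    (hd : ContDiff ℝ 1 fun q => (k q).d) (he : ContDiff ℝ 1 fun q => (k q).e)
    {x : OrbitParam} (hdet : (Matrix.of x.1).det ≠ 0) (hk : TransverseAt k x.2)
    {y : OrbitParam} (hy : fderiv ℝ (orbitMap k) x y = 0) : y = 0 := by
  obtain ⟨g, q⟩ := x
  obtain ⟨B, v⟩ := y
  simp only at hdet hk
  set G : Matrix (Fin 2) (Fin 2) ℝ := Matrix.of g with hG
  have hunit : IsUnit G.det := isUnit_iff_ne_zero.2 hdet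
  have hline : ∀ {V : Type} [NormedAddCommGroup V] [NormedSpace ℝ V] (z w : V),
      HasDerivAt (fun s : ℝ => z + s • w) w 0 := by
    intro V _ _ z w
    simpa using ((hasDerivAt_id (0 : ℝ)).smul_const w).const_add z
  have hcurve : HasDerivAt (fun s : ℝ => orbitMap k ((g, q) + s • (B, v))) 0 0 := by
    have h1 : HasFDerivAt (orbitMap k) (fderiv ℝ (orbitMap k) (g, q)) ((g, q) + (0 : ℝ) • (B, v)) := by
      simpa using ((contDiff_orbitMap ha hb hc hd he).differentiable one_ne_zero
        (g, q)).hasFDerivAt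
    have h2 := h1.comp_hasDerivAt (0 : ℝ) (hline (g, q) (B, v))
    rwa [hy] at h2
  have hvec : ∀ i, HasDerivAt (fun s : ℝ => (orbitMap k ((g, q) + s • (B, v))).1 i) 0 0 := by
    intro i
    have := (hasFDerivAt_fst (𝕜 := ℝ) (E := Fin 5 → ℝ) (F := ℝ)).comp_hasDerivAt (0 : ℝ) hcurve
    simpa using (hasDerivAt_pi.1 this) i
  have hdt : HasDerivAt (fun s : ℝ => (orbitMap k ((g, q) + s • (B, v))).2) 0 0 := by
    exact ((hasFDerivAt_snd (𝕜 := ℝ) (E := Fin 5 → ℝ) (F := ℝ)).comp_hasDerivAt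
      (0 : ℝ) hcurve).congr_deriv (by simp)
  set F : ℝ → Quartic := fun s => (k (q + s • v)).subst (Matrix.of (g + s • B)) with hF
  obtain ⟨t1, t2, t3, t4, t5⟩ := hasDerivAt_subst_const (F := F) G⁻¹ (hvec 0) (hvec 1) (hvec 2)
    (hvec 3) (hvec 4)
  set A : Matrix (Fin 2) (Fin 2) ℝ := G⁻¹ * Matrix.of B with hA
  have hmat : ∀ s : ℝ, G⁻¹ * Matrix.of (g + s • B) = 1 + s • A := by
    intro s
    have : Matrix.of (g + s • B) = G + s • Matrix.of B := rfl
    rw [this, Matrix.mul_add, Matrix.nonsing_inv_mul _ hunit, Matrix.mul_smul]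
  have hmat' : ∀ s : ℝ, (1 + s • A) = Matrix.of ![![1 + s * A 0 0, 0 + s * A 0 1],
      ![0 + s * A 1 0, 1 + s * A 1 1]] := by
    intro s
    ext i j
    fin_cases i <;> fin_cases j <;> simp
  have hFs : ∀ s, (F s).subst G⁻¹ = (k (q + s • v)).subst (Matrix.of
      ![![1 + s * A 0 0, 0 + s * A 0 1], ![0 + s * A 1 0, 1 + s * A 1 1]]) := by
    intro s
    rw [hF, ← Quartic.subst_mul, hmat, hmat']
  have dif : ∀ {h : ℝ × ℝ → ℝ}, ContDiff ℝ 1 h →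
      HasDerivAt (fun s : ℝ => h (q + s • v)) (fderiv ℝ h q v) 0 := by
    intro h hh
    have h1 : HasFDerivAt h (fderiv ℝ h q) (q + (0 : ℝ) • v) := by
      simpa using (hh.differentiable one_ne_zero q).hasFDerivAt
    exact h1.comp_hasDerivAt (0 : ℝ) (hline q v)
  have hlin : ∀ z w : ℝ, HasDerivAt (fun s : ℝ => z + s * w) w 0 := fun z w => hline z w
  obtain ⟨u1, u2, u3, u4, u5⟩ := hasDerivAt_subst (dif ha) (dif hb) (dif hc) (dif hd) (dif he)
    (hlin 1 (A 0 0)) (hlin 0 (A 0 1)) (hlin 0 (A 1 0)) (hlin 1 (A 1 1)) (by simp) (by simp)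
    (by simp) (by simp)
  simp only [hFs] at t1 t2 t3 t4 t5
  have e1 := u1.unique t1
  have e2 := u2.unique t2
  have e3 := u3.unique t3
  have e4 := u4.unique t4
  have e5 := u5.unique t5
  -- The derivative of det(1 + sA) at 0 is the trace, and it vanishes because the last coordinate of
  -- the orbit map is stationary.
  have htr : A 1 1 = - A 0 0 := by
    have h1 : HasDerivAt (fun s : ℝ => G⁻¹.det * (Matrix.of (g + s • B)).det) (G⁻¹.det * 0) 0 :=
      hdt.const_mul _
    have h2 : HasDerivAt (fun s : ℝ => (1 + s * A 0 0) * (1 + s * A 1 1)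
        - (0 + s * A 0 1) * (0 + s * A 1 0)) (A 0 0 + A 1 1) 0 := by
      refine HasDerivAt.congr_deriv (((hlin 1 (A 0 0)).mul (hlin 1 (A 1 1))).sub
        ((hlin 0 (A 0 1)).mul (hlin 0 (A 1 0)))) ?_
      simp
    have h3 : (fun s : ℝ => G⁻¹.det * (Matrix.of (g + s • B)).det) = fun s : ℝ =>
        (1 + s * A 0 0) * (1 + s * A 1 1) - (0 + s * A 0 1) * (0 + s * A 1 0) := by
      ext s
      rw [← Matrix.det_mul, hmat, hmat', Matrix.det_fin_two]
      simp
    rw [h3] at h1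
    have := h2.unique h1
    linarith
  rw [htr] at e2 e3 e4 e5
  simp only [zero_smul, add_zero] at e1 e2 e3 e4 e5
  obtain ⟨r1, r2, r3, r4⟩ := hk v (A 0 0) (A 0 1) (A 1 0) _ _ _ _ _ (dif ha) (dif hb) (dif hc)
    (dif hd) (dif he) e1 (by linarith) (by linarith) (by linarith) (by linarith)
  have hA0 : A = 0 := by
    ext i j
    fin_cases i <;> fin_cases j <;> simp [r1, r2, r3, htr]
  have hB : Matrix.of B = 0 := by
    have : G * A = Matrix.of B := by
      rw [hA, ← Matrix.mul_assoc, Matrix.mul_nonsing_inv _ hunit, one_mul]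
    rw [← this, hA0, mul_zero]
  refine Prod.ext ?_ r4
  exact Matrix.of.injective hB

/-- With equal dimensions an injective derivative is invertible. The local inverse is again C¹,
hence Lipschitz near the image point, and the chart is shrunk accordingly. -/
theorem hasLipschitzInverseAt_of_fderiv {E F : Type*} [NormedAddCommGroup E] [NormedSpace ℝ E]
    [FiniteDimensional ℝ E] [NormedAddCommGroup F] [NormedSpace ℝ F] [FiniteDimensional ℝ F]
    (hEF : Module.finrank ℝ E = Module.finrank ℝ F) {Θ : E → F} (hΘ : ContDiff ℝ 1 Θ) {x : E}
    (hx : ∀ y, fderiv ℝ Θ x y = 0 → y = 0) : HasLipschitzInverseAt Θ x := by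
  have := FiniteDimensional.complete ℝ E
  have := FiniteDimensional.complete ℝ F
  have hinj : Function.Injective (fderiv ℝ Θ x).toLinearMap := by
    rw [← LinearMap.ker_eq_bot, LinearMap.ker_eq_bot']
    exact hx
  set L : E ≃L[ℝ] F :=
    ((fderiv ℝ Θ x).toLinearMap.linearEquivOfInjective hinj
      hEF).toContinuousLinearEquiv with hL
  have hL' : HasFDerivAt Θ (L : E →L[ℝ] F) x := by
    have : (L : E →L[ℝ] F) = fderiv ℝ Θ x := by
      ext y; rfl
    rw [this]
    exact (hΘ.differentiable one_ne_zero x).hasFDerivAt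
  have hcd : ContDiffAt ℝ 1 Θ x := hΘ.contDiffAt
  set e := hcd.toOpenPartialHomeomorph Θ hL' one_ne_zero with he
  have hxs : x ∈ e.source := hcd.mem_toOpenPartialHomeomorph_source hL' one_ne_zero
  have hinv : ContDiffAt ℝ 1 e.symm (Θ x) := hcd.to_localInverse hL' one_ne_zero
  obtain ⟨K, s, hs, hK⟩ := hinv.exists_lipschitzOnWith
  -- The set `s` lies in the target, so the inverse chart is the one restricted.
  refine ⟨(e.symm.restr (interior s)).symm, K, ?_, ?_, ?_⟩
  · simp only [OpenPartialHomeomorph.symm_source, OpenPartialHomeomorph.restr_target,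
      OpenPartialHomeomorph.symm_target, OpenPartialHomeomorph.symm_symm, interior_interior]
    exact ⟨hxs, mem_interior_iff_mem_nhds.2 hs⟩
  · intro y _
    rfl
  · apply hK.mono
    intro y hy
    simp only [OpenPartialHomeomorph.symm_target, OpenPartialHomeomorph.restr_source,
      OpenPartialHomeomorph.symm_source, interior_interior] at hy
    exact interior_subset hy.2

/-! ### Lipschitz continuity near a point -/

/-- `f` is Lipschitz on a neighbourhood of `x`. -/
def LipschitzAt {E F : Type*} [PseudoEMetricSpace E] [PseudoEMetricSpace F] (f : E → F) (x : E) :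
    Prop :=
  ∃ K, ∃ s ∈ nhds x, LipschitzOnWith K f s

section LipschitzAt

variable {E F G : Type*} [PseudoEMetricSpace E] [PseudoEMetricSpace F] [PseudoEMetricSpace G]

theorem LipschitzAt.continuousAt {f : E → F} {x : E} (hf : LipschitzAt f x) :
    ContinuousAt f x := by
  obtain ⟨K, s, hs, h⟩ := hf
  exact h.continuousOn.continuousAt hs

theorem LipschitzAt.comp {g : F → G} {f : E → F} {x : E} (hg : LipschitzAt g (f x))
    (hf : LipschitzAt f x) : LipschitzAt (fun y => g (f y)) x := by
  have hc := hf.continuousAt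
  obtain ⟨K, s, hs, h⟩ := hf
  obtain ⟨K', s', hs', h'⟩ := hg
  exact ⟨K' * K, s ∩ f ⁻¹' s', Filter.inter_mem hs (hc.preimage_mem_nhds hs'),
    h'.comp (h.mono Set.inter_subset_left) (fun z hz => hz.2)⟩

theorem LipschitzAt.prodMk {f : E → F} {g : E → G} {x : E} (hf : LipschitzAt f x)
    (hg : LipschitzAt g x) : LipschitzAt (fun y => (f y, g y)) x := by
  obtain ⟨K, s, hs, h⟩ := hf
  obtain ⟨K', s', hs', h'⟩ := hg
  exact ⟨max K K', s ∩ s', Filter.inter_mem hs hs',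
    (h.mono Set.inter_subset_left).prodMk (h'.mono Set.inter_subset_right)⟩

theorem LipschitzAt.congr {f g : E → F} {x : E} (hf : LipschitzAt f x)
    (h : g =ᶠ[nhds x] f) : LipschitzAt g x := by
  obtain ⟨K, s, hs, hK⟩ := hf
  refine ⟨K, s ∩ {y | g y = f y}, Filter.inter_mem hs h, ?_⟩
  intro y hy z hz
  rw [hy.2, hz.2]
  exact hK hy.1 hz.1

theorem LipschitzAt.max {f g : E → ℝ} {x : E} (hf : LipschitzAt f x) (hg : LipschitzAt g x) :
    LipschitzAt (fun y => max (f y) (g y)) x := by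
  have h : LipschitzAt (fun p : ℝ × ℝ => Max.max p.1 p.2) (f x, g x) :=
    (LocallyLipschitz.max LipschitzWith.prod_fst.locallyLipschitz
      LipschitzWith.prod_snd.locallyLipschitz) _
  exact LipschitzAt.comp (f := fun y => (f y, g y)) h (hf.prodMk hg)

end LipschitzAt

theorem lipschitzAt_of_contDiffAt {E F : Type*} [NormedAddCommGroup E] [NormedSpace ℝ E]
    [NormedAddCommGroup F] [NormedSpace ℝ F] {f : E → F} {x : E} (hf : ContDiffAt ℝ 1 f x) :
    LipschitzAt f x := hf.exists_lipschitzOnWith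

theorem LipschitzAt.mul {E : Type*} [PseudoEMetricSpace E] {f g : E → ℝ} {x : E}
    (hf : LipschitzAt f x) (hg : LipschitzAt g x) : LipschitzAt (fun y => f y * g y) x :=
  LipschitzAt.comp (g := fun p : ℝ × ℝ => p.1 * p.2) (f := fun y => (f y, g y))
    (lipschitzAt_of_contDiffAt (by fun_prop)) (hf.prodMk hg)

/-- A locally Lipschitz function with compact support is Lipschitz and bounded. -/
theorem exists_lipschitzWith_of_hasCompactSupport {E : Type*} [NormedAddCommGroup E]
    [ProperSpace E] {f : E → ℝ} (hf : LocallyLipschitz f) (hc : HasCompactSupport f) :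
    ∃ C, LipschitzWith C f := by
  obtain ⟨R, hR⟩ := hc.isBounded.subset_closedBall (0 : E)
  obtain ⟨B, hB⟩ := hf.continuous.bounded_above_of_compact_support hc
  have hB0 : 0 ≤ B := (norm_nonneg _).trans (hB 0)
  obtain ⟨C, hC⟩ := (hf.locallyLipschitzOn (s := Metric.closedBall (0 : E)
    (R + 1))).exists_lipschitzOnWith_of_compact (isCompact_closedBall _ _)
  have hout : ∀ x, x ∉ Metric.closedBall (0 : E) R → f x = 0 := by
    intro x hx
    by_contra h
    exact hx (hR (subset_tsupport _ h))
  -- The margin 1 between the two balls matters: a point outside the larger one is at distance at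
  -- least 1 from the support, so the sup bound serves as a Lipschitz constant.
  have far : ∀ x y, x ∉ Metric.closedBall (0 : E) (R + 1) → |f x - f y| ≤ B * dist x y := by
    intro x y hx
    have hx' : R + 1 < ‖x‖ := by simpa using hx
    have fx : f x = 0 := hout x (by simp; linarith)
    by_cases hy : y ∈ Metric.closedBall (0 : E) R
    · have hy' : ‖y‖ ≤ R := by simpa using hy
      have : 1 ≤ dist x y := by
        rw [dist_eq_norm]
        have := norm_sub_norm_le x y
        linarith
      rw [fx, zero_sub, abs_neg]
      calc |f y| ≤ B := hB y
        _ ≤ B * dist x y := le_mul_of_one_le_right hB0 this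
    · rw [fx, hout y hy]
      simp only [sub_zero, abs_zero]
      positivity
  refine ⟨max C B.toNNReal, LipschitzWith.of_dist_le_mul fun x y => ?_⟩
  rw [NNReal.coe_max, Real.coe_toNNReal _ hB0, Real.dist_eq]
  by_cases hx : x ∈ Metric.closedBall (0 : E) (R + 1)
  · by_cases hy : y ∈ Metric.closedBall (0 : E) (R + 1)
    · have := hC.dist_le_mul x hx y hy
      rw [Real.dist_eq] at this
      exact this.trans (by gcongr; exact le_max_left _ _)
    · have := far y x hy
      rw [abs_sub_comm, dist_comm] at this
      exact this.trans (by gcongr; exact le_max_right _ _)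
  · exact (far x y hx).trans (by gcongr; exact le_max_right _ _)

/-! ### Invariants and the action -/

theorem Quartic.invI_subst (g : Matrix (Fin 2) (Fin 2) ℝ) (f : Quartic) :
    (f.subst g).invI = g.det ^ 4 * f.invI := by
  simp only [Quartic.subst, Quartic.invI, Matrix.det_fin_two]
  ring

theorem Quartic.invJ_subst (g : Matrix (Fin 2) (Fin 2) ℝ) (f : Quartic) :
    (f.subst g).invJ = g.det ^ 6 * f.invJ := by
  simp only [Quartic.subst, Quartic.invJ, Matrix.det_fin_two]
  ring

theorem Quartic.invI_scale (r : ℝ) (f : Quartic) : (f.scale r).invI = r ^ 2 * f.invI := by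
  simp only [Quartic.scale, Quartic.invI]; ring

theorem Quartic.invJ_scale (r : ℝ) (f : Quartic) : (f.scale r).invJ = r ^ 3 * f.invJ := by
  simp only [Quartic.scale, Quartic.invJ]; ring

theorem Quartic.scale_one (f : Quartic) : f.scale 1 = f := by
  ext <;> simp [Quartic.scale]

theorem Quartic.gl_smul_def (g : GL (Fin 2) ℝ) (f : Quartic) :
    g • f = (f.subst g.1).scale ((g.1.det ^ 2)⁻¹) := rfl

theorem Quartic.pgl_mk_smul (g : GL (Fin 2) ℝ) (f : Quartic) :
    Matrix.ProjGenLinGroup.mk g • f = g • f :=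
  Matrix.ProjGenLinGroup.mk_smul ..

theorem Quartic.gl_smul_of_det_sq_eq_one {g : GL (Fin 2) ℝ} (hg : g.1.det ^ 2 = 1) (f : Quartic) :
    g • f = f.subst g.1 := by
  rw [Quartic.gl_smul_def, hg, inv_one, Quartic.scale_one]

theorem det_val_ne_zero (g : GL (Fin 2) ℝ) : g.1.det ≠ 0 :=
  ((Matrix.isUnit_iff_isUnit_det _).1 g.isUnit).ne_zero

theorem Quartic.invI_smul (g : PGL(2, ℝ)) (f : Quartic) : (g • f).invI = f.invI := by
  induction g using Matrix.ProjGenLinGroup.induction_on with | mk g =>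
  have := det_val_ne_zero g
  rw [Quartic.pgl_mk_smul, Quartic.gl_smul_def, Quartic.invI_scale, Quartic.invI_subst]
  field_simp

theorem Quartic.invJ_smul (g : PGL(2, ℝ)) (f : Quartic) : (g • f).invJ = f.invJ := by
  induction g using Matrix.ProjGenLinGroup.induction_on with | mk g =>
  have := det_val_ne_zero g
  rw [Quartic.pgl_mk_smul, Quartic.gl_smul_def, Quartic.invJ_scale, Quartic.invJ_subst]
  field_simp

/-! ### Slices -/

/-- The diagonal matrix with entries `t, 1`. -/
def diagGL (t : ℝ) (ht : 0 < t) : GL (Fin 2) ℝ :=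
  Matrix.GeneralLinearGroup.mkOfDetNeZero !![t, 0; 0, 1] (by simp [ht.ne'])

/-- The pair of invariants of a form. -/
def Quartic.inv (f : Quartic) : ℝ × ℝ := (f.invI, f.invJ)

/-- A smooth two-dimensional family of forms, transverse to the orbits, that represents the forms
`kappa i p` up to a diagonal matrix. -/
structure Slice (i : Kind) where
  k : ℝ × ℝ → Quartic
  Q : Set (ℝ × ℝ)
  param : ℝ × ℝ → ℝ × ℝ
  τ : ℝ × ℝ → ℝ
  ha : ContDiff ℝ 1 fun q => (k q).a
  hb : ContDiff ℝ 1 fun q => (k q).b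
  hc : ContDiff ℝ 1 fun q => (k q).c
  hd : ContDiff ℝ 1 fun q => (k q).d
  he : ContDiff ℝ 1 fun q => (k q).e
  isOpen_Q : IsOpen Q
  transverse : ∀ q ∈ Q, TransverseAt k q
  param_mem : ∀ p ∈ invariantRegion i, param p ∈ Q
  inv_param : ∀ p ∈ invariantRegion i, (k (param p)).inv = p
  param_inv : ∀ q ∈ Q, (k q).inv ∈ invariantRegion i → param (k q).inv = q
  continuousAt_param : ∀ p ∈ invariantRegion i, ContinuousAt param p
  τ_pos : ∀ p ∈ invariantRegion i, 0 < τ p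
  lipschitzAt_τ : ∀ p ∈ invariantRegion i, LipschitzAt τ p
  kappa_eq : ∀ p (hp : p ∈ invariantRegion i), kappa i p = diagGL (τ p) (τ_pos p hp) • k (param p)

/-- Each branch of the maximum is smooth where its own variable is non-zero. If one variable
vanishes at p ≠ 0, the other branch strictly dominates nearby, so the singular branch is never seen.
On the locus where the branches agree only Lipschitz regularity survives. -/
theorem lipschitzAt_dilation {p : ℝ × ℝ} (hp : p ≠ 0) : LipschitzAt dilation p := by
  have h1 : p.1 ≠ 0 → ContDiffAt ℝ 1 (fun p : ℝ × ℝ => √|p.1|) p := by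
    intro h
    have : ContDiffAt ℝ 1 (fun p : ℝ × ℝ => |p.1|) p :=
      (contDiffAt_abs h).comp p contDiffAt_fst
    exact this.sqrt (abs_pos.2 h).ne'
  have h2 : p.2 ≠ 0 → ContDiffAt ℝ 1 (fun p : ℝ × ℝ => (|p.2| / 2) ^ ((1 : ℝ) / 3)) p := by
    intro h
    have : ContDiffAt ℝ 1 (fun p : ℝ × ℝ => |p.2| / 2) p :=
      ((contDiffAt_abs h).comp p contDiffAt_snd).div_const 2
    exact this.rpow_const_of_ne (by have := abs_pos.2 h; positivity)
  have c1 : ContinuousAt (fun p : ℝ × ℝ => √|p.1|) p := by fun_prop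
  have c2 : ContinuousAt (fun p : ℝ × ℝ => (|p.2| / 2) ^ ((1 : ℝ) / 3)) p :=
    ContinuousAt.rpow_const (by fun_prop) (Or.inr (by norm_num))
  by_cases hp1 : p.1 = 0
  · have hp2 : p.2 ≠ 0 := fun h => hp (Prod.ext hp1 h)
    refine (lipschitzAt_of_contDiffAt (h2 hp2)).congr ?_
    have : √|p.1| < (|p.2| / 2) ^ ((1 : ℝ) / 3) := by
      rw [hp1]
      have := abs_pos.2 hp2
      simp only [abs_zero, Real.sqrt_zero]
      positivity
    filter_upwards [c1.eventually_lt c2 this] with y hy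
    exact max_eq_right hy.le
  · by_cases hp2 : p.2 = 0
    · refine (lipschitzAt_of_contDiffAt (h1 hp1)).congr ?_
      have : (|p.2| / 2) ^ ((1 : ℝ) / 3) < √|p.1| := by
        rw [hp2]
        have := abs_pos.2 hp1
        simp only [abs_zero, zero_div]
        rw [Real.zero_rpow (by norm_num)]
        positivity
      filter_upwards [c2.eventually_lt c1 this] with y hy
      exact max_eq_left hy.le
    · exact (lipschitzAt_of_contDiffAt (h1 hp1)).max (lipschitzAt_of_contDiffAt (h2 hp2))

theorem ne_zero_of_mem_invariantRegion {i : Kind} {p : ℝ × ℝ} (hp : p ∈ invariantRegion i) :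
    p ≠ 0 := by
  rintro rfl
  simp [invariantRegion, disc] at hp

/-- The slice `x³y - I/3 xy³ - J/27 y⁴`. -/
def cubicForm (q : ℝ × ℝ) : Quartic := ⟨0, 1, 0, -q.1 / 3, -q.2 / 27⟩

theorem cubicForm_inv (q : ℝ × ℝ) : (cubicForm q).inv = q := by
  ext <;> simp only [cubicForm, Quartic.inv, Quartic.invI, Quartic.invJ] <;> ring

/-- The system is triangular: the first three equations give β = 0, α = 0, γ = 0 in turn, and the
last two then read off v. -/
theorem cubicForm_transverseAt (q : ℝ × ℝ) : TransverseAt cubicForm q := by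
  intro v α β γ a' b' c' d' e' ha hb hc hd he h1 h2 h3 h4 h5
  have ha' := ha.unique (hasDerivAt_const (0 : ℝ) (0 : ℝ))
  have hb' := hb.unique (hasDerivAt_const (0 : ℝ) (1 : ℝ))
  have hc' := hc.unique (hasDerivAt_const (0 : ℝ) (0 : ℝ))
  have hd' : d' = -v.1 / 3 := by
    refine hd.unique ?_
    have : HasDerivAt (fun s : ℝ => -(q.1 + s * v.1) / 3) (-(1 * v.1) / 3) 0 :=
      ((((hasDerivAt_id (0 : ℝ)).mul_const v.1).const_add q.1).neg).div_const 3
    rw [one_mul] at this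
    exact this
  have he' : e' = -v.2 / 27 := by
    refine he.unique ?_
    have : HasDerivAt (fun s : ℝ => -(q.2 + s * v.2) / 27) (-(1 * v.2) / 27) 0 :=
      ((((hasDerivAt_id (0 : ℝ)).mul_const v.2).const_add q.2).neg).div_const 27
    rw [one_mul] at this
    exact this
  subst ha' hb' hc' hd' he'
  simp only [cubicForm] at h1 h2 h3 h4 h5
  have hβ : β = 0 := by linarith
  subst hβ
  have hα : α = 0 := by linarith
  subst hα
  have hγ : γ = 0 := by linarith
  subst hγ
  exact ⟨rfl, rfl, rfl, Prod.ext (by simp; linarith) (by simp; linarith)⟩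

/-- The slice for forms with a real root. -/
def cubicSlice (i : Kind) (hi : ∀ p, baseForm i p = cubicForm p) : Slice i where
  k := cubicForm
  Q := Set.univ
  param := id
  τ := dilation
  ha := contDiff_const
  hb := contDiff_const
  hc := contDiff_const
  hd := by simp only [cubicForm]; fun_prop
  he := by simp only [cubicForm]; fun_prop
  isOpen_Q := isOpen_univ
  transverse q _ := cubicForm_transverseAt q
  param_mem _ _ := Set.mem_univ _
  inv_param p _ := cubicForm_inv p
  param_inv q _ _ := cubicForm_inv q
  continuousAt_param _ _ := continuousAt_id
  τ_pos _ hp := dilation_pos hp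
  lipschitzAt_τ _ hp := lipschitzAt_dilation (ne_zero_of_mem_invariantRegion hp)
  kappa_eq p hp := by
    have hm := dilation_pos hp
    unfold kappa
    rw [hi, Quartic.gl_smul_def]
    simp only [diagGL, Matrix.GeneralLinearGroup.mkOfDetNeZero, cubicForm, id]
    ext <;> simp [Quartic.subst, Quartic.scale] <;> field_simp

/-- The slice `±m (x⁴/16 - s x³y + x²y²/2 + y⁴)`. -/
def definiteForm (σ : ℝ) (q : ℝ × ℝ) : Quartic :=
  ⟨σ * q.1 * (1 / 16), σ * q.1 * (-q.2), σ * q.1 * (1 / 2), 0, σ * q.1⟩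

theorem definiteForm_inv {σ : ℝ} (hσ : σ ^ 2 = 1) (q : ℝ × ℝ) :
    (definiteForm σ q).inv = (q.1 ^ 2, σ * q.1 ^ 3 * (2 - 27 * q.2 ^ 2)) := by
  ext
  · simp only [definiteForm, Quartic.inv, Quartic.invI]
    linear_combination q.1 ^ 2 * hσ
  · simp only [definiteForm, Quartic.inv, Quartic.invJ]
    linear_combination σ * q.1 ^ 3 * (2 - 27 * q.2 ^ 2) * hσ

/-- Eliminating v.1, γ and α from the equations for a, c, d, e leaves q.1·q.2·β = 0. Positivity of
q.2, which keeps away from the end J = 2σm³ (m the dilation) of the family, is what makes the linear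
system non-degenerate. -/
theorem definiteForm_transverseAt {σ : ℝ} (hσ : σ ^ 2 = 1) {q : ℝ × ℝ} (h1 : 0 < q.1)
    (h2 : 0 < q.2) : TransverseAt (definiteForm σ) q := by
  have hσ0 : σ ≠ 0 := by rintro rfl; norm_num at hσ
  intro v α β γ a' b' c' d' e' ha hb hc hd he e1 e2 e3 e4 e5
  have l1 : HasDerivAt (fun s : ℝ => σ * (q.1 + s * v.1)) (σ * v.1) 0 := by
    simpa using! (((hasDerivAt_id (0 : ℝ)).mul_const v.1).const_add q.1).const_mul σ
  have l2 : HasDerivAt (fun s : ℝ => -(q.2 + s * v.2)) (-v.2) 0 := by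
    exact ((((hasDerivAt_id (0 : ℝ)).mul_const v.2).const_add q.2).neg).congr_deriv (by simp)
  have ha' := ha.unique (l1.mul_const (1 / 16))
  have hb' := hb.unique (l1.mul l2)
  have hc' := hc.unique (l1.mul_const (1 / 2))
  have hd' := hd.unique (hasDerivAt_const (0 : ℝ) (0 : ℝ))
  have he' := he.unique l1
  simp only [zero_smul, add_zero, zero_mul] at hb'
  subst ha' hb' hc' hd' he'
  simp only [definiteForm] at e1 e2 e3 e4 e5
  have r1 : σ * (v.1 * (1 / 16) + q.1 * (α / 4 - q.2 * β)) = 0 := by linear_combination e1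
  have r2 : σ * (-v.1 * q.2 - q.1 * v.2 + q.1 * (γ / 4 - 2 * q.2 * α + β)) = 0 := by
    linear_combination e2
  have r3 : σ * (v.1 / 2 - 3 * q.1 * q.2 * γ) = 0 := by linear_combination e3
  have r4 : σ * (q.1 * (γ + 4 * β)) = 0 := by linear_combination e4
  have r5 : σ * (v.1 - 4 * q.1 * α) = 0 := by linear_combination e5
  replace r1 := (mul_eq_zero.1 r1).resolve_left hσ0
  replace r2 := (mul_eq_zero.1 r2).resolve_left hσ0
  replace r3 := (mul_eq_zero.1 r3).resolve_left hσ0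
  replace r4 := (mul_eq_zero.1 ((mul_eq_zero.1 r4).resolve_left hσ0)).resolve_left h1.ne'
  replace r5 := (mul_eq_zero.1 r5).resolve_left hσ0
  have s1 : q.1 * (α + 6 * q.2 * β) = 0 := by
    linear_combination (1 / 2) * r3 - (1 / 4) * r5 + (3 / 2) * q.1 * q.2 * r4
  have s2 := (mul_eq_zero.1 s1).resolve_left h1.ne'
  have s3 : q.1 * q.2 * β = 0 := by
    linear_combination (-1 / 4) * r1 + (1 / 64) * r5 + (1 / 8) * q.1 * s2
  have hβ : β = 0 := (mul_eq_zero.1 s3).resolve_left (by positivity)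
  subst hβ
  have hα : α = 0 := by linarith
  subst hα
  have hγ : γ = 0 := by linarith
  subst hγ
  have hv1 : v.1 = 0 := by linarith
  have hv2 : v.2 = 0 := by
    rw [hv1] at r2
    have : q.1 * v.2 = 0 := by linarith
    exact (mul_eq_zero.1 this).resolve_left h1.ne'
  exact ⟨rfl, rfl, rfl, Prod.ext hv1 hv2⟩

/-- The inequality J² < 4I³ says that the `I` branch strictly wins the maximum that defines
`dilation`. -/
theorem dilation_sq_of_disc_pos {p : ℝ × ℝ} (h : 0 < disc p) :
    p.1 = dilation p ^ 2 ∧ |p.2| < 2 * dilation p ^ 3 := by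
  obtain ⟨b1, b2, b3⟩ := dilation_bounds (p := p)
  have hm : 0 < dilation p := dilation_pos (i := .zero) (by simpa [invariantRegion, Kind.sign])
  have h' : p.2 ^ 2 < 4 * p.1 ^ 3 := by
    simp only [disc] at h
    linarith
  have hI : 0 < p.1 := by
    by_contra h0
    have : p.1 ^ 3 ≤ 0 := by
      have h1 : p.1 ≤ 0 := not_lt.1 h0
      nlinarith [sq_nonneg p.1]
    nlinarith [sq_nonneg p.2]
  rw [abs_of_pos hI] at b1 b3
  have c1 : p.1 ^ 3 ≤ dilation p ^ 6 := by
    calc p.1 ^ 3 ≤ (dilation p ^ 2) ^ 3 := pow_le_pow_left₀ hI.le b1 3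
      _ = dilation p ^ 6 := by ring
  have c2 : |p.2| < 2 * dilation p ^ 3 := abs_lt_of_sq_lt_sq (by nlinarith) (by positivity)
  exact ⟨b3.resolve_right c2.ne, c2⟩

/-- The slice for definite forms. -/
def definiteSlice (i : Kind) (σ : ℝ) (hσ : σ ^ 2 = 1) (hs : i.sign = 1)
    (hi : ∀ p, baseForm i p = definiteForm σ (1, √((2 - σ * p.2) / 27))) : Slice i where
  k := definiteForm σ
  Q := {q | 0 < q.1 ∧ 0 < q.2}
  param p := (dilation p, √((2 - σ * (p.2 / dilation p ^ 3)) / 27))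
  τ _ := 1
  ha := by simp only [definiteForm]; fun_prop
  hb := by simp only [definiteForm]; fun_prop
  hc := by simp only [definiteForm]; fun_prop
  hd := contDiff_const
  he := by simp only [definiteForm]; fun_prop
  isOpen_Q := (isOpen_lt continuous_const continuous_fst).inter
    (isOpen_lt continuous_const continuous_snd)
  transverse q hq := definiteForm_transverseAt hσ hq.1 hq.2
  param_mem p hp := by
    have hd : 0 < disc p := by simpa [invariantRegion, hs] using hp
    have hm := dilation_pos hp
    refine ⟨hm, Real.sqrt_pos.2 (div_pos ?_ (by norm_num))⟩
    have h2 := (dilation_sq_of_disc_pos hd).2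
    have h3 : |σ * (p.2 / dilation p ^ 3)| < 2 := by
      have : |σ| = 1 := by rwa [← sq_eq_sq₀ (abs_nonneg _) zero_le_one, sq_abs, one_pow]
      rw [abs_mul, this, one_mul, abs_div, abs_of_pos (by positivity : 0 < dilation p ^ 3),
        div_lt_iff₀ (by positivity)]
      exact h2
    have := (abs_lt.1 h3).2
    linarith
  inv_param p hp := by
    obtain ⟨k1, k2, -⟩ := kappa_spec hp
    have : kappa i p = definiteForm σ
        (dilation p, √((2 - σ * (p.2 / dilation p ^ 3)) / 27)) := by
      rw [kappa, hi]
      ext <;> simp [definiteForm, Quartic.scale] <;> ring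
    rw [← this, Quartic.inv, k1, k2]
  param_inv q hq hp := by
    have hd : 0 < disc (definiteForm σ q).inv := by simpa [invariantRegion, hs] using hp
    have h1 := (dilation_sq_of_disc_pos hd).1
    have hm := dilation_pos hp
    have hdil : dilation (definiteForm σ q).inv = q.1 := by
      rw [← sq_eq_sq₀ hm.le hq.1.le, ← h1, definiteForm_inv hσ]
    have hq1 := hq.1
    rw [hdil]
    refine Prod.ext rfl ?_
    simp only
    rw [Real.sqrt_eq_iff_mul_self_eq_of_pos hq.2, definiteForm_inv hσ]
    field_simp
    linear_combination (2 - 27 * q.2 ^ 2) * hσ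
  continuousAt_param p hp := by
    have h1 := (lipschitzAt_dilation (ne_zero_of_mem_invariantRegion hp)).continuousAt
    have hm := dilation_pos hp
    refine h1.prodMk ?_
    refine Real.continuous_sqrt.continuousAt.comp ?_
    refine ContinuousAt.div_const (continuousAt_const.sub (continuousAt_const.mul ?_)) _
    exact continuousAt_snd.div (h1.pow 3) (by positivity)
  τ_pos _ _ := one_pos
  lipschitzAt_τ _ _ := lipschitzAt_of_contDiffAt contDiffAt_const
  kappa_eq p hp := by
    rw [kappa, hi, Quartic.gl_smul_def]
    simp only [diagGL, Matrix.GeneralLinearGroup.mkOfDetNeZero]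
    ext <;> simp [definiteForm, Quartic.scale, Quartic.subst] <;> ring

/-- A slice for each kind. -/
def slice : (i : Kind) → Slice i
  | .zero => cubicSlice .zero fun _ => rfl
  | .one => cubicSlice .one fun _ => rfl
  | .twoPos => definiteSlice .twoPos 1 (by norm_num) rfl fun p => by
      ext <;> simp [baseForm, definiteForm]
  | .twoNeg => definiteSlice .twoNeg (-1) (by norm_num) rfl fun p => by
      ext <;> simp [baseForm, definiteForm, Quartic.scale]

/-! ### The weight on the space of orbit parameters -/

/-- The lift of a function on `PGL₂(ℝ)` to matrices. -/
def liftPGL (η : PGL(2, ℝ) → ℝ) (m : Fin 2 → Fin 2 → ℝ) : ℝ :=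
  if h : (Matrix.of m).det ≠ 0 then
    η (Matrix.ProjGenLinGroup.mk (Matrix.GeneralLinearGroup.mkOfDetNeZero (Matrix.of m) h))
  else 0

theorem liftPGL_val (η : PGL(2, ℝ) → ℝ) (g : GL (Fin 2) ℝ) :
    liftPGL η (fun i j => g.1 i j) = η (Matrix.ProjGenLinGroup.mk g) := by
  have h : (Matrix.of fun i j => g.1 i j).det ≠ 0 := det_val_ne_zero g
  rw [liftPGL, dif_pos h]
  congr 2
  exact Units.ext rfl

/-- Multiplication of the first column of a matrix by a real number. -/
def colScale (t : ℝ) (m : Fin 2 → Fin 2 → ℝ) : Fin 2 → Fin 2 → ℝ :=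
  fun i j => m i j * if j = 0 then t else 1

theorem det_colScale (t : ℝ) (m : Fin 2 → Fin 2 → ℝ) :
    (Matrix.of (colScale t m)).det = t * (Matrix.of m).det := by
  simp [Matrix.det_fin_two, colScale]; ring

theorem colScale_colScale_inv {t : ℝ} (ht : t ≠ 0) (m : Fin 2 → Fin 2 → ℝ) :
    colScale t (colScale t⁻¹ m) = m := by
  ext i j
  fin_cases j <;> simp [colScale, ht]

theorem mul_diagGL (g : GL (Fin 2) ℝ) {t : ℝ} (ht : 0 < t) :
    (fun i j => (g * diagGL t ht).1 i j) = colScale t (fun i j => g.1 i j) := by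
  ext i j
  fin_cases j <;>
  simp [diagGL, Matrix.GeneralLinearGroup.mkOfDetNeZero, Matrix.mul_apply, colScale]

/-- A cutoff function for the determinant, equal to one at `±1`. -/
def detCutoff (D : ℝ) : ℝ := max 0 (1 - 2 * |(|D| - 1)|)

theorem detCutoff_eq_one {D : ℝ} (h : D ^ 2 = 1) : detCutoff D = 1 := by
  have : |D| = 1 := by rwa [← sq_eq_sq₀ (abs_nonneg _) zero_le_one, sq_abs, one_pow]
  simp [detCutoff, this]

theorem mem_Icc_of_detCutoff_ne_zero {D : ℝ} (h : detCutoff D ≠ 0) :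
    |D| ∈ Set.Icc (1 / 2 : ℝ) 2 := by
  have h1 : 0 < 1 - 2 * |(|D| - 1)| := by
    by_contra h'
    exact h (max_eq_left (not_lt.1 h'))
  have h2 := abs_lt.1 (by linarith : |(|D| - 1)| < 1 / 2)
  exact ⟨by linarith, by linarith⟩

theorem locallyLipschitz_detCutoff : LocallyLipschitz detCutoff := by
  have h1 : LocallyLipschitz (fun x : ℝ => |x|) := lipschitzWith_one_norm.locallyLipschitz
  have h2 : LocallyLipschitz (fun x : ℝ => x - 1) :=
    ContDiff.locallyLipschitz (𝕂 := ℝ) (by fun_prop)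
  have h3 : LocallyLipschitz (fun x : ℝ => 1 - 2 * x) :=
    ContDiff.locallyLipschitz (𝕂 := ℝ) (by fun_prop)
  exact (h3.comp (h1.comp (h2.comp h1))).const_max 0

open Classical in
/-- The weight on orbit parameters whose fibre sums are twice the values of `Psi`. -/
def weight {i : Kind} (S : Slice i) (η : PGL(2, ℝ) → ℝ) (w : ℝ × ℝ → ℝ) (x : OrbitParam) : ℝ :=
  if x.2 ∈ S.Q then detCutoff (Matrix.of x.1).det *
    liftPGL η (colScale (S.τ (S.k x.2).inv)⁻¹ x.1) * w (S.k x.2).inv else 0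

/-! ### Compact support and Lipschitz continuity of the weight -/

variable {i : Kind}

theorem Slice.contDiff_inv (S : Slice i) : ContDiff ℝ 1 fun q => (S.k q).inv := by
  have ha := S.ha
  have hb := S.hb
  have hc := S.hc
  have hd := S.hd
  have he := S.he
  unfold Quartic.inv Quartic.invI Quartic.invJ
  fun_prop

/-- A matrix in the support is u·γ'·diag(τ, 1) with γ' in the compact set attached to η. Its
determinant is pinned to 1/2 ≤ |det| ≤ 2 by the cutoff, so u is determined up to sign, and the
support lies in the continuous image of a product of compact sets. -/
theorem exists_compact_weight (S : Slice i) {η : PGL(2, ℝ) → ℝ}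
    (hη : CompactlySupportedOnPGL η) {w : ℝ × ℝ → ℝ} (hwc : HasCompactSupport w)
    (hws : tsupport w ⊆ unitRegion i) :
    ∃ Z : Set OrbitParam, IsCompact Z ∧ (∀ x, x ∉ Z → weight S η w x = 0) ∧
      ∀ x ∈ Z, (Matrix.of x.1).det ≠ 0 ∧ x.2 ∈ S.Q ∧ (S.k x.2).inv ∈ unitRegion i := by
  obtain ⟨K, hK, hKdet, hKη⟩ := hη
  set f : (Fin 2 → Fin 2 → ℝ) × ℝ × ℝ × (ℝ × ℝ) → OrbitParam := fun z =>
    (fun a b => z.2.2.1 * √(z.2.1 / (|(Matrix.of z.1).det| * S.τ z.2.2.2)) *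
      (z.1 a b * if b = 0 then S.τ z.2.2.2 else 1), S.param z.2.2.2) with hf
  set Y : Set ((Fin 2 → Fin 2 → ℝ) × ℝ × ℝ × (ℝ × ℝ)) :=
    K ×ˢ (Set.Icc (1 / 2 : ℝ) 2 ×ˢ (({1, -1} : Set ℝ) ×ˢ tsupport w)) with hY
  have hreg : ∀ p ∈ tsupport w, p ∈ invariantRegion i := fun p hp => (hws hp).1
  have hYc : IsCompact Y := hK.prod (isCompact_Icc.prod ((Set.toFinite _).isCompact.prod hwc))
  have hfc : ContinuousOn f Y := by
    intro z hz
    obtain ⟨hz1, hz2, hz3, hz4⟩ := hz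
    have hp := hreg _ hz4
    have hτ : ContinuousAt (fun z : (Fin 2 → Fin 2 → ℝ) × ℝ × ℝ × (ℝ × ℝ) => S.τ z.2.2.2) z :=
      ContinuousAt.comp (f := fun z : (Fin 2 → Fin 2 → ℝ) × ℝ × ℝ × (ℝ × ℝ) => z.2.2.2)
        (S.lipschitzAt_τ _ hp).continuousAt (by fun_prop)
    have hpar : ContinuousAt (fun z : (Fin 2 → Fin 2 → ℝ) × ℝ × ℝ × (ℝ × ℝ) =>
        S.param z.2.2.2) z :=
      ContinuousAt.comp (f := fun z : (Fin 2 → Fin 2 → ℝ) × ℝ × ℝ × (ℝ × ℝ) => z.2.2.2)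
        (S.continuousAt_param _ hp) (by fun_prop)
    have hdet : ContinuousAt (fun z : (Fin 2 → Fin 2 → ℝ) × ℝ × ℝ × (ℝ × ℝ) =>
        |(Matrix.of z.1).det|) z := by
      simp only [Matrix.det_fin_two, Matrix.of_apply]
      fun_prop
    have hne : |(Matrix.of z.1).det| * S.τ z.2.2.2 ≠ 0 :=
      mul_ne_zero (abs_ne_zero.2 (hKdet _ hz1)) (S.τ_pos _ hp).ne'
    have hsq : ContinuousAt (fun z : (Fin 2 → Fin 2 → ℝ) × ℝ × ℝ × (ℝ × ℝ) =>
        √(z.2.1 / (|(Matrix.of z.1).det| * S.τ z.2.2.2))) z :=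
      Real.continuous_sqrt.continuousAt.comp
        (ContinuousAt.div (by fun_prop) (hdet.mul hτ) hne)
    refine ContinuousAt.continuousWithinAt (ContinuousAt.prodMk ?_ hpar)
    refine continuousAt_pi.2 fun a => continuousAt_pi.2 fun b => ?_
    by_cases hb : b = 0
    · simp only [hb, if_true]
      exact (ContinuousAt.mul (by fun_prop) hsq).mul (ContinuousAt.mul (by fun_prop) hτ)
    · simp only [hb, if_false]
      exact (ContinuousAt.mul (by fun_prop) hsq).mul (by fun_prop)
  refine ⟨f '' Y, hYc.image_of_continuousOn hfc, ?_, ?_⟩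
  · intro x hx
    by_contra h0
    apply hx
    obtain ⟨γ, q⟩ := x
    unfold weight at h0
    simp only at h0
    split_ifs at h0 with hq
    swap
    · exact absurd rfl h0
    have hw0 := right_ne_zero_of_mul h0
    have h1 := left_ne_zero_of_mul h0
    have hl0 := right_ne_zero_of_mul h1
    have hd0 := left_ne_zero_of_mul h1
    set p := (S.k q).inv with hp
    have hpw : p ∈ tsupport w := subset_tsupport _ hw0
    have hpr := hreg p hpw
    have hτ := S.τ_pos p hpr
    unfold liftPGL at hl0
    split_ifs at hl0 with hdet
    swap
    · exact absurd rfl hl0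
    obtain ⟨γ', hγ', hγK⟩ := hKη _ hl0
    obtain ⟨u, hu⟩ := Matrix.ProjGenLinGroup.mk_eq_mk_iff.1 hγ'
    have hu' : ∀ a b, γ'.1 a b * (u : ℝ) = colScale (S.τ p)⁻¹ γ a b := by
      intro a b
      have := congrArg (fun g : GL (Fin 2) ℝ => g.1 a b) hu
      simpa [Matrix.GeneralLinearGroup.mkOfDetNeZero, Matrix.mul_apply,
        Matrix.scalar_apply, Matrix.diagonal_apply] using this
    have hγ : ∀ a b, γ a b = u * (γ'.1 a b * if b = 0 then S.τ p else 1) := by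
      intro a b
      have := congrFun (congrFun (colScale_colScale_inv hτ.ne' γ) a) b
      rw [← this]
      unfold colScale
      have h2 := hu' a b
      unfold colScale at h2
      rw [← h2]
      ring
    have hdetγ : (Matrix.of γ).det = u ^ 2 * (γ'.1.det * S.τ p) := by
      simp only [Matrix.det_fin_two, Matrix.of_apply, hγ]
      simp
      ring
    have hdγ' := det_val_ne_zero γ'
    -- From det γ = u²·τ·det γ' the scalar is recovered as sign(u)·√(|det γ| / (|det γ'|τ)).
    refine ⟨(fun a b => γ'.1 a b, |(Matrix.of γ).det|, SignType.sign (u : ℝ), p),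
      ⟨hγK, mem_Icc_of_detCutoff_ne_zero hd0, ?_, hpw⟩, ?_⟩
    · rcases lt_or_gt_of_ne u.ne_zero with h | h
      · simp [sign_neg h]
      · simp [sign_pos h]
    · refine Prod.ext ?_ (S.param_inv q hq hpr)
      simp only [hf]
      have e1 : |(Matrix.of γ).det| / (|(Matrix.of fun a b => γ'.1 a b).det| * S.τ p)
          = (u : ℝ) ^ 2 := by
        have : (Matrix.of fun a b => γ'.1 a b).det = γ'.1.det := rfl
        rw [this, hdetγ, abs_mul, abs_mul, abs_of_pos hτ, abs_of_nonneg (sq_nonneg (u : ℝ))]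
        have := abs_ne_zero.2 hdγ'
        field_simp
      ext a b
      rw [e1, Real.sqrt_sq_eq_abs, hγ a b, sign_mul_abs]
  · rintro x ⟨z, ⟨hz1, hz2, hz3, hz4⟩, rfl⟩
    have hp := hreg _ hz4
    have hτ := S.τ_pos _ hp
    refine ⟨?_, S.param_mem _ hp, ?_⟩
    · simp only [hf]
      have : (Matrix.of fun a b => z.2.2.1 * √(z.2.1 / (|(Matrix.of z.1).det| * S.τ z.2.2.2)) *
          (z.1 a b * if b = 0 then S.τ z.2.2.2 else 1)).det
          = (z.2.2.1 * √(z.2.1 / (|(Matrix.of z.1).det| * S.τ z.2.2.2))) ^ 2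
            * ((Matrix.of z.1).det * S.τ z.2.2.2) := by
        simp [Matrix.det_fin_two]
        ring
      rw [this]
      have h1 := hKdet _ hz1
      have h2 : z.2.2.1 ≠ 0 := by
        rcases hz3 with h | h <;> (rw [h]; norm_num)
      have h3 : 0 < z.2.1 := lt_of_lt_of_le (by norm_num) hz2.1
      have h4 : √(z.2.1 / (|(Matrix.of z.1).det| * S.τ z.2.2.2)) ≠ 0 := by
        have := abs_pos.2 h1
        positivity
      exact mul_ne_zero (pow_ne_zero _ (mul_ne_zero h2 h4)) (mul_ne_zero h1 hτ.ne')
    · simp only [hf]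
      rw [S.inv_param _ hp]
      exact hws hz4

/-- At points of the compact set `Z` every factor is Lipschitz, since there the matrix is invertible
and the parameter lies in the open set `S.Q`. Off `Z` the weight vanishes on an open set, so the
case distinction in its definition does no harm. -/
theorem locallyLipschitz_weight (S : Slice i) {η : PGL(2, ℝ) → ℝ} (hηs : SmoothOnPGL η)
    (hη : CompactlySupportedOnPGL η) {w : ℝ × ℝ → ℝ} (hw : ContDiff ℝ ∞ w)
    (hwc : HasCompactSupport w) (hws : tsupport w ⊆ unitRegion i) :
    LocallyLipschitz (weight S η w) := by
  obtain ⟨Z, hZ, hZ0, hZU⟩ := exists_compact_weight S hη hwc hws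
  intro x
  by_cases hx : x ∈ Z
  · obtain ⟨hdet, hQ, hP⟩ := hZU x hx
    change LipschitzAt _ x
    have hinv : LipschitzAt (fun x : OrbitParam => (S.k x.2).inv) x :=
      lipschitzAt_of_contDiffAt (S.contDiff_inv.comp contDiff_snd).contDiffAt
    have hτ0 := S.τ_pos _ hP.1
    have hτ : LipschitzAt (fun x : OrbitParam => S.τ (S.k x.2).inv) x :=
      LipschitzAt.comp (g := S.τ) (S.lipschitzAt_τ _ hP.1) hinv
    have hcol : LipschitzAt (fun x : OrbitParam => colScale (S.τ (S.k x.2).inv)⁻¹ x.1) x := by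
      refine LipschitzAt.comp (f := fun x : OrbitParam => (x.1, S.τ (S.k x.2).inv))
        (g := fun y : (Fin 2 → Fin 2 → ℝ) × ℝ => colScale y.2⁻¹ y.1)
        (lipschitzAt_of_contDiffAt ?_)
        ((lipschitzAt_of_contDiffAt contDiffAt_fst).prodMk hτ)
      refine contDiffAt_pi.2 fun a => contDiffAt_pi.2 fun b => ?_
      unfold colScale
      by_cases hb : b = 0
      · simp only [hb, if_true]
        exact ContDiffAt.mul (by fun_prop) (contDiffAt_snd.inv hτ0.ne')
      · simp only [hb, if_false]
        fun_prop
    have hlift : LipschitzAt (fun x : OrbitParam =>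
        liftPGL η (colScale (S.τ (S.k x.2).inv)⁻¹ x.1)) x := by
      refine LipschitzAt.comp (g := liftPGL η) (lipschitzAt_of_contDiffAt ?_) hcol
      have hopen : IsOpen {m : Fin 2 → Fin 2 → ℝ | (Matrix.of m).det ≠ 0} := by
        refine isOpen_ne.preimage ?_
        simp only [Matrix.det_fin_two, Matrix.of_apply]
        fun_prop
      have hmem : colScale (S.τ (S.k x.2).inv)⁻¹ x.1 ∈
          {m : Fin 2 → Fin 2 → ℝ | (Matrix.of m).det ≠ 0} := by
        change (Matrix.of _).det ≠ 0
        rw [det_colScale]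
        exact mul_ne_zero (inv_ne_zero hτ0.ne') hdet
      exact (ContDiffOn.contDiffAt hηs (hopen.mem_nhds hmem)).of_le (by exact_mod_cast le_top)
    have hcut : LipschitzAt (fun x : OrbitParam => detCutoff (Matrix.of x.1).det) x := by
      refine LipschitzAt.comp (g := detCutoff) (locallyLipschitz_detCutoff _)
        (lipschitzAt_of_contDiffAt ?_)
      simp only [Matrix.det_fin_two, Matrix.of_apply]
      fun_prop
    have hwL : LipschitzAt (fun x : OrbitParam => w (S.k x.2).inv) x :=
      LipschitzAt.comp (g := w) (lipschitzAt_of_contDiffAt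
        (hw.contDiffAt.of_le (by exact_mod_cast le_top))) hinv
    refine ((hcut.mul hlift).mul hwL).congr ?_
    have : ∀ᶠ y : OrbitParam in nhds x, y.2 ∈ S.Q :=
      continuous_snd.continuousAt.preimage_mem_nhds (S.isOpen_Q.mem_nhds hQ)
    filter_upwards [this] with y hy
    exact if_pos hy
  · refine ⟨0, Zᶜ, hZ.isClosed.isOpen_compl.mem_nhds hx, ?_⟩
    intro y hy z hz
    rw [hZ0 y hy, hZ0 z hz]
    simp

theorem fibreSummable_weight (S : Slice i) {η : PGL(2, ℝ) → ℝ} (hηs : SmoothOnPGL η)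
    (hη : CompactlySupportedOnPGL η) {w : ℝ × ℝ → ℝ} (hw : ContDiff ℝ ∞ w)
    (hwc : HasCompactSupport w) (hws : tsupport w ⊆ unitRegion i) :
    FibreSummable (orbitMap S.k) (weight S η w) ∧
      HasCompactSupport (fibreSum (orbitMap S.k) (weight S η w)) := by
  obtain ⟨Z, hZ, hZ0, hZU⟩ := exists_compact_weight S hη hwc hws
  have hcont := contDiff_orbitMap S.ha S.hb S.hc S.hd S.he
  have hsub : tsupport (weight S η w) ⊆ Z := by
    refine closure_minimal (fun x hx => ?_) hZ.isClosed
    by_contra h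
    exact hx (hZ0 x h)
  refine ⟨fibreSummable (locallyLipschitz_weight S hηs hη hw hwc hws)
    (HasCompactSupport.intro hZ hZ0) fun x hx => ?_, ?_⟩
  · obtain ⟨h1, h2, -⟩ := hZU x (hsub hx)
    refine hasLipschitzInverseAt_of_fderiv ?_ hcont ?_
    -- Both sides have dimension 6: 4 + 2 on the left, 5 + 1 on the right.
    · simp [Module.finrank_pi_fintype]
    · intro y hy
      exact fderiv_orbitMap_ker S.ha S.hb S.hc S.hd S.he h1 (S.transverse _ h2) hy
  · refine HasCompactSupport.intro (hZ.image hcont.continuous) fun v hv => ?_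
    apply finsum_mem_eq_zero_of_forall_eq_zero
    intro x hx
    by_contra h
    refine hv ⟨x, ?_, hx⟩
    by_contra h'
    exact h (hZ0 x h')

/-! ### `Psi` as a fibre sum -/

/-- Any matrix is divided by the square root of the absolute value of its determinant. -/
theorem exists_rep (g : PGL(2, ℝ)) :
    ∃ γ : GL (Fin 2) ℝ, Matrix.ProjGenLinGroup.mk γ = g ∧ γ.1.det ^ 2 = 1 := by
  induction g using Matrix.ProjGenLinGroup.induction_on with | mk g =>
  have hd := det_val_ne_zero g
  have hs : √|g.1.det| ≠ 0 := (Real.sqrt_pos.2 (abs_pos.2 hd)).ne'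
  set u : ℝˣ := Units.mk0 (√|g.1.det|)⁻¹ (inv_ne_zero hs) with hu
  refine ⟨g * Matrix.GeneralLinearGroup.scalar (Fin 2) u, ?_, ?_⟩
  · rw [map_mul, Matrix.ProjGenLinGroup.mk_scalar, mul_one]
  · have h1 : (√|g.1.det|) ^ 4 = g.1.det ^ 2 := by
      calc (√|g.1.det|) ^ 4 = ((√|g.1.det|) ^ 2) ^ 2 := by ring
        _ = g.1.det ^ 2 := by rw [Real.sq_sqrt (abs_nonneg _), sq_abs]
    have h2 : (g * Matrix.GeneralLinearGroup.scalar (Fin 2) u).1.det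
        = g.1.det * (√|g.1.det|)⁻¹ ^ 2 := by
      rw [Units.val_mul, Matrix.det_mul]
      simp [hu]
    rw [h2, mul_pow, ← h1]
    field_simp

/-- The two matrices differ by a real scalar u, and comparing squared determinants gives u⁴ = 1. -/
theorem eq_or_eq_neg_of_mk_eq {g h : GL (Fin 2) ℝ}
    (hgh : Matrix.ProjGenLinGroup.mk g = Matrix.ProjGenLinGroup.mk h)
    (hg : g.1.det ^ 2 = 1) (hh : h.1.det ^ 2 = 1) : h.1 = g.1 ∨ h.1 = -g.1 := by
  obtain ⟨u, hu⟩ := Matrix.ProjGenLinGroup.mk_eq_mk_iff.1 hgh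
  have h1 : h.1 = (u : ℝ) • g.1 := by
    rw [← hu]
    ext a b
    simp [Matrix.mul_apply, Matrix.diagonal_apply, mul_comm]
  have h2 : (u : ℝ) ^ 2 = 1 := by
    rw [h1, Matrix.det_smul, mul_pow, hg, mul_one, Fintype.card_fin] at hh
    have h3 : 0 ≤ (u : ℝ) ^ 2 := sq_nonneg _
    rw [← sq_eq_sq₀ h3 zero_le_one, one_pow, ← hh]
  rcases sq_eq_sq_iff_eq_or_eq_neg.1 (h2.trans (one_pow 2).symm) with h | h
  · left; rw [h1, h, one_smul]
  · right; rw [h1, h, neg_one_smul]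

theorem mk_neg (g : GL (Fin 2) ℝ) :
    Matrix.ProjGenLinGroup.mk (-g) = Matrix.ProjGenLinGroup.mk g := by
  refine (Matrix.ProjGenLinGroup.mk_eq_mk_iff.2 ⟨-1, ?_⟩).symm
  ext a b
  simp [Matrix.mul_apply, Matrix.diagonal_apply]

/-- The representative of determinant `±1` of an element of `PGL₂(ℝ)`. -/
def rep (g : PGL(2, ℝ)) : GL (Fin 2) ℝ := (exists_rep g).choose

theorem mk_rep (g : PGL(2, ℝ)) : Matrix.ProjGenLinGroup.mk (rep g) = g :=
  (exists_rep g).choose_spec.1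

theorem det_rep (g : PGL(2, ℝ)) : (rep g).1.det ^ 2 = 1 := (exists_rep g).choose_spec.2

theorem det_neg_val (g : GL (Fin 2) ℝ) : (-g).1.det = g.1.det := by
  rw [Units.val_neg, Matrix.det_neg]
  simp

open Classical in
/-- The diagonal element of `PGL₂(ℝ)` that takes the slice to the image of `kappa`. -/
def Slice.diag (S : Slice i) (p : ℝ × ℝ) : PGL(2, ℝ) :=
  if h : p ∈ invariantRegion i then Matrix.ProjGenLinGroup.mk (diagGL (S.τ p) (S.τ_pos p h)) else 1

theorem Slice.diag_smul (S : Slice i) {p : ℝ × ℝ} (hp : p ∈ invariantRegion i) :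
    S.diag p • S.k (S.param p) = kappa i p := by
  rw [Slice.diag, dif_pos hp, Quartic.pgl_mk_smul, S.kappa_eq p hp]

/-- The column scaling by τ⁻¹ cancels the diagonal matrix, so η is evaluated at g itself; the
determinant cutoff equals 1 on matrices of determinant ±1. -/
theorem weight_rep (S : Slice i) (η : PGL(2, ℝ) → ℝ) (w : ℝ × ℝ → ℝ) {p : ℝ × ℝ}
    (hp : p ∈ invariantRegion i) {g : PGL(2, ℝ)} {γ : GL (Fin 2) ℝ}
    (hγ : Matrix.ProjGenLinGroup.mk γ = g * S.diag p) (hd : γ.1.det ^ 2 = 1) :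
    weight S η w (fun a b => γ.1 a b, S.param p) = η g * w p := by
  have hτ := S.τ_pos p hp
  have h1 : γ.1.det = (Matrix.of fun a b => γ.1 a b).det := rfl
  rw [weight, if_pos (S.param_mem p hp), S.inv_param p hp]
  simp only
  rw [← h1, detCutoff_eq_one hd, one_mul]
  congr 1
  set γ' : GL (Fin 2) ℝ := γ * (diagGL (S.τ p) hτ)⁻¹ with hγ'
  have h2 : γ = γ' * diagGL (S.τ p) hτ := by rw [hγ', inv_mul_cancel_right]
  have h3 : colScale (S.τ p)⁻¹ (fun a b => γ.1 a b) = fun a b => γ'.1 a b := by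
    conv_lhs => rw [h2, mul_diagGL]
    ext a b
    fin_cases b <;> simp [colScale, hτ.ne']
  rw [h3, liftPGL_val, hγ', map_mul, map_inv, hγ, Slice.diag, dif_pos hp, mul_inv_cancel_right]

theorem Quartic.vec_injective : Function.Injective Quartic.vec := by
  intro f g h
  have h0 := congrFun h 0
  have h1 := congrFun h 1
  have h2 := congrFun h 2
  have h3 := congrFun h 3
  have h4 := congrFun h 4
  ext
  · exact h0
  · exact h1
  · exact h2
  · exact h3
  · exact h4

/-- A pair (g, p) with g • κ(p) = f corresponds to exactly two points of the fibres over (f, 1) and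
(f, -1), namely ±γ with γ representing g·diag(τ, 1). Both carry the weight η(g)w(p), whence the
factor 1/2. -/
theorem Psi_eq_fibreSum (S : Slice i) {η : PGL(2, ℝ) → ℝ} {w : ℝ × ℝ → ℝ}
    (hws : tsupport w ⊆ unitRegion i)
    (hfin : ∀ v, ({x | orbitMap S.k x = v} ∩ Function.support (weight S η w)).Finite)
    (f : Quartic) :
    Psi i η w f = 1 / 2 * (fibreSum (orbitMap S.k) (weight S η w) (f.vec, 1)
      + fibreSum (orbitMap S.k) (weight S η w) (f.vec, -1)) := by
  set ζ := weight S η w with hζ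
  set A : Set (PGL(2, ℝ) × (ℝ × ℝ)) := {y | y.2 ∈ unitRegion i ∧ y.1 • kappa i y.2 = f} with hA
  have hAreg : ∀ y ∈ A, y.2 ∈ invariantRegion i := fun y hy => hy.1.1
  have hAp : ∀ y ∈ A, y.2 = (f.invI, f.invJ) := by
    intro y hy
    obtain ⟨k1, k2, -⟩ := kappa_spec (hAreg y hy)
    rw [← hy.2, Quartic.invI_smul, Quartic.invJ_smul, k1, k2]
  set r : PGL(2, ℝ) × (ℝ × ℝ) → OrbitParam := fun y =>
    (fun a b => (rep (y.1 * S.diag y.2)).1 a b, S.param y.2) with hr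
  set r' : PGL(2, ℝ) × (ℝ × ℝ) → OrbitParam := fun y =>
    (fun a b => (-rep (y.1 * S.diag y.2)).1 a b, S.param y.2) with hr'
  have hζr : ∀ y ∈ A, ζ (r y) = η y.1 * w y.2 := fun y hy =>
    weight_rep S η w (hAreg y hy) (mk_rep _) (det_rep _)
  have hζr' : ∀ y ∈ A, ζ (r' y) = η y.1 * w y.2 := fun y hy =>
    weight_rep S η w (hAreg y hy) ((mk_neg _).trans (mk_rep _)) (by rw [det_neg_val, det_rep])
  -- All pairs in `A` have second entry equal to the invariants of f, so the outer factor of `Psi`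
  -- can be moved inside the sum.
  have hPsi : Psi i η w f = ∑ᶠ y ∈ A, η y.1 * w y.2 := by
    unfold Psi
    rw [mul_comm, ← smul_eq_mul, smul_finsum]
    refine finsum_congr fun y => ?_
    rw [smul_finsum]
    refine finsum_congr fun hy => ?_
    rw [smul_eq_mul, mul_comm, hAp y hy]
  set Fib : Set OrbitParam := {x | orbitMap S.k x = (f.vec, 1)} ∪ {x | orbitMap S.k x = (f.vec, -1)}
    with hFib
  have hFibsum : ∑ᶠ x ∈ Fib, ζ x = fibreSum (orbitMap S.k) ζ (f.vec, 1)
      + fibreSum (orbitMap S.k) ζ (f.vec, -1) := by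
    refine finsum_mem_union' ?_ (hfin _) (hfin _)
    refine Set.disjoint_left.2 fun x hx hx' => ?_
    have h1 : orbitMap S.k x = (f.vec, 1) := hx
    have h2 : orbitMap S.k x = (f.vec, -1) := hx'
    rw [h1] at h2
    have := congrArg Prod.snd h2
    norm_num at this
  have hFibfin : (Fib ∩ Function.support ζ).Finite := by
    rw [hFib, Set.union_inter_distrib_right]
    exact (hfin _).union (hfin _)
  have memFib : ∀ y ∈ A, ∀ γ : GL (Fin 2) ℝ, Matrix.ProjGenLinGroup.mk γ = y.1 * S.diag y.2 →
      γ.1.det ^ 2 = 1 → ((fun a b => γ.1 a b, S.param y.2) : OrbitParam) ∈ Fib := by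
    intro y hy γ hγ hd
    have h1 : (S.k (S.param y.2)).subst γ.1 = f := by
      rw [← Quartic.gl_smul_of_det_sq_eq_one hd, ← Quartic.pgl_mk_smul, hγ, mul_smul,
        S.diag_smul (hAreg y hy)]
      exact hy.2
    rcases sq_eq_sq_iff_eq_or_eq_neg.1 (hd.trans (one_pow 2).symm) with h | h
    · left; exact Prod.ext (congrArg Quartic.vec h1) h
    · right; exact Prod.ext (congrArg Quartic.vec h1) h
  -- Only points of non-zero weight need to come from a pair: for them the parameter lies in `S.Q`
  -- with invariants in the unit region, so that `param_inv` applies.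
  have hcover : ∀ x ∈ Fib, ζ x ≠ 0 → x ∈ r '' A ∪ r' '' A := by
    rintro ⟨γ, q⟩ hx h0
    have hsub : (S.k q).subst (Matrix.of γ) = f ∧ (Matrix.of γ).det ^ 2 = 1 := by
      rcases hx with h | h
      · exact ⟨Quartic.vec_injective (congrArg Prod.fst h), by
          rw [show (Matrix.of γ).det = 1 from congrArg Prod.snd h]; norm_num⟩
      · exact ⟨Quartic.vec_injective (congrArg Prod.fst h), by
          rw [show (Matrix.of γ).det = -1 from congrArg Prod.snd h]; norm_num⟩
    have hdet : (Matrix.of γ).det ≠ 0 := by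
      intro h
      have := hsub.2
      rw [h] at this
      norm_num at this
    set G : GL (Fin 2) ℝ := Matrix.GeneralLinearGroup.mkOfDetNeZero (Matrix.of γ) hdet with hG
    have hGv : G.1 = Matrix.of γ := rfl
    have hGf : G • S.k q = f := by
      rw [Quartic.gl_smul_of_det_sq_eq_one (by rw [hGv]; exact hsub.2), hGv, hsub.1]
    rw [hζ, weight] at h0
    simp only at h0
    split_ifs at h0 with hq
    swap
    · exact absurd rfl h0
    set p := (S.k q).inv with hp
    have hpU : p ∈ unitRegion i := hws (subset_tsupport _ (right_ne_zero_of_mul h0))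
    have hpq : S.param p = q := S.param_inv q hq hpU.1
    set y : PGL(2, ℝ) × (ℝ × ℝ) := (Matrix.ProjGenLinGroup.mk G * (S.diag p)⁻¹, p) with hy
    have hyA : y ∈ A := by
      refine ⟨hpU, ?_⟩
      simp only [hy]
      rw [← S.diag_smul hpU.1, hpq, smul_smul, inv_mul_cancel_right, Quartic.pgl_mk_smul, hGf]
    have hmk : Matrix.ProjGenLinGroup.mk (rep (y.1 * S.diag y.2)) = Matrix.ProjGenLinGroup.mk G := by
      rw [mk_rep]
      simp [hy]
    rcases eq_or_eq_neg_of_mk_eq hmk (det_rep _) (by rw [hGv]; exact hsub.2) with h | h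
    · left
      refine ⟨y, hyA, Prod.ext ?_ hpq⟩
      ext a b
      change (rep (y.1 * S.diag y.2)).1 a b = γ a b
      rw [← h]; rfl
    · right
      refine ⟨y, hyA, Prod.ext ?_ hpq⟩
      ext a b
      change (-rep (y.1 * S.diag y.2)).1 a b = γ a b
      rw [Units.val_neg, ← h]; rfl
  have hrFib : r '' A ∪ r' '' A ⊆ Fib := by
    rintro x (⟨y, hy, rfl⟩ | ⟨y, hy, rfl⟩)
    · exact memFib y hy _ (mk_rep _) (det_rep _)
    · exact memFib y hy _ ((mk_neg _).trans (mk_rep _)) (by rw [det_neg_val, det_rep])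
  have hsum : ∑ᶠ x ∈ Fib, ζ x = ∑ᶠ x ∈ r '' A ∪ r' '' A, ζ x := by
    refine finsum_mem_inter_support_eq ζ _ _ ?_
    ext x
    exact ⟨fun h => ⟨hcover x h.1 h.2, h.2⟩, fun h => ⟨hrFib h.1, h.2⟩⟩
  have hparam : ∀ y ∈ A, ∀ z ∈ A, S.param y.2 = S.param z.2 → y.2 = z.2 := by
    intro y hy z hz h
    rw [hAp y hy, hAp z hz]
  have hpgl : ∀ y ∈ A, ∀ z ∈ A, Matrix.ProjGenLinGroup.mk (rep (y.1 * S.diag y.2))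
      = Matrix.ProjGenLinGroup.mk (rep (z.1 * S.diag z.2)) → y = z := by
    intro y hy z hz h
    rw [mk_rep, mk_rep] at h
    have h2 : y.2 = z.2 := by rw [hAp y hy, hAp z hz]
    rw [h2] at h
    exact Prod.ext (mul_right_cancel h) h2
  have hinj : Set.InjOn r A := by
    intro y hy z hz h
    refine hpgl y hy z hz (congrArg _ (Units.ext ?_))
    ext a b
    exact congrFun (congrFun (congrArg Prod.fst h) a) b
  have hinj' : Set.InjOn r' A := by
    intro y hy z hz h
    refine hpgl y hy z hz (congrArg _ (neg_injective (Units.ext ?_)))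
    ext a b
    exact congrFun (congrFun (congrArg Prod.fst h) a) b
  -- A common point would give a representative equal to its own negative, hence zero, against its
  -- determinant being ±1.
  have hdisj : Disjoint (r '' A) (r' '' A) := by
    refine Set.disjoint_left.2 ?_
    rintro x ⟨y, hy, rfl⟩ ⟨z, hz, h⟩
    have h1 : -rep (z.1 * S.diag z.2) = rep (y.1 * S.diag y.2) := by
      refine Units.ext ?_
      ext a b
      exact congrFun (congrFun (congrArg Prod.fst h) a) b
    have h2 : y = z := by
      refine hpgl y hy z hz ?_
      rw [← h1, mk_neg]
    rw [h2] at h1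
    have h3 := congrArg (fun g : GL (Fin 2) ℝ => g.1) h1
    simp only [Units.val_neg] at h3
    have h4 : (rep (z.1 * S.diag z.2)).1 = 0 := by
      ext a b
      have := congrFun (congrFun h3 a) b
      simp only [Matrix.neg_apply] at this
      simp only [Matrix.zero_apply]
      linarith
    have h5 := det_rep (z.1 * S.diag z.2)
    rw [h4] at h5
    simp at h5
  have hfinsub : ∀ s ⊆ Fib, (s ∩ Function.support ζ).Finite := fun s hs =>
    hFibfin.subset (Set.inter_subset_inter_left _ hs)
  rw [← hFibsum, hsum, finsum_mem_union' hdisj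
    (hfinsub _ (Set.subset_union_left.trans hrFib))
    (hfinsub _ (Set.subset_union_right.trans hrFib)),
    finsum_mem_image hinj, finsum_mem_image hinj', hPsi,
    finsum_mem_congr rfl hζr, finsum_mem_congr rfl hζr']
  ring

/-- The quartic form with a given coefficient vector. -/
def ofVec (v : Fin 5 → ℝ) : Quartic := ⟨v 0, v 1, v 2, v 3, v 4⟩

theorem vec_ofVec (v : Fin 5 → ℝ) : (ofVec v).vec = v := by
  ext j
  fin_cases j <;> rfl

theorem Psi_lipschitz {η : PGL(2, ℝ) → ℝ} (hηs : SmoothOnPGL η)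
    (hη : CompactlySupportedOnPGL η) {w : ℝ × ℝ → ℝ} (hw : ContDiff ℝ ∞ w)
    (hwc : HasCompactSupport w) (hws : tsupport w ⊆ unitRegion i) :
    (∃ C, LipschitzWith C fun v => Psi i η w (ofVec v)) ∧
      HasCompactSupport fun v => Psi i η w (ofVec v) := by
  set S := slice i
  obtain ⟨⟨hfin, hLip⟩, hcs⟩ := fibreSummable_weight S hηs hη hw hwc hws
  set Φ := fibreSum (orbitMap S.k) (weight S η w) with hΦ
  have heq : (fun v => Psi i η w (ofVec v)) = fun v => 1 / 2 * (Φ (v, 1) + Φ (v, -1)) := by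
    ext v
    rw [Psi_eq_fibreSum S hws hfin, vec_ofVec]
  have hL : ∀ σ : ℝ, LocallyLipschitz fun v : Fin 5 → ℝ => Φ (v, σ) := fun σ =>
    hLip.comp (LocallyLipschitz.prodMk_right σ)
  have hcomp : HasCompactSupport fun v => Psi i η w (ofVec v) := by
    rw [heq]
    refine HasCompactSupport.intro (hcs.image continuous_fst) fun v hv => ?_
    have : ∀ σ : ℝ, Φ (v, σ) = 0 := by
      intro σ
      by_contra h
      exact hv ⟨(v, σ), subset_tsupport _ h, rfl⟩
    rw [this, this]
    norm_num
  refine ⟨exists_lipschitzWith_of_hasCompactSupport ?_ hcomp, hcomp⟩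
  rw [heq]
  exact LocallyLipschitz.mul_real (LocallyLipschitz.const _)
    (LocallyLipschitz.add_real (hL 1) (hL (-1)))

/-! ### Uniform bounds for the translates of `Psi` by unipotent elements -/

theorem unip_inv_smul (u : ℝ) (f : Quartic) :
    (unip u)⁻¹ • f = ⟨f.a, f.b - 4 * u * f.a, f.c - 3 * u * f.b + 6 * u ^ 2 * f.a,
      f.d - 2 * u * f.c + 3 * u ^ 2 * f.b - 4 * u ^ 3 * f.a,
      f.e - u * f.d + u ^ 2 * f.c - u ^ 3 * f.b + u ^ 4 * f.a⟩ := by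
  have h : (unip u)⁻¹ = unip (-u) := by
    rw [inv_eq_iff_mul_eq_one]
    ext a b
    fin_cases a <;> fin_cases b <;>
      simp [unip, Matrix.GeneralLinearGroup.mkOfDetNeZero, Matrix.mul_apply]
  rw [h, Quartic.gl_smul_def]
  simp only [unip, Matrix.GeneralLinearGroup.mkOfDetNeZero]
  ext <;> simp [Quartic.subst, Quartic.scale] <;> ring

/-- A function on the plane that is bounded, compactly supported, and Lipschitz. -/
structure LipBump (B K L : ℝ) (F : ℝ → ℝ → ℝ) : Prop where
  bound : ∀ x y, |F x y| ≤ B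
  support_fst : ∀ x y, F x y ≠ 0 → |x| ≤ K
  support_snd : ∀ x y, F x y ≠ 0 → |y| ≤ K
  lip : ∀ x y x' y', |F x y - F x' y'| ≤ L * (|x - x'| + |y - y'|)

/-- The action of the unipotent element is triangular with polynomial entries in u, and |u| ≤ 1/2.
Its inverse therefore bounds d and e on the support, while a, b, c drop out of differences; this
makes all constants uniform in a, b, c, u. -/
theorem exists_lipBump {i : Kind} {η : PGL(2, ℝ) → ℝ} (hηs : SmoothOnPGL η)
    (hη : CompactlySupportedOnPGL η) {w : ℝ × ℝ → ℝ} (hw : ContDiff ℝ ∞ w)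
    (hwc : HasCompactSupport w) (hws : tsupport w ⊆ unitRegion i) :
    ∃ B K L : ℝ, 0 ≤ B ∧ 0 ≤ K ∧ 0 ≤ L ∧ ∀ u a b c : ℝ, |u| ≤ 1 / 2 →
      LipBump B K L fun d e => Psi i η w ((unip u)⁻¹ • ⟨a, b, c, d, e⟩) := by
  obtain ⟨⟨L, hL⟩, hc⟩ := Psi_lipschitz (i := i) hηs hη hw hwc hws
  obtain ⟨R, hR⟩ := hc.isBounded.subset_closedBall (0 : Fin 5 → ℝ)
  obtain ⟨B, hB⟩ := hL.continuous.bounded_above_of_compact_support hc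
  have hsup : ∀ f : Quartic, Psi i η w f ≠ 0 → ∀ j, |f.vec j| ≤ max R 0 := by
    intro f hf j
    have h1 : f.vec ∈ Metric.closedBall (0 : Fin 5 → ℝ) R := hR (subset_tsupport _ hf)
    have h2 : ‖f.vec‖ ≤ R := by simpa using h1
    exact ((norm_le_pi_norm f.vec j).trans h2).trans (le_max_left _ _)
  have hbd : ∀ f : Quartic, |Psi i η w f| ≤ B := fun f => hB f.vec
  -- Solving back for d costs 1 + 2/2 + 3/4 + 4/8 < 4 times the radius; e costs less than twice the
  -- radius.
  refine ⟨B, 4 * max R 0, L, (abs_nonneg _).trans (hbd ⟨0, 0, 0, 0, 0⟩), by positivity,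
    L.2, ?_⟩
  intro u a b c hu
  have u1 := abs_le.1 hu
  have hu2 : |u ^ 2| ≤ 1 / 4 := by
    rw [abs_pow]; calc |u| ^ 2 ≤ (1 / 2) ^ 2 := by gcongr
      _ = 1 / 4 := by norm_num
  have hu3 : |u ^ 3| ≤ 1 / 8 := by
    rw [abs_pow]; calc |u| ^ 3 ≤ (1 / 2) ^ 3 := by gcongr
      _ = 1 / 8 := by norm_num
  have hu4 : |u ^ 4| ≤ 1 / 16 := by
    rw [abs_pow]; calc |u| ^ 4 ≤ (1 / 2) ^ 4 := by gcongr
      _ = 1 / 16 := by norm_num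
  have mulb : ∀ {x y m r : ℝ}, |x| ≤ m → |y| ≤ r → |x * y| ≤ m * r := by
    intro x y m r hx hy
    rw [abs_mul]
    exact mul_le_mul hx hy (abs_nonneg _) ((abs_nonneg _).trans hx)
  refine ⟨fun d e => hbd _, ?_, ?_, ?_⟩
  · intro d e h
    have hs := hsup _ h
    rw [unip_inv_smul] at hs
    simp only at hs
    have v0 := hs 0
    have v1 := hs 1
    have v2 := hs 2
    have v3 := hs 3
    simp only [Quartic.vec, Matrix.cons_val] at v0 v1 v2 v3
    set V0 := a
    set V1 := b - 4 * u * a with hV1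
    set V2 := c - 3 * u * b + 6 * u ^ 2 * a with hV2
    set V3 := d - 2 * u * c + 3 * u ^ 2 * b - 4 * u ^ 3 * a with hV3
    have hd : d = V3 + 2 * (u * V2) + 3 * (u ^ 2 * V1) + 4 * (u ^ 3 * V0) := by
      rw [hV3, hV2, hV1]; ring
    have m2 := abs_le.1 (mulb hu v2)
    have m1 := abs_le.1 (mulb hu2 v1)
    have m0 := abs_le.1 (mulb hu3 v0)
    have m3 := abs_le.1 v3
    have hR0 : 0 ≤ max R 0 := le_max_right _ _
    rw [hd, abs_le]
    constructor <;> linarith [m2.1, m2.2, m1.1, m1.2, m0.1, m0.2, m3.1, m3.2]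
  · intro d e h
    have hs := hsup _ h
    rw [unip_inv_smul] at hs
    simp only at hs
    have v0 := hs 0
    have v1 := hs 1
    have v2 := hs 2
    have v3 := hs 3
    have v4 := hs 4
    simp only [Quartic.vec, Matrix.cons_val] at v0 v1 v2 v3 v4
    set V0 := a
    set V1 := b - 4 * u * a with hV1
    set V2 := c - 3 * u * b + 6 * u ^ 2 * a with hV2
    set V3 := d - 2 * u * c + 3 * u ^ 2 * b - 4 * u ^ 3 * a with hV3
    set V4 := e - u * d + u ^ 2 * c - u ^ 3 * b + u ^ 4 * a with hV4
    have he : e = V4 + u * V3 + u ^ 2 * V2 + u ^ 3 * V1 + u ^ 4 * V0 := by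
      rw [hV4, hV3, hV2, hV1]; ring
    have m4 := abs_le.1 v4
    have m3 := abs_le.1 (mulb hu v3)
    have m2 := abs_le.1 (mulb hu2 v2)
    have m1 := abs_le.1 (mulb hu3 v1)
    have m0 := abs_le.1 (mulb hu4 v0)
    have hR0 : 0 ≤ max R 0 := le_max_right _ _
    rw [he, abs_le]
    constructor <;> linarith [m4.1, m4.2, m2.1, m2.2, m1.1, m1.2, m0.1, m0.2, m3.1, m3.2]
  · intro d e d' e'
    have h1 := hL.dist_le_mul ((unip u)⁻¹ • (⟨a, b, c, d, e⟩ : Quartic)).vec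
      ((unip u)⁻¹ • (⟨a, b, c, d', e'⟩ : Quartic)).vec
    rw [Real.dist_eq] at h1
    refine h1.trans (mul_le_mul_of_nonneg_left ?_ L.2)
    rw [unip_inv_smul, unip_inv_smul]
    have hpos : 0 ≤ |d - d'| + |e - e'| := by positivity
    rw [dist_pi_le_iff hpos]
    intro j
    fin_cases j
    · simpa [Quartic.vec] using hpos
    · simpa [Quartic.vec] using hpos
    · simpa [Quartic.vec] using hpos
    · simp only [Quartic.vec, Real.dist_eq, Matrix.cons_val, Fin.reduceFinMk]
      have : d - 2 * u * c + 3 * u ^ 2 * b - 4 * u ^ 3 * a -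
          (d' - 2 * u * c + 3 * u ^ 2 * b - 4 * u ^ 3 * a) = d - d' := by ring
      rw [this]
      linarith [abs_nonneg (e - e')]
    · simp only [Quartic.vec, Real.dist_eq, Matrix.cons_val, Fin.reduceFinMk]
      have : e - u * d + u ^ 2 * c - u ^ 3 * b + u ^ 4 * a -
          (e' - u * d' + u ^ 2 * c - u ^ 3 * b + u ^ 4 * a) = (e - e') - u * (d - d') := by ring
      rw [this]
      have h3 := abs_sub (e - e') (u * (d - d'))
      have h4 : |u * (d - d')| ≤ 1 / 2 * |d - d'| := by
        rw [abs_mul]; gcongr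
      linarith [abs_nonneg (d - d')]

/-! ### Total variation -/

/-- The total variation of `G` is at most `V`. -/
def VariationLE (G : ℝ → ℝ) (V : ℝ) : Prop :=
  ∀ u : ℕ → ℝ, Monotone u → ∀ n, ∑ j ∈ Finset.range n, |G (u (j + 1)) - G (u j)| ≤ V

/-- The truncation of a real number to `[-K, K]`. -/
def clamp (K x : ℝ) : ℝ := max (-K) (min K x)

theorem clamp_mono (K : ℝ) : Monotone (clamp K) := fun _ _ h =>
  max_le_max le_rfl (min_le_min le_rfl h)

theorem abs_clamp_le {K : ℝ} (hK : 0 ≤ K) (x : ℝ) : |clamp K x| ≤ K :=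
  abs_le.2 ⟨le_max_left _ _, max_le (by linarith) (min_le_left _ _)⟩

theorem clamp_of_abs_le {K x : ℝ} (h : |x| ≤ K) : clamp K x = x := by
  have := abs_le.1 h
  rw [clamp, min_eq_right this.2, max_eq_right this.1]

theorem clamp_neg {K : ℝ} (hK : 0 ≤ K) (x : ℝ) : clamp K (-x) = -clamp K x := by
  unfold clamp
  rcases le_total x K with h1 | h1 <;> rcases le_total (-K) x with h2 | h2
  · rw [min_eq_right h1, max_eq_right h2, min_eq_right (by linarith), max_eq_right (by linarith)]
  · rw [min_eq_right h1, max_eq_left h2, min_eq_left (by linarith), max_eq_right (by linarith),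
      neg_neg]
  · rw [min_eq_left h1, min_eq_right (by linarith), max_eq_left (by linarith),
      max_eq_right (by linarith)]
  · rw [min_eq_left h1, min_eq_right (by linarith), max_eq_left (by linarith),
      max_eq_right (by linarith)]

theorem VariationLE.of_lipschitz {G a b : ℝ → ℝ} {L Va Vb : ℝ} (hL : 0 ≤ L)
    (h : ∀ x y, |G x - G y| ≤ L * (|a x - a y| + |b x - b y|))
    (ha : VariationLE a Va) (hb : VariationLE b Vb) : VariationLE G (L * (Va + Vb)) := by
  intro u hu n
  calc ∑ j ∈ Finset.range n, |G (u (j + 1)) - G (u j)|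
      ≤ ∑ j ∈ Finset.range n, L * (|a (u (j + 1)) - a (u j)| + |b (u (j + 1)) - b (u j)|) :=
        Finset.sum_le_sum fun j _ => h _ _
    _ = L * (∑ j ∈ Finset.range n, |a (u (j + 1)) - a (u j)|
        + ∑ j ∈ Finset.range n, |b (u (j + 1)) - b (u j)|) := by
        rw [← Finset.sum_add_distrib, Finset.mul_sum]
    _ ≤ _ := mul_le_mul_of_nonneg_left (add_le_add (ha u hu n) (hb u hu n)) hL

theorem VariationLE.mul {f g : ℝ → ℝ} {Bf Bg Vf Vg : ℝ} (hBf : ∀ x, |f x| ≤ Bf)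
    (hBg : ∀ x, |g x| ≤ Bg) (hf : VariationLE f Vf) (hg : VariationLE g Vg) :
    VariationLE (fun x => f x * g x) (Bg * Vf + Bf * Vg) := by
  have hBf0 : 0 ≤ Bf := (abs_nonneg _).trans (hBf 0)
  have hBg0 : 0 ≤ Bg := (abs_nonneg _).trans (hBg 0)
  intro u hu n
  calc ∑ j ∈ Finset.range n, |f (u (j + 1)) * g (u (j + 1)) - f (u j) * g (u j)|
      ≤ ∑ j ∈ Finset.range n, (Bg * |f (u (j + 1)) - f (u j)|
        + Bf * |g (u (j + 1)) - g (u j)|) := by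
        refine Finset.sum_le_sum fun j _ => ?_
        have e : f (u (j + 1)) * g (u (j + 1)) - f (u j) * g (u j)
            = g (u (j + 1)) * (f (u (j + 1)) - f (u j))
              + f (u j) * (g (u (j + 1)) - g (u j)) := by ring
        rw [e]
        refine (abs_add_le _ _).trans ?_
        rw [abs_mul, abs_mul]
        gcongr
        · exact hBg _
        · exact hBf _
    _ = Bg * (∑ j ∈ Finset.range n, |f (u (j + 1)) - f (u j)|)
        + Bf * ∑ j ∈ Finset.range n, |g (u (j + 1)) - g (u j)| := by
        rw [Finset.sum_add_distrib, Finset.mul_sum, Finset.mul_sum]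
    _ ≤ _ := add_le_add (mul_le_mul_of_nonneg_left (hf u hu n) hBg0)
        (mul_le_mul_of_nonneg_left (hg u hu n) hBf0)

theorem VariationLE.of_monotone {f : ℝ → ℝ} {K : ℝ} (hf : Monotone f) (hK : ∀ x, |f x| ≤ K) :
    VariationLE f (2 * K) := by
  intro u hu n
  have : ∀ j, |f (u (j + 1)) - f (u j)| = f (u (j + 1)) - f (u j) := fun j =>
    abs_of_nonneg (sub_nonneg.2 (hf (hu (Nat.le_succ j))))
  simp only [this]
  rw [Finset.sum_range_sub (fun j => f (u j))]
  have h1 := (abs_le.1 (hK (u n))).2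
  have h2 := (abs_le.1 (hK (u 0))).1
  linarith

theorem VariationLE.neg {f : ℝ → ℝ} {V : ℝ} (hf : VariationLE f V) :
    VariationLE (fun x => -f x) V := by
  intro u hu n
  have := hf u hu n
  simp only [neg_sub_neg]
  simpa only [abs_sub_comm] using this

theorem VariationLE.of_antitone {f : ℝ → ℝ} {K : ℝ} (hf : Antitone f) (hK : ∀ x, |f x| ≤ K) :
    VariationLE f (2 * K) := by
  have h1 : VariationLE (fun x => -f x) (2 * K) :=
    VariationLE.of_monotone (fun x y h => neg_le_neg (hf h)) (fun x => by rw [abs_neg]; exact hK x)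
  simpa using h1.neg

/-- Split at the vertex v as q(s) = q(min s v) + q(max s v) - q(v). Both parts are monotone with
values in [-K, K], so each has variation at most 2K, whatever the coefficients. -/
theorem VariationLE.clamp_quadratic_of_pos {α : ℝ} (hα : 0 < α) (v γ : ℝ) {K : ℝ} (hK : 0 ≤ K) :
    VariationLE (fun s => clamp K (α * (s - v) ^ 2 + γ)) (4 * K) := by
  set q : ℝ → ℝ := fun s => clamp K (α * (s - v) ^ 2 + γ) with hq
  have h1 : VariationLE (fun s => q (min s v)) (2 * K) := by
    refine VariationLE.of_antitone (fun x y h => clamp_mono K ?_) (fun x => abs_clamp_le hK _)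
    have h2 : (min y v - v) ^ 2 ≤ (min x v - v) ^ 2 := by
      have := min_le_min h (le_refl v)
      have := min_le_right y v
      nlinarith
    nlinarith
  have h2 : VariationLE (fun s => q (max s v)) (2 * K) := by
    refine VariationLE.of_monotone (fun x y h => clamp_mono K ?_) (fun x => abs_clamp_le hK _)
    have h2 : (max x v - v) ^ 2 ≤ (max y v - v) ^ 2 := by
      have := max_le_max h (le_refl v)
      have := le_max_right x v
      nlinarith
    nlinarith
  have h3 : ∀ s, q s = q (min s v) + q (max s v) - q v := by
    intro s
    rcases le_total s v with h | h
    · rw [min_eq_left h, max_eq_right h]; ring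
    · rw [min_eq_right h, max_eq_left h]; ring
  have := VariationLE.of_lipschitz (G := q) zero_le_one (fun x y => ?_) h1 h2
  · convert this using 1; ring
  · rw [h3 x, h3 y, one_mul]
    have e : q (min x v) + q (max x v) - q v - (q (min y v) + q (max y v) - q v)
      = (q (min x v) - q (min y v)) + (q (max x v) - q (max y v)) := by ring
    rw [e]
    exact abs_add_le _ _

theorem VariationLE.clamp_quadratic {α : ℝ} (hα : α ≠ 0) (β γ : ℝ) {K : ℝ} (hK : 0 ≤ K) :
    VariationLE (fun s => clamp K (α * s ^ 2 + β * s + γ)) (4 * K) := by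
  have e : ∀ s, α * s ^ 2 + β * s + γ
      = α * (s - -β / (2 * α)) ^ 2 + (γ - β ^ 2 / (4 * α)) := by
    intro s; field_simp; ring
  simp only [e]
  rcases lt_or_gt_of_ne hα with h | h
  · have h1 := (VariationLE.clamp_quadratic_of_pos (neg_pos.2 h) (-β / (2 * α))
      (-(γ - β ^ 2 / (4 * α))) hK).neg
    have e2 : ∀ s, -clamp K (-α * (s - -β / (2 * α)) ^ 2 + -(γ - β ^ 2 / (4 * α)))
        = clamp K (α * (s - -β / (2 * α)) ^ 2 + (γ - β ^ 2 / (4 * α))) := by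
      intro s
      rw [← clamp_neg hK]
      congr 1; ring
    simpa only [e2] using h1
  · exact VariationLE.clamp_quadratic_of_pos h _ _ hK

theorem VariationLE.clamp_affine {α : ℝ} (hα : 0 ≤ α) (β : ℝ) {K : ℝ} (hK : 0 ≤ K) :
    VariationLE (fun s => clamp K (α * s + β)) (2 * K) :=
  VariationLE.of_monotone (fun x y h => clamp_mono K (by gcongr)) (fun _ => abs_clamp_le hK _)

/-- Summation by parts against a function of bounded variation. -/
theorem norm_sum_mul_le_of_variation {G : ℝ → ℝ} {V : ℝ} (hG : VariationLE G V) (s : ℝ) {n : ℕ}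
    (hn : G (s + n) = 0) {z : ℕ → ℂ} {M : ℝ}
    (hM : ∀ m ≤ n, ‖∑ j ∈ Finset.range m, z j‖ ≤ M) :
    ‖∑ j ∈ Finset.range n, (G (s + j) : ℂ) * z j‖ ≤ V * M := by
  have hM0 : 0 ≤ M := (norm_nonneg _).trans (hM 0 (Nat.zero_le _))
  have habel : ∀ m, ∑ j ∈ Finset.range m, (G (s + j) : ℂ) * z j
      = (G (s + m) : ℂ) * (∑ j ∈ Finset.range m, z j)
        - ∑ j ∈ Finset.range m, ((G (s + (j + 1 : ℕ)) - G (s + j) : ℝ) : ℂ)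
          * ∑ l ∈ Finset.range (j + 1), z l := by
    intro m
    induction m with
    | zero => simp
    | succ m ih =>
      rw [Finset.sum_range_succ, ih, Finset.sum_range_succ z m,
        Finset.sum_range_succ (fun j : ℕ => ((G (s + (j + 1 : ℕ)) - G (s + j) : ℝ) : ℂ)
          * ∑ l ∈ Finset.range (j + 1), z l) m, Finset.sum_range_succ z m]
      push_cast
      ring
  rw [habel n, hn]
  simp only [Complex.ofReal_zero, zero_mul, zero_sub, norm_neg]
  refine (norm_sum_le _ _).trans ?_
  have h1 := hG (fun j => s + j) (fun a b h => by
    have : (a : ℝ) ≤ b := by exact_mod_cast h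
    simpa using this) n
  calc ∑ j ∈ Finset.range n, ‖((G (s + (j + 1 : ℕ)) - G (s + j) : ℝ) : ℂ)
        * ∑ l ∈ Finset.range (j + 1), z l‖
      ≤ ∑ j ∈ Finset.range n, |G (s + (j + 1 : ℕ)) - G (s + j)| * M := by
        refine Finset.sum_le_sum fun j hj => ?_
        rw [norm_mul, Complex.norm_real, Real.norm_eq_abs]
        gcongr
        exact hM _ (Finset.mem_range.1 hj)
    _ = (∑ j ∈ Finset.range n, |G (s + (j + 1 : ℕ)) - G (s + j)|) * M := by
        rw [Finset.sum_mul]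
    _ ≤ V * M := mul_le_mul_of_nonneg_right h1 hM0

/-- The sum of a function of bounded variation approximates its integral. -/
theorem abs_sum_sub_integral_le_of_variation {G : ℝ → ℝ} {V : ℝ} (hG : VariationLE G V)
    (hc : Continuous G) (s : ℝ) (n : ℕ) :
    |∑ j ∈ Finset.range n, G (s + j) - ∫ x in s..(s + n), G x| ≤ V := by
  -- Integrating over the offset t of unit intervals compares the sum with n sample points at once,
  -- so that the error is one total variation and not n of them.
  have h1 : ∫ x in s..(s + n), G x
      = ∫ t in (0 : ℝ)..1, ∑ j ∈ Finset.range n, G (s + j + t) := by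
    rw [intervalIntegral.integral_finsetSum (f := fun (j : ℕ) t => G (s + j + t)) fun j _ =>
      (by fun_prop : Continuous fun t => G (s + j + t)).intervalIntegrable _ _]
    have h2 : ∀ j : ℕ, ∫ t in (0 : ℝ)..1, G (s + j + t)
        = ∫ x in (s + j)..(s + (j + 1 : ℕ)), G x := by
      intro j
      rw [intervalIntegral.integral_comp_add_left (fun x => G x) (s + (j : ℝ))]
      push_cast
      rw [add_zero, add_assoc]
    simp only [h2]
    rw [intervalIntegral.sum_integral_adjacent_intervals (a := fun j : ℕ => s + (j : ℝ))
      fun j _ => hc.intervalIntegrable _ _]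
    simp
  have h3 : ∑ j ∈ Finset.range n, G (s + j) = ∫ t in (0 : ℝ)..1, ∑ j ∈ Finset.range n, G (s + j) := by
    simp
  rw [h1, h3, ← intervalIntegral.integral_sub (by simp)
    ((by fun_prop : Continuous fun t => ∑ j ∈ Finset.range n, G (s + j + t)).intervalIntegrable _ _)]
  have key : ∀ t ∈ Set.uIoc (0 : ℝ) 1, ‖(∑ j ∈ Finset.range n, G (s + j))
      - ∑ j ∈ Finset.range n, G (s + j + t)‖ ≤ V := by
    intro t ht
    rw [Set.uIoc_of_le zero_le_one] at ht
    -- The interlaced sequence s, s + t, s + 1, s + 1 + t, …, whose even-to-odd increments are the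
    -- differences to be bounded.
    set u : ℕ → ℝ := fun m => s + (m / 2 : ℕ) + if m % 2 = 0 then 0 else t with hu
    have hmono : Monotone u := by
      refine monotone_nat_of_le_succ fun m => ?_
      simp only [hu]
      rcases Nat.even_or_odd' m with ⟨k, rfl | rfl⟩
      · have e1 : 2 * k / 2 = k := by omega
        have e2 : (2 * k + 1) / 2 = k := by omega
        have e3 : (2 * k) % 2 = 0 := by omega
        have e4 : ¬ (2 * k + 1) % 2 = 0 := by omega
        rw [e1, e2, if_pos e3, if_neg e4]
        linarith [ht.1]
      · have e1 : (2 * k + 1 + 1) / 2 = k + 1 := by omega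
        have e2 : (2 * k + 1) / 2 = k := by omega
        have e3 : (2 * k + 1 + 1) % 2 = 0 := by omega
        have e4 : ¬ (2 * k + 1) % 2 = 0 := by omega
        rw [e1, e2, if_pos e3, if_neg e4]
        push_cast
        linarith [ht.2]
    have hV := hG u hmono (2 * n)
    rw [← Finset.sum_sub_distrib]
    refine (norm_sum_le _ _).trans (le_trans ?_ hV)
    have hsub : ∀ m : ℕ, ∑ j ∈ Finset.range m, ‖G (s + j) - G (s + j + t)‖
        ≤ ∑ j ∈ Finset.range (2 * m), |G (u (j + 1)) - G (u j)| := by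
      intro m
      induction m with
      | zero => simp
      | succ m ih =>
        rw [Finset.sum_range_succ, show 2 * (m + 1) = 2 * m + 1 + 1 by ring,
          Finset.sum_range_succ, Finset.sum_range_succ]
        have e1 : u (2 * m + 1) = s + m + t := by
          simp only [hu]
          rw [show (2 * m + 1) / 2 = m by omega, if_neg (by omega)]
        have e2 : u (2 * m) = s + m := by
          simp only [hu]
          rw [show (2 * m) / 2 = m by omega, if_pos (by omega), add_zero]
        rw [e1, e2, Real.norm_eq_abs, abs_sub_comm (G (s + m))]
        have := abs_nonneg (G (u (2 * m + 1 + 1)) - G (s + m + t))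
        linarith
    exact hsub n
  have := intervalIntegral.norm_integral_le_of_norm_le_const key
  simpa using this

/-! ### Quadratic exponential sums -/

/-- The additive character `x ↦ exp(2πix)`. -/
def ee (x : ℝ) : ℂ := Complex.exp ((2 * Real.pi * x : ℝ) * Complex.I)

theorem norm_ee (x : ℝ) : ‖ee x‖ = 1 := Complex.norm_exp_ofReal_mul_I _

theorem ee_add (x y : ℝ) : ee (x + y) = ee x * ee y := by
  rw [ee, ee, ee, ← Complex.exp_add]
  congr 1
  push_cast
  ring

theorem ee_zero : ee 0 = 1 := by simp [ee]

theorem ee_nat_mul (x : ℝ) (n : ℕ) : ee (n * x) = ee x ^ n := by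
  rw [ee, ee, ← Complex.exp_nat_mul]
  congr 1
  push_cast
  ring

theorem conj_ee (x : ℝ) : (starRingEnd ℂ) (ee x) = ee (-x) := by
  rw [ee, ee, ← Complex.exp_conj, map_mul, Complex.conj_ofReal, Complex.conj_I]
  congr 1
  push_cast
  ring

/-- The chord has length 2|sin πx|, and Jordan's inequality gives |sin πx| ≥ 2|x| on this range. -/
theorem four_mul_abs_le_norm_ee_sub_one {x : ℝ} (hx : |x| ≤ 1 / 2) : 4 * |x| ≤ ‖ee x - 1‖ := by
  have h1 : ee x = Complex.exp (Complex.I * (2 * Real.pi * x : ℝ)) := by rw [ee, mul_comm]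
  rw [h1, Complex.norm_exp_I_mul_ofReal_sub_one, Real.norm_eq_abs, abs_mul,
    abs_of_pos (two_pos : (0 : ℝ) < 2)]
  have e : 2 * Real.pi * x / 2 = Real.pi * x := by ring
  rw [e]
  have key : 2 * |x| ≤ |Real.sin (Real.pi * x)| := by
    have h2 : |Real.sin (Real.pi * x)| = |Real.sin (Real.pi * |x|)| := by
      rcases abs_cases x with ⟨h, _⟩ | ⟨h, _⟩
      · rw [h]
      · rw [h, mul_neg, Real.sin_neg, abs_neg]
    rw [h2]
    have h3 := Real.mul_le_sin (x := Real.pi * |x|) (by positivity)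
      (by nlinarith [Real.pi_pos])
    have h4 : 2 / Real.pi * (Real.pi * |x|) = 2 * |x| := by
      have := Real.pi_pos.ne'
      field_simp
    rw [h4] at h3
    exact h3.trans (le_abs_self _)
  linarith

theorem norm_geom_sum_ee_le {x : ℝ} (hx0 : x ≠ 0) (hx : |x| ≤ 1 / 2) (n : ℕ) :
    ‖∑ l ∈ Finset.range n, ee x ^ l‖ ≤ 1 / (2 * |x|) := by
  have h1 := four_mul_abs_le_norm_ee_sub_one hx
  have hx' : 0 < |x| := abs_pos.2 hx0
  have hne : ee x ≠ 1 := by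
    intro h
    rw [h, sub_self, norm_zero] at h1
    linarith
  rw [geom_sum_eq hne, norm_div]
  have h2 : ‖ee x ^ n - 1‖ ≤ 2 := by
    refine (norm_sub_le _ _).trans ?_
    rw [norm_pow, norm_ee, one_pow, norm_one]
    norm_num
  calc ‖ee x ^ n - 1‖ / ‖ee x - 1‖ ≤ 2 / (4 * |x|) := by gcongr
    _ = 1 / (2 * |x|) := by field_simp; norm_num

theorem sum_lt_pairs_eq (f : ℕ → ℕ → ℂ) (B : ℕ) :
    ∑ j ∈ Finset.range B, ∑ l ∈ Finset.range j, f j l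
      = ∑ h ∈ Finset.Ico 1 B, ∑ l ∈ Finset.range (B - h), f (l + h) l := by
  rw [Finset.sum_sigma', Finset.sum_sigma']
  refine Finset.sum_nbij' (fun p => ⟨p.1 - p.2, p.2⟩) (fun p => ⟨p.2 + p.1, p.2⟩) ?_ ?_ ?_ ?_ ?_
  · rintro ⟨j, l⟩ h
    simp only [Finset.mem_sigma, Finset.mem_range, Finset.mem_Ico] at h ⊢
    omega
  · rintro ⟨j, l⟩ h
    simp only [Finset.mem_sigma, Finset.mem_range, Finset.mem_Ico] at h ⊢
    omega
  · rintro ⟨j, l⟩ h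
    simp only [Finset.mem_sigma, Finset.mem_range] at h
    simp only [Sigma.mk.injEq, heq_eq_eq, and_true]
    omega
  · rintro ⟨j, l⟩ h
    simp
  · rintro ⟨j, l⟩ h
    simp only [Finset.mem_sigma, Finset.mem_range] at h
    simp only
    congr 1
    omega

/-- Weyl differencing: the square is expanded, the diagonal contributes B, and conjugate pairs are
grouped by h = j - l. -/
theorem norm_sq_sum_le (z : ℕ → ℂ) (hz : ∀ j, ‖z j‖ = 1) (B : ℕ) :
    ‖∑ j ∈ Finset.range B, z j‖ ^ 2 ≤ B + 2 * ∑ h ∈ Finset.Ico 1 B,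
      ‖∑ l ∈ Finset.range (B - h), z (l + h) * (starRingEnd ℂ) (z l)‖ := by
  have h1 : ‖∑ j ∈ Finset.range B, z j‖ ^ 2
      = B + 2 * (∑ j ∈ Finset.range B, ∑ l ∈ Finset.range j,
        z j * (starRingEnd ℂ) (z l)).re := by
    induction B with
    | zero => simp
    | succ B ih =>
      rw [Finset.sum_range_succ, Finset.sum_range_succ, ← Complex.normSq_eq_norm_sq,
        Complex.normSq_add, Complex.normSq_eq_norm_sq, ih, Complex.normSq_eq_norm_sq, hz B,
        Complex.add_re, ← Finset.mul_sum, ← map_sum]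
      have : ((∑ j ∈ Finset.range B, z j) * (starRingEnd ℂ) (z B)).re
          = (z B * (starRingEnd ℂ) (∑ j ∈ Finset.range B, z j)).re := by
        simp only [Complex.mul_re, Complex.conj_re, Complex.conj_im]
        ring
      rw [this]
      push_cast
      ring
  rw [h1, sum_lt_pairs_eq]
  have h2 := (Complex.re_le_norm (∑ h ∈ Finset.Ico 1 B, ∑ l ∈ Finset.range (B - h),
    z (l + h) * (starRingEnd ℂ) (z l))).trans (norm_sum_le _ _)
  linarith

theorem sum_Ico_inv_le (B : ℕ) :
    ∑ h ∈ Finset.Ico 1 B, (1 : ℝ) / h ≤ 1 + Real.log B := by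
  have h1 := harmonic_le_one_add_log B
  refine le_trans ?_ h1
  rw [harmonic_eq_sum_Icc]
  push_cast
  calc ∑ h ∈ Finset.Ico 1 B, (1 : ℝ) / h ≤ ∑ h ∈ Finset.Icc 1 B, (1 : ℝ) / h := by
        refine Finset.sum_le_sum_of_subset_of_nonneg ?_ fun _ _ _ => by positivity
        intro h hh
        simp only [Finset.mem_Ico, Finset.mem_Icc] at hh ⊢
        omega
    _ = _ := by simp only [one_div]

/-- Quadratic sums over short ranges. -/
theorem norm_sq_quadratic_sum_le {β : ℝ} (hβ : β ≠ 0) (γ : ℝ) {B : ℕ}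
    (hB' : B * |2 * β| ≤ 1 / 2) :
    ‖∑ j ∈ Finset.range B, ee (β * j ^ 2 + γ * j)‖ ^ 2
      ≤ (3 / 2 + Real.log B) / |2 * β| := by
  have hθ : 0 < |2 * β| := by positivity
  have h1 := norm_sq_sum_le (fun j => ee (β * j ^ 2 + γ * j)) (fun j => norm_ee _) B
  refine h1.trans ?_
  have h2 : ∀ h ∈ Finset.Ico 1 B, ‖∑ l ∈ Finset.range (B - h),
      ee (β * (l + h : ℕ) ^ 2 + γ * (l + h : ℕ)) * (starRingEnd ℂ) (ee (β * l ^ 2 + γ * l))‖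
      ≤ 1 / (2 * |2 * β|) * (1 / h) := by
    intro h hh
    -- The h-th correlation is a geometric sum with ratio `ee (2βh)`. Since B·|2β| ≤ 1/2, the
    -- distance from 2βh to the nearest integer is |2βh| itself; summing 1/h then produces the
    -- logarithm.
    rw [Finset.mem_Ico] at hh
    have e : ∀ l : ℕ, ee (β * (l + h : ℕ) ^ 2 + γ * (l + h : ℕ))
        * (starRingEnd ℂ) (ee (β * l ^ 2 + γ * l))
        = ee (β * h ^ 2 + γ * h) * ee (2 * β * h) ^ l := by
      intro l
      rw [conj_ee, ← ee_add, ← ee_nat_mul, ← ee_add]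
      congr 1
      push_cast
      ring
    simp only [e]
    rw [← Finset.mul_sum, norm_mul, norm_ee, one_mul]
    have hh0 : (0 : ℝ) < h := by exact_mod_cast hh.1
    have hx : |2 * β * h| ≤ 1 / 2 := by
      rw [abs_mul, abs_of_pos hh0, mul_comm]
      refine le_trans ?_ hB'
      gcongr
      exact hh.2.le
    refine (norm_geom_sum_ee_le (by positivity) hx _).trans (le_of_eq ?_)
    rw [abs_mul, abs_of_pos hh0]
    field_simp
  have h3 := Finset.sum_le_sum h2
  rw [← Finset.mul_sum] at h3
  have h4 := sum_Ico_inv_le B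
  have h5 : (B : ℝ) ≤ (1 / 2) / |2 * β| := by
    rw [le_div_iff₀ hθ]; exact hB'
  calc (B : ℝ) + 2 * _ ≤ (1 / 2) / |2 * β| + 2 * (1 / (2 * |2 * β|) * (1 + Real.log B)) := by
        gcongr
        exact h3.trans (by gcongr)
    _ = (3 / 2 + Real.log B) / |2 * β| := by field_simp; ring

theorem norm_sum_le_of_windows {z : ℕ → ℂ} {B : ℕ} (hB : 0 < B) {M : ℝ}
    (h : ∀ s n, n ≤ B → ‖∑ j ∈ Finset.range n, z (s + j)‖ ≤ M) (n : ℕ) :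
    ∀ s, ‖∑ j ∈ Finset.range n, z (s + j)‖ ≤ (n / B + 1) * M := by
  have hM : 0 ≤ M := (norm_nonneg _).trans (h 0 0 (Nat.zero_le _))
  induction n using Nat.strong_induction_on with
  | _ n ih =>
    intro s
    by_cases hn : n ≤ B
    · refine (h s n hn).trans (le_mul_of_one_le_left hM ?_)
      have : (0 : ℝ) ≤ n / B := by positivity
      linarith
    · push Not at hn
      obtain ⟨m, rfl⟩ := Nat.exists_eq_add_of_le hn.le
      rw [Finset.sum_range_add]
      refine (norm_add_le _ _).trans ?_
      have h1 := h s B le_rfl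
      have h2 := ih m (by omega) (s + B)
      simp only [add_assoc] at h2
      have hB' : (B : ℝ) ≠ 0 := by exact_mod_cast hB.ne'
      have e : (((B + m : ℕ) : ℝ) / B + 1) * M = M + (m / B + 1) * M := by
        push_cast
        field_simp
        ring
      rw [e]
      exact add_le_add h1 h2

/-- Weyl's bound for quadratic exponential sums. -/
theorem norm_quadratic_sum_le {β : ℝ} (hβ : β ≠ 0) (γ : ℝ) (n : ℕ) :
    ‖∑ j ∈ Finset.range n, ee (β * j ^ 2 + γ * j)‖
      ≤ 4 * (n * √|2 * β| + 1 / √|2 * β|) * √(3 / 2 + max 0 (Real.log (1 / |2 * β|))) := by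
  set θ := |2 * β| with hθ
  have hθ0 : 0 < θ := by positivity
  have hs0 : 0 < √θ := Real.sqrt_pos.2 hθ0
  set Λ := max 0 (Real.log (1 / θ)) with hΛ
  have hΛ0 : 0 ≤ Λ := le_max_left _ _
  by_cases hc : θ ≤ 1 / 2
  · have h1 : 1 ≤ 1 / (2 * θ) := by
      rw [le_div_iff₀ (by positivity)]; linarith
    -- The longest window to which the short-range bound applies. Translating a window changes only
    -- the linear coefficient and a constant phase, so one bound serves them all.
    set B := ⌊1 / (2 * θ)⌋₊ with hBdef
    have hB : 0 < B := Nat.floor_pos.2 h1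
    have hB1 : (1 : ℝ) ≤ B := by exact_mod_cast hB
    have hB2 : (B : ℝ) ≤ 1 / (2 * θ) := Nat.floor_le (by positivity)
    have hB3 : 1 / (4 * θ) ≤ B := by
      have h2 := Nat.lt_floor_add_one (1 / (2 * θ))
      have h3 : 1 / (2 * θ) = 2 * (1 / (4 * θ)) := by field_simp; norm_num
      rw [← hBdef] at h2
      linarith
    have hlog : ∀ m : ℕ, 0 < m → m ≤ B → Real.log m ≤ Λ := by
      intro m hm hmB
      have hm' : (0 : ℝ) < m := by exact_mod_cast hm
      have hmB' : (m : ℝ) ≤ B := by exact_mod_cast hmB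
      refine le_trans (Real.log_le_log hm' ?_) (le_max_right _ _)
      calc (m : ℝ) ≤ 1 / (2 * θ) := hmB'.trans hB2
        _ ≤ 1 / θ := by gcongr; linarith
    have hwin : ∀ s m : ℕ, m ≤ B → ‖∑ j ∈ Finset.range m, ee (β * ((s + j : ℕ) : ℝ) ^ 2
        + γ * ((s + j : ℕ) : ℝ))‖ ≤ √((3 / 2 + Λ) / θ) := by
      intro s m hm
      have e : ∀ j : ℕ, ee (β * ((s + j : ℕ) : ℝ) ^ 2 + γ * ((s + j : ℕ) : ℝ))
          = ee (β * s ^ 2 + γ * s) * ee (β * j ^ 2 + (γ + 2 * β * s) * j) := by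
        intro j
        rw [← ee_add]
        congr 1
        push_cast
        ring
      simp only [e]
      rw [← Finset.mul_sum, norm_mul, norm_ee, one_mul]
      rcases Nat.eq_zero_or_pos m with rfl | hm0
      · simp
      · apply Real.le_sqrt_of_sq_le
        refine (norm_sq_quadratic_sum_le hβ _ ?_).trans ?_
        · have : (m : ℝ) ≤ 1 / (2 * θ) := le_trans (by exact_mod_cast hm) hB2
          calc (m : ℝ) * θ ≤ 1 / (2 * θ) * θ := by gcongr
            _ = 1 / 2 := by field_simp
        · gcongr
          exact hlog m hm0 hm
    have h2 := norm_sum_le_of_windows (z := fun j : ℕ => ee (β * (j : ℝ) ^ 2 + γ * (j : ℝ)))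
      hB hwin n 0
    simp only [zero_add] at h2
    refine h2.trans ?_
    rw [Real.sqrt_div (by positivity)]
    have h4 : (n : ℝ) / B ≤ 4 * (n * θ) := by
      rw [div_le_iff₀ (by linarith)]
      have : n * θ * (1 / (4 * θ)) ≤ n * θ * B := by gcongr
      have e : (n : ℝ) * θ * (1 / (4 * θ)) = n / 4 := by field_simp
      rw [e] at this
      linarith
    have h5 : √θ * √θ = θ := Real.mul_self_sqrt hθ0.le
    calc ((n : ℝ) / B + 1) * (√(3 / 2 + Λ) / √θ)
        ≤ (4 * (n * θ) + 4) * (√(3 / 2 + Λ) / √θ) := by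
          gcongr
          norm_num
      _ = 4 * (n * √θ + 1 / √θ) * √(3 / 2 + Λ) := by
          field_simp
          rw [Real.sq_sqrt hθ0.le]
  · push Not at hc
    -- For θ > 1/2 no cancellation is needed: the right-hand side exceeds the number of terms.
    have h1 : ‖∑ j ∈ Finset.range n, ee (β * j ^ 2 + γ * j)‖ ≤ n := by
      refine (norm_sum_le _ _).trans ?_
      simp [norm_ee]
    refine h1.trans ?_
    have h2 : 1 / 2 ≤ √θ := by
      apply Real.le_sqrt_of_sq_le
      norm_num
      linarith
    have h3 : 1 ≤ √(3 / 2 + Λ) := by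
      apply Real.le_sqrt_of_sq_le
      linarith
    have hn : (0 : ℝ) ≤ n := Nat.cast_nonneg _
    have h4 : (n : ℝ) ≤ 4 * (n * √θ + 1 / √θ) := by
      have : 0 ≤ 1 / √θ := by positivity
      nlinarith
    exact h4.trans (le_mul_of_one_le_right (by positivity) h3)

/-! ### Poisson summation for a dilated bump function -/

-- Two integrations by parts, in the form that differentiation multiplies the Fourier transform by
-- 2πix.
open scoped FourierTransform in
theorem norm_fourier_le_of_deriv_two {g g' g'' : ℝ → ℂ} (h1 : ∀ y, HasDerivAt g (g' y) y)
    (h2 : ∀ y, HasDerivAt g' (g'' y) y) (i0 : MeasureTheory.Integrable g)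
    (i1 : MeasureTheory.Integrable g') (i2 : MeasureTheory.Integrable g'') {C : ℝ}
    (hC : ∫ y, ‖g'' y‖ ≤ C) {x : ℝ} (hx : x ≠ 0) : ‖𝓕 g x‖ ≤ C / (2 * Real.pi * x) ^ 2 := by
  have d1 : deriv g = g' := funext fun y => (h1 y).deriv
  have d2 : deriv g' = g'' := funext fun y => (h2 y).deriv
  have e1 := Real.fourier_deriv i0 (fun y => (h1 y).differentiableAt) (by rwa [d1])
  have e2 := Real.fourier_deriv i1 (fun y => (h2 y).differentiableAt) (by rwa [d2])
  rw [d1] at e1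
  rw [d2] at e2
  have e3 : ‖𝓕 g'' x‖ = (2 * Real.pi * x) ^ 2 * ‖𝓕 g x‖ := by
    rw [e2, e1]
    simp only [smul_eq_mul, norm_mul, Complex.norm_I, mul_one, Complex.norm_real,
      Real.norm_eq_abs, Complex.norm_ofNat]
    rw [abs_of_pos Real.pi_pos, mul_pow, ← sq_abs x]
    ring
  have e4 : ‖𝓕 g'' x‖ ≤ ∫ y, ‖g'' y‖ := by
    rw [Real.fourier_eq]
    refine (MeasureTheory.norm_integral_le_integral_norm _).trans (le_of_eq ?_)
    simp only [Circle.norm_smul]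
  rw [le_div_iff₀ (by have := Real.pi_pos; positivity), mul_comm, ← e3]
  exact e4.trans hC

/-- A twice differentiable function supported in `[-A, A]`, with bounds for its derivatives. -/
structure SmoothBump (A D₀ D₁ D₂ : ℝ) (φ : ℝ → ℝ) : Prop where
  smooth : ContDiff ℝ 2 φ
  support : ∀ x, A < |x| → φ x = 0
  bound : ∀ x, |φ x| ≤ D₀
  lip : ∀ x y, |φ x - φ y| ≤ D₁ * |x - y|
  bound₂ : ∀ x, |deriv (deriv φ) x| ≤ D₂

-- Poisson summation for y ↦ φ(ρy), translated by x. The second derivative is at most ρ²D₂ on an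
-- interval of length 2A/|ρ|, which explains the single power of |ρ| in the decay of the
-- coefficients.
open scoped FourierTransform in
theorem SmoothBump.poisson {A D₀ D₁ D₂ : ℝ} {φ : ℝ → ℝ} (hφ : SmoothBump A D₀ D₁ D₂ φ)
    (hA : 0 < A) {ρ : ℝ} (hρ : ρ ≠ 0) :
    ∃ g : ℤ → ℂ, (∀ x : ℝ, HasSum (fun ν : ℤ => g ν * ee (-(ν * x)))
        ((∑' e : ℤ, φ (ρ * (e - x)) : ℝ) : ℂ)) ∧
      g 0 = ((∫ y, φ (ρ * y) : ℝ) : ℂ) ∧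
      ∀ ν : ℤ, ν ≠ 0 → ‖g ν‖ ≤ |ρ| * A * D₂ / (ν : ℝ) ^ 2 := by
  set g : ℝ → ℂ := fun y => ((φ (ρ * y) : ℝ) : ℂ) with hg
  have hρ' : 0 < |ρ| := abs_pos.2 hρ
  have hD2 : 0 ≤ D₂ := (abs_nonneg _).trans (hφ.bound₂ 0)
  have hφ1 : ContDiff ℝ 1 (deriv φ) := (contDiff_succ_iff_deriv (n := 1)).1 hφ.smooth |>.2.2
  have hdiff : ∀ y, HasDerivAt φ (deriv φ y) y := fun y =>
    (hφ.smooth.differentiable two_ne_zero y).hasDerivAt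
  have hdiff1 : ∀ y, HasDerivAt (deriv φ) (deriv (deriv φ) y) y := fun y =>
    (hφ1.differentiable one_ne_zero y).hasDerivAt
  have hlin : ∀ y : ℝ, HasDerivAt (fun y => ρ * y) ρ y := fun y => by
    simpa using (hasDerivAt_id y).const_mul ρ
  have h1 : ∀ y, HasDerivAt g ((deriv φ (ρ * y) * ρ : ℝ) : ℂ) y := fun y =>
    ((hdiff (ρ * y)).comp y (hlin y)).ofReal_comp
  have h2 : ∀ y, HasDerivAt (fun y => ((deriv φ (ρ * y) * ρ : ℝ) : ℂ))
      ((deriv (deriv φ) (ρ * y) * ρ * ρ : ℝ) : ℂ) y := fun y =>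
    (((hdiff1 (ρ * y)).comp y (hlin y)).mul_const ρ).ofReal_comp
  have z0 : ∀ x, A < |x| → φ =ᶠ[nhds x] fun _ => 0 := fun x hx => by
    filter_upwards [(isOpen_lt continuous_const continuous_abs).mem_nhds hx] with y hy
    exact hφ.support y hy
  have z1 : ∀ x, A < |x| → deriv φ x = 0 := fun x hx => by
    rw [(z0 x hx).deriv_eq]; simp
  have z2 : ∀ x, A < |x| → deriv (deriv φ) x = 0 := fun x hx => by
    have : deriv φ =ᶠ[nhds x] fun _ => 0 := by
      filter_upwards [(isOpen_lt continuous_const continuous_abs).mem_nhds hx] with y hy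
      exact z1 y hy
    rw [this.deriv_eq]; simp
  have hcomp : ∀ f : ℝ → ℂ, (∀ y, A < |ρ * y| → f y = 0) → HasCompactSupport f := by
    intro f hf
    refine HasCompactSupport.intro (isCompact_Icc (a := -(A / |ρ|)) (b := A / |ρ|)) fun y hy => ?_
    apply hf
    by_contra h
    apply hy
    rw [not_lt, abs_mul, mul_comm, ← le_div_iff₀ hρ'] at h
    exact abs_le.1 h
  have cs0 : HasCompactSupport g := hcomp _ fun y hy => by simp [hg, hφ.support _ hy]
  have cs1 := hcomp (fun y => ((deriv φ (ρ * y) * ρ : ℝ) : ℂ)) fun y hy => by simp [z1 _ hy]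
  have cs2 := hcomp (fun y => ((deriv (deriv φ) (ρ * y) * ρ * ρ : ℝ) : ℂ)) fun y hy => by
    simp [z2 _ hy]
  have hc0 : Continuous φ := hφ.smooth.continuous
  have hc1 : Continuous (deriv φ) := hφ1.continuous
  have hc2 : Continuous (deriv (deriv φ)) := hφ1.continuous_deriv le_rfl
  have c0 : Continuous g := by fun_prop
  have i0 := c0.integrable_of_hasCompactSupport cs0 (μ := MeasureTheory.volume)
  have i1 := (by fun_prop : Continuous fun y =>
    ((deriv φ (ρ * y) * ρ : ℝ) : ℂ)).integrable_of_hasCompactSupport cs1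
    (μ := MeasureTheory.volume)
  have i2 := (by fun_prop : Continuous fun y =>
    ((deriv (deriv φ) (ρ * y) * ρ * ρ : ℝ) : ℂ)).integrable_of_hasCompactSupport cs2
    (μ := MeasureTheory.volume)
  have hC : ∫ y, ‖((deriv (deriv φ) (ρ * y) * ρ * ρ : ℝ) : ℂ)‖ ≤ |ρ| * (2 * A * D₂) := by
    have hs : Function.support (fun y => ‖((deriv (deriv φ) (ρ * y) * ρ * ρ : ℝ) : ℂ)‖)
        ⊆ Set.Icc (-(A / |ρ|)) (A / |ρ|) := by
      intro y hy
      by_contra h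
      apply hy
      have : A < |ρ * y| := by
        by_contra h'
        apply h
        rw [not_lt, abs_mul, mul_comm, ← le_div_iff₀ hρ'] at h'
        exact abs_le.1 h'
      simp [z2 _ this]
    rw [← MeasureTheory.setIntegral_eq_integral_of_forall_compl_eq_zero
      (s := Set.Icc (-(A / |ρ|)) (A / |ρ|)) fun y hy => by
        by_contra h
        exact hy (hs h)]
    have h3 := MeasureTheory.norm_setIntegral_le_of_norm_le_const (μ := MeasureTheory.volume)
      (s := Set.Icc (-(A / |ρ|)) (A / |ρ|)) (C := D₂ * |ρ| * |ρ|)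
      (f := fun y => ‖((deriv (deriv φ) (ρ * y) * ρ * ρ : ℝ) : ℂ)‖) (by simp) (fun y _ => by
        rw [norm_norm, Complex.norm_real, norm_mul, norm_mul, Real.norm_eq_abs, Real.norm_eq_abs]
        gcongr
        exact hφ.bound₂ _)
    refine (le_abs_self _).trans (h3.trans (le_of_eq ?_))
    rw [Real.volume_real_Icc, max_eq_left (by have : 0 ≤ A / |ρ| := by positivity
                                              linarith)]
    field_simp
    ring
  have hbound : ∀ ν : ℤ, ν ≠ 0 → ‖𝓕 g ν‖ ≤ |ρ| * A * D₂ / (ν : ℝ) ^ 2 := by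
    intro ν hν
    have hν' : (ν : ℝ) ≠ 0 := by exact_mod_cast hν
    refine (norm_fourier_le_of_deriv_two h1 h2 i0 i1 i2 hC hν').trans ?_
    have hν2 : 0 < (ν : ℝ) ^ 2 := by positivity
    rw [div_le_div_iff₀ (by have := Real.pi_pos; positivity) hν2]
    -- The factor 2 of the support length is absorbed by (2π)².
    have hpi : 2 ≤ (2 * Real.pi) ^ 2 := by nlinarith [Real.pi_gt_three]
    have h5 : 0 ≤ |ρ| * A * D₂ * (ν : ℝ) ^ 2 := by positivity
    calc |ρ| * (2 * A * D₂) * (ν : ℝ) ^ 2 = 2 * (|ρ| * A * D₂ * (ν : ℝ) ^ 2) := by ring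
      _ ≤ (2 * Real.pi) ^ 2 * (|ρ| * A * D₂ * (ν : ℝ) ^ 2) := by gcongr
      _ = |ρ| * A * D₂ * (2 * Real.pi * ν) ^ 2 := by ring
  have hsum : Summable fun ν : ℤ => 𝓕 g ν := by
    have hs : Summable fun ν : ℤ => |ρ| * A * D₂ * (1 / (ν : ℝ) ^ 2) :=
      (Real.summable_one_div_int_pow.2 one_lt_two).mul_left _
    refine Summable.of_norm_bounded_eventually hs ?_
    filter_upwards [(Set.finite_singleton (0 : ℤ)).compl_mem_cofinite] with ν hν
    refine (hbound ν (by simpa using hν)).trans (le_of_eq ?_)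
    rw [mul_one_div]
  refine ⟨fun ν => 𝓕 g ν, fun x => ?_, ?_, hbound⟩
  · have hO : g =O[Filter.cocompact ℝ] fun x : ℝ => |x| ^ (-2 : ℝ) := by
      have : g =ᶠ[Filter.cocompact ℝ] fun _ => 0 := by
        filter_upwards [cs0.compl_mem_cocompact] with y hy
        exact image_eq_zero_of_notMem_tsupport hy
      exact this.trans_isBigO (Asymptotics.isBigO_zero _ _)
    have hp := Real.tsum_eq_tsum_fourier_of_rpow_decay_of_summable c0 one_lt_two hO hsum (-x)
    have hf : ∀ ν : ℤ, fourier ν ((-x : ℝ) : UnitAddCircle) = ee (-(ν * x)) := by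
      intro ν
      rw [fourier_coe_apply, ee]
      congr 1
      push_cast
      ring
    simp only [hf] at hp
    have hs2 : Summable fun ν : ℤ => 𝓕 g ν * ee (-(ν * x)) := by
      refine Summable.of_norm ?_
      simpa [norm_ee] using hsum.norm
    have := hs2.hasSum
    rw [← hp] at this
    convert this using 1
    rw [Complex.ofReal_tsum]
    refine tsum_congr fun e => ?_
    simp only [hg]
    congr 3
    ring
  · simp only [Int.cast_zero]
    rw [Real.fourier_eq]
    simp only [hg]
    rw [← integral_complex_ofReal]
    simp

theorem GoodApprox.smoothBump {A ε : ℝ} {D : ℕ → ℝ} {φ : ℝ → ℝ} (h : GoodApprox A D ε φ) :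
    SmoothBump A (D 0) (D 1 * (ε ^ 2)⁻¹) (D 2 * (ε ^ 4)⁻¹) φ where
  smooth := by exact_mod_cast contDiff_infty.1 h.smooth 2
  support := h.support
  bound x := by simpa using h.deriv_le 0 x
  lip x y := by
    have h1 : ∀ z, ‖deriv φ z‖ ≤ D 1 * (ε ^ 2)⁻¹ := fun z => by
      simpa [iteratedDeriv_one] using h.deriv_le 1 z
    have h2 := Convex.norm_image_sub_le_of_norm_deriv_le (f := φ) (s := Set.univ) (x := y) (y := x)
      (fun z _ => (h.smooth.differentiable (by simp)) z) (fun z _ => h1 z) convex_univ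
      (Set.mem_univ _) (Set.mem_univ _)
    simpa using h2
  bound₂ x := by
    have := h.deriv_le 2 x
    rwa [iteratedDeriv_succ, iteratedDeriv_one] at this

/-! ### Sums and integrals over a thin neighbourhood of a parabola -/

theorem LipBump.continuous {B K L : ℝ} {F : ℝ → ℝ → ℝ} (hF : LipBump B K L F) :
    Continuous fun p : ℝ × ℝ => F p.1 p.2 := by
  have hL : LipschitzWith (2 * L).toNNReal fun p : ℝ × ℝ => F p.1 p.2 := by
    refine LipschitzWith.of_dist_le_mul fun p q => ?_
    rw [Real.dist_eq]
    have h1 := hF.lip p.1 p.2 q.1 q.2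
    have hL0 : 0 ≤ L := by
      have := (abs_nonneg _).trans (hF.lip 0 0 1 0)
      simpa using this
    rw [Real.coe_toNNReal _ (by positivity)]
    have h2 : |p.1 - q.1| ≤ dist p q := by
      rw [← Real.dist_eq]; exact le_max_left _ _
    have h3 : |p.2 - q.2| ≤ dist p q := by
      rw [← Real.dist_eq]; exact le_max_right _ _
    calc _ ≤ L * (|p.1 - q.1| + |p.2 - q.2|) := h1
      _ ≤ L * (dist p q + dist p q) := by gcongr
      _ = 2 * L * dist p q := by ring
  exact hL.continuous

/-- Any argument beyond K + 1 is clamped to a point still beyond K, where F vanishes. Clamped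
arguments have bounded variation, which the original unbounded ones do not. -/
theorem LipBump.clamp_eq {B K L : ℝ} {F : ℝ → ℝ → ℝ} (hF : LipBump B K L F) (hK : 0 ≤ K)
    (x y : ℝ) : F x y = F (clamp (K + 1) x) (clamp (K + 1) y) := by
  have habs : ∀ x, K + 1 < |x| → K < |clamp (K + 1) x| := by
    intro x hx
    rcases lt_abs.1 hx with h | h
    · rw [clamp, min_eq_left h.le, max_eq_right (by linarith), abs_of_nonneg (by linarith)]
      linarith
    · rw [clamp, min_eq_right (by linarith), max_eq_left (by linarith), abs_neg,
        abs_of_nonneg (by linarith)]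
      linarith
  have z1 : ∀ x y, K < |x| → F x y = 0 := fun x y h => by
    by_contra h'
    exact absurd (hF.support_fst x y h') (not_le.2 h)
  have z2 : ∀ x y, K < |y| → F x y = 0 := fun x y h => by
    by_contra h'
    exact absurd (hF.support_snd x y h') (not_le.2 h)
  by_cases hx : |x| ≤ K + 1
  · by_cases hy : |y| ≤ K + 1
    · rw [clamp_of_abs_le hx, clamp_of_abs_le hy]
    · rw [not_le] at hy
      rw [z2 _ _ (habs y hy), z2 x y (by linarith)]
  · rw [not_le] at hx
    rw [z1 _ _ (habs x hx), z1 x y (by linarith)]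

theorem SmoothBump.variationLE {A D₀ D₁ D₂ : ℝ} {φ : ℝ → ℝ} (hφ : SmoothBump A D₀ D₁ D₂ φ)
    (hA : 0 < A) {a : ℝ} (ha : 0 ≤ a) (b : ℝ) :
    VariationLE (fun s => φ (a * s + b)) (D₁ * (2 * (A + 1))) := by
  have hD1 : 0 ≤ D₁ := by
    have := (abs_nonneg _).trans (hφ.lip 1 0)
    simpa using this
  have hcl : ∀ x, φ x = φ (clamp (A + 1) x) := by
    intro x
    by_cases hx : |x| ≤ A + 1
    · rw [clamp_of_abs_le hx]
    · rw [not_le] at hx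
      rw [hφ.support x (by linarith), hφ.support]
      rcases lt_abs.1 hx with h | h
      · rw [clamp, min_eq_left h.le, max_eq_right (by linarith), abs_of_nonneg (by linarith)]
        linarith
      · rw [clamp, min_eq_right (by linarith), max_eq_left (by linarith), abs_neg,
          abs_of_nonneg (by linarith)]
        linarith
  have h0 : VariationLE (fun _ => (0 : ℝ)) 0 := fun u _ n => by simp
  have := VariationLE.of_lipschitz (G := fun s => φ (a * s + b)) hD1 (fun x y => ?_)
    (VariationLE.clamp_affine ha b (by linarith : 0 ≤ A + 1)) h0
  · simpa using this
  · rw [hcl (a * x + b), hcl (a * y + b)]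
    simpa using hφ.lip _ _

/-- After clamping, the affine argument contributes 2(K + 1) and the quadratic one 4(K + 1). The
bound does not see the size of the coefficients, which is what makes it usable uniformly in a, b, c.
-/
theorem LipBump.variationLE {B K L : ℝ} {F : ℝ → ℝ → ℝ} (hF : LipBump B K L F) (hK : 0 ≤ K)
    (hL : 0 ≤ L) {σ₁ : ℝ} (h1 : 0 < σ₁) {σ₂ : ℝ} (h2 : 0 < σ₂) {α : ℝ} (hα : α ≠ 0) (β γ : ℝ) :
    VariationLE (fun s => F (σ₁ * s) (σ₂ * (α * s ^ 2 + β * s + γ))) (L * (6 * (K + 1))) := by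
  have hK1 : 0 ≤ K + 1 := by linarith
  have va := VariationLE.clamp_affine h1.le 0 hK1
  have vb := VariationLE.clamp_quadratic (mul_ne_zero h2.ne' hα) (σ₂ * β) (σ₂ * γ) hK1
  have := VariationLE.of_lipschitz (G := fun s => F (σ₁ * s) (σ₂ * (α * s ^ 2 + β * s + γ))) hL
    (fun x y => ?_) va vb
  · convert this using 1; ring
  · rw [hF.clamp_eq hK (σ₁ * x), hF.clamp_eq hK (σ₁ * y)]
    have e : ∀ s, σ₂ * (α * s ^ 2 + β * s + γ) = σ₂ * α * s ^ 2 + σ₂ * β * s + σ₂ * γ := by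
      intro s; ring
    rw [e, e, add_zero, add_zero]
    exact hF.lip _ _ _ _

theorem abs_affine_le_iff {a : ℝ} (ha : a ≠ 0) (b A y : ℝ) :
    |a * y + b| ≤ A ↔ y ∈ Set.Icc (-b / a - A / |a|) (-b / a + A / |a|) := by
  have h : a * y + b = a * (y - -b / a) := by field_simp; ring
  rw [h, abs_mul, mul_comm, ← le_div_iff₀ (abs_pos.2 ha), abs_le, Set.mem_Icc]
  constructor
  · rintro ⟨h1, h2⟩; constructor <;> linarith
  · rintro ⟨h1, h2⟩; constructor <;> linarith

theorem abs_integral_le_of_support {f : ℝ → ℝ} {a b A C : ℝ} (ha : a ≠ 0) (hA : 0 < A)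
    (hf : ∀ y, A < |a * y + b| → f y = 0) (hC : ∀ y, |f y| ≤ C) :
    |∫ y, f y| ≤ C * (2 * A / |a|) := by
  rw [← MeasureTheory.setIntegral_eq_integral_of_forall_compl_eq_zero
    (s := Set.Icc (-b / a - A / |a|) (-b / a + A / |a|)) fun y hy => hf y (by
      rwa [← abs_affine_le_iff ha, not_le] at hy)]
  have h := MeasureTheory.norm_setIntegral_le_of_norm_le_const (μ := MeasureTheory.volume)
    (s := Set.Icc (-b / a - A / |a|) (-b / a + A / |a|)) (C := C) (f := f) (by simp)
    (fun y _ => hC y)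
  rw [Real.volume_real_Icc] at h
  have h2 : 0 ≤ A / |a| := by positivity
  rw [max_eq_left (by linarith)] at h
  refine h.trans (le_of_eq ?_)
  ring

/-- The shear (s, y) ↦ (s, x(s) + y) maps a rectangle onto the strip, so the continuous integrand
has compact support. -/
theorem integrable_strip {f : ℝ × ℝ → ℝ} (hf : Continuous f) {φ : ℝ → ℝ} (hφ : Continuous φ)
    {A : ℝ} (hs : ∀ x, A < |x| → φ x = 0) {x : ℝ → ℝ} (hx : Continuous x) {a ρ : ℝ} (ha : a ≠ 0)
    (hρ : ρ ≠ 0) (b : ℝ) :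
    MeasureTheory.Integrable fun z : ℝ × ℝ =>
      f z * (φ (a * z.1 + b) * φ (ρ * (z.2 - x z.1))) := by
  refine Continuous.integrable_of_hasCompactSupport (by fun_prop) ?_
  have hK : IsCompact ((fun z : ℝ × ℝ => (z.1, x z.1 + z.2)) ''
      (Set.Icc (-b / a - A / |a|) (-b / a + A / |a|) ×ˢ
        Set.Icc (-0 / ρ - A / |ρ|) (-0 / ρ + A / |ρ|))) :=
    (isCompact_Icc.prod isCompact_Icc).image (by fun_prop)
  refine HasCompactSupport.intro hK fun z hz => ?_
  by_contra h
  apply hz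
  have h1 := right_ne_zero_of_mul h
  have h2 : |a * z.1 + b| ≤ A := by
    by_contra h'
    exact left_ne_zero_of_mul h1 (hs _ (not_le.1 h'))
  have h3 : |ρ * (z.2 - x z.1) + 0| ≤ A := by
    by_contra h'
    rw [add_zero] at h'
    exact right_ne_zero_of_mul h1 (hs _ (not_le.1 h'))
  exact ⟨(z.1, z.2 - x z.1), ⟨(abs_affine_le_iff ha _ _ _).1 h2,
    (abs_affine_le_iff hρ _ _ _).1 h3⟩, by simp⟩

/-! ### Counting integral points near a graph -/

theorem card_Icc_int_le {l r : ℝ} (h : l ≤ r) :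
    ((Finset.Icc ⌈l⌉ ⌊r⌋).card : ℝ) ≤ r - l + 1 := by
  rw [Int.card_Icc]
  have h1 := Int.floor_le r
  have h2 := Int.le_ceil l
  have h3 : (((⌊r⌋ + 1 - ⌈l⌉).toNat : ℤ) : ℝ) ≤ r - l + 1 := by
    rw [Int.toNat_eq_max]
    push_cast
    exact max_le (by linarith) (by linarith)
  exact_mod_cast h3

/-- One unit is left free at each end, so that the inequalities are strict. The weight then vanishes
at d + n, which kills the boundary term in summation by parts. -/
theorem exists_integer_window {a A : ℝ} (ha : 0 < a) (hA : 0 < A) (b : ℝ) :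
    ∃ (d : ℤ) (n : ℕ), (n : ℝ) ≤ 2 * A / a + 2 ∧
      ∀ s : ℝ, |a * s + b| ≤ A → (d : ℝ) < s ∧ s < d + n := by
  set l := -b / a - A / |a| with hl
  set r := -b / a + A / |a| with hr
  have hlr : r - l = 2 * A / a := by
    rw [hl, hr, abs_of_pos ha]; ring
  have hpos : 0 < 2 * A / a := by positivity
  have h1 := Int.floor_le r
  have h2 := Int.lt_floor_add_one r
  have h3 := Int.le_ceil l
  have h4 := Int.ceil_lt_add_one l
  have hn : 0 ≤ ⌊r⌋ + 1 - (⌈l⌉ - 1) := by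
    have : (0 : ℝ) ≤ ((⌊r⌋ + 1 - (⌈l⌉ - 1) : ℤ) : ℝ) := by push_cast; linarith
    exact_mod_cast this
  refine ⟨⌈l⌉ - 1, (⌊r⌋ + 1 - (⌈l⌉ - 1)).toNat, ?_, ?_⟩
  · have : (((⌊r⌋ + 1 - (⌈l⌉ - 1)).toNat : ℤ) : ℝ) ≤ 2 * A / a + 2 := by
      rw [Int.toNat_of_nonneg hn]
      push_cast
      linarith
    exact_mod_cast this
  · intro s hs
    rw [abs_affine_le_iff ha.ne'] at hs
    have e : (((⌊r⌋ + 1 - (⌈l⌉ - 1)).toNat : ℕ) : ℝ) = ((⌊r⌋ + 1 - (⌈l⌉ - 1) : ℤ) : ℝ) := by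
      rw [← Int.cast_natCast, Int.toNat_of_nonneg hn]
    rw [e]
    push_cast
    constructor
    · linarith [hs.1]
    · linarith [hs.2]

/-- The contribution of the non-zero frequencies. -/
theorem abs_sum_periodized_sub_le {A D₀ D₁ D₂ : ℝ} {φ : ℝ → ℝ} (hφ : SmoothBump A D₀ D₁ D₂ φ)
    (hA : 0 < A) {ρ : ℝ} (hρ : ρ ≠ 0) {G : ℝ → ℝ} {V : ℝ} (hG : VariationLE G V) {d : ℤ} {n : ℕ}
    (hn : G (d + n) = 0) {α : ℝ} (hα : α ≠ 0) (β γ : ℝ) {N : ℝ} (hN : n ≤ N) :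
    |∑ j ∈ Finset.range n, G (d + j) *
        (∑' e : ℤ, φ (ρ * (e - (α * (d + j) ^ 2 + β * (d + j) + γ))))
      - (∑ j ∈ Finset.range n, G (d + j)) * ∫ y, φ (ρ * y)|
      ≤ |ρ| * A * D₂ * V * (4 * (N * √(2 * |α|) + 1 / √(2 * |α|)) *
        √(3 / 2 + max 0 (Real.log (1 / (2 * |α|))))) * ∑' ν : ℤ, |(ν : ℝ)| ^ (-(3 / 2) : ℝ) := by
  obtain ⟨g, hg, hg0, hgν⟩ := hφ.poisson hA hρ
  have hα' : 0 < |α| := abs_pos.2 hα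
  set θ := 2 * |α| with hθ
  have hθ0 : 0 < θ := by positivity
  set Λ := max 0 (Real.log (1 / θ)) with hΛ
  have hΛ0 : 0 ≤ Λ := le_max_left _ _
  set U := 4 * (N * √θ + 1 / √θ) * √(3 / 2 + Λ) with hU
  have hV : 0 ≤ V := by simpa using hG (fun _ => 0) monotone_const 0
  have hN0 : 0 ≤ N := (Nat.cast_nonneg n).trans hN
  have hU0 : 0 ≤ U := by positivity
  set x : ℝ → ℝ := fun s => α * s ^ 2 + β * s + γ with hx
  have hsum : HasSum (fun ν : ℤ => ∑ j ∈ Finset.range n,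
      (G (d + j) : ℂ) * (g ν * ee (-(ν * x (d + j)))))
      (∑ j ∈ Finset.range n, (G (d + j) : ℂ) *
        ((∑' e : ℤ, φ (ρ * (e - x (d + j))) : ℝ) : ℂ)) :=
    hasSum_sum fun j _ => (hg (x (d + j))).mul_left _
  set f : ℤ → ℂ := fun ν => ∑ j ∈ Finset.range n,
      (G (d + j) : ℂ) * (g ν * ee (-(ν * x (d + j)))) with hf
  have hf0 : f 0 = (((∑ j ∈ Finset.range n, G (d + j)) * ∫ y, φ (ρ * y) : ℝ) : ℂ) := by
    simp only [hf, Int.cast_zero, zero_mul, neg_zero, ee_zero, mul_one, hg0]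
    push_cast
    rw [Finset.sum_mul]
  have hfν : ∀ ν : ℤ, ν ≠ 0 → ‖f ν‖ ≤ |ρ| * A * D₂ * V * U * |(ν : ℝ)| ^ (-(3 / 2) : ℝ) := by
    intro ν hν
    have hνr : (ν : ℝ) ≠ 0 := by exact_mod_cast hν
    have hν0 : 0 < |(ν : ℝ)| := abs_pos.2 hνr
    have hν1 : 1 ≤ |(ν : ℝ)| := by exact_mod_cast Int.one_le_abs hν
    -- The phase at frequency ν has leading coefficient -να; the term 1/√(ν|α|) is weakened so that
    -- √|ν| factors out of the whole bound, uniformly over partial sums.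
    have hinner : ∀ m ≤ n, ‖∑ j ∈ Finset.range m, ee (-(ν * x (d + j)))‖ ≤ √|(ν : ℝ)| * U := by
      intro m hm
      have e : ∀ j : ℕ, ee (-(ν * x (d + j)))
          = ee (-(ν * x d)) * ee (-(ν * α) * j ^ 2 + -(ν * (2 * α * d + β)) * j) := by
        intro j
        rw [← ee_add]
        congr 1
        simp only [hx]
        ring
      simp only [e]
      rw [← Finset.mul_sum, norm_mul, norm_ee, one_mul]
      refine (norm_quadratic_sum_le (neg_ne_zero.2 (mul_ne_zero hνr hα)) _ m).trans ?_
      have e2 : |2 * -(ν * α)| = |(ν : ℝ)| * θ := by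
        rw [abs_mul, abs_neg, abs_mul, abs_of_pos (two_pos : (0 : ℝ) < 2), hθ]
        ring
      rw [e2, Real.sqrt_mul hν0.le]
      have hs1 : 1 ≤ √|(ν : ℝ)| := by
        rw [← Real.sqrt_one]; exact Real.sqrt_le_sqrt hν1
      have hsθ : 0 < √θ := Real.sqrt_pos.2 hθ0
      have b1 : (m : ℝ) * (√|(ν : ℝ)| * √θ) ≤ √|(ν : ℝ)| * (N * √θ) := by
        have hm' : (m : ℝ) ≤ N := le_trans (by exact_mod_cast hm) hN
        calc (m : ℝ) * (√|(ν : ℝ)| * √θ) ≤ N * (√|(ν : ℝ)| * √θ) := by gcongr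
          _ = √|(ν : ℝ)| * (N * √θ) := by ring
      have b2 : 1 / (√|(ν : ℝ)| * √θ) ≤ √|(ν : ℝ)| * (1 / √θ) := by
        rw [div_le_iff₀ (by positivity)]
        have : √|(ν : ℝ)| * (1 / √θ) * (√|(ν : ℝ)| * √θ) = √|(ν : ℝ)| * √|(ν : ℝ)| := by
          field_simp
        rw [this]
        nlinarith
      have b3 : max 0 (Real.log (1 / (|(ν : ℝ)| * θ))) ≤ Λ := by
        refine max_le_max le_rfl (Real.log_le_log (by positivity) ?_)
        refine one_div_le_one_div_of_le hθ0 ?_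
        exact le_mul_of_one_le_left hθ0.le hν1
      calc 4 * (m * (√|(ν : ℝ)| * √θ) + 1 / (√|(ν : ℝ)| * √θ)) *
            √(3 / 2 + max 0 (Real.log (1 / (|(ν : ℝ)| * θ))))
          ≤ 4 * (√|(ν : ℝ)| * (N * √θ) + √|(ν : ℝ)| * (1 / √θ)) * √(3 / 2 + Λ) := by
            gcongr
        _ = √|(ν : ℝ)| * U := by rw [hU]; ring
    have habel := norm_sum_mul_le_of_variation hG (d : ℝ) hn hinner
    have e3 : f ν = g ν * ∑ j ∈ Finset.range n, (G (d + j) : ℂ) * ee (-(ν * x (d + j))) := by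
      simp only [hf]
      rw [Finset.mul_sum]
      exact Finset.sum_congr rfl fun j _ => by ring
    rw [e3, norm_mul]
    have hD2 : 0 ≤ D₂ := (abs_nonneg _).trans (hφ.bound₂ 0)
    calc ‖g ν‖ * ‖∑ j ∈ Finset.range n, (G (d + j) : ℂ) * ee (-(ν * x (d + j)))‖
        ≤ (|ρ| * A * D₂ / (ν : ℝ) ^ 2) * (V * (√|(ν : ℝ)| * U)) := by
          gcongr
          exact hgν ν hν
      _ = |ρ| * A * D₂ * V * U * |(ν : ℝ)| ^ (-(3 / 2) : ℝ) := by
          have e4 : |(ν : ℝ)| ^ (-(3 / 2) : ℝ) = √|(ν : ℝ)| / (ν : ℝ) ^ 2 := by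
            rw [Real.sqrt_eq_rpow, ← sq_abs, ← Real.rpow_natCast, ← Real.rpow_sub hν0]
            norm_num
          rw [e4]
          ring
  have hsum' := hsum.sub (hasSum_ite_eq (0 : ℤ) (f 0))
  have hb : HasSum (fun ν : ℤ => |ρ| * A * D₂ * V * U * |(ν : ℝ)| ^ (-(3 / 2) : ℝ))
      (|ρ| * A * D₂ * V * U * ∑' ν : ℤ, |(ν : ℝ)| ^ (-(3 / 2) : ℝ)) :=
    ((Real.summable_abs_int_rpow (b := 3 / 2) (by norm_num)).hasSum).mul_left _
  have hle := hsum'.norm_le_of_bounded hb fun ν => by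
    by_cases hν : ν = 0
    · subst hν
      -- Frequency zero has been subtracted, and the majorant also vanishes there because 0 to the
      -- power -3/2 is 0 by convention.
      simp [Real.zero_rpow]
    · simp only [hν, if_false, sub_zero]
      exact hfν ν hν
  rw [hf0] at hle
  have e5 : (∑ j ∈ Finset.range n, (G (d + j) : ℂ) *
        ((∑' e : ℤ, φ (ρ * (e - x (d + j))) : ℝ) : ℂ))
      - (((∑ j ∈ Finset.range n, G (d + j)) * ∫ y, φ (ρ * y) : ℝ) : ℂ)
      = ((∑ j ∈ Finset.range n, G (d + j) * (∑' e : ℤ, φ (ρ * (e - x (d + j))))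
        - (∑ j ∈ Finset.range n, G (d + j)) * ∫ y, φ (ρ * y) : ℝ) : ℂ) := by
    push_cast
    rfl
  rw [e5, Complex.norm_real] at hle
  exact hle

/-- A function on `ℤ × ℤ` supported in a strip around a graph has finite support, and its sum can
be taken column by column. -/
theorem strip_tsum {f : ℤ × ℤ → ℝ} {A a b ρ : ℝ} {x : ℝ → ℝ} (hρ : ρ ≠ 0) {d : ℤ} {n : ℕ}
    (hw : ∀ s : ℝ, |a * s + b| ≤ A → (d : ℝ) < s ∧ s < d + n)
    (hf : ∀ p : ℤ × ℤ, f p ≠ 0 → |a * p.1 + b| ≤ A ∧ |ρ * (p.2 - x p.1)| ≤ A) :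
    Summable f ∧ ∑' p, f p = ∑ j ∈ Finset.range n, ∑' e : ℤ, f (d + j, e) ∧
      ∀ s : ℤ, ∑' e : ℤ, f (s, e) =
        ∑ e ∈ Finset.Icc ⌈x s - A / |ρ|⌉ ⌊x s + A / |ρ|⌋, f (s, e) := by
  have hcol : ∀ (s e : ℤ), f (s, e) ≠ 0 →
      e ∈ Finset.Icc ⌈x s - A / |ρ|⌉ ⌊x s + A / |ρ|⌋ := by
    intro s e h
    have h2 := (hf _ h).2
    have h3 : |ρ * (e : ℝ) + -(ρ * x s)| ≤ A := by
      convert h2 using 2; ring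
    rw [abs_affine_le_iff hρ] at h3
    have e1 : -(-(ρ * x s)) / ρ = x s := by field_simp
    rw [e1] at h3
    rw [Finset.mem_Icc]
    exact ⟨Int.ceil_le.2 h3.1, Int.le_floor.2 h3.2⟩
  have hrow : ∀ (s e : ℤ), f (s, e) ≠ 0 → ∃ j ∈ Finset.range n, s = d + (j : ℤ) := by
    intro s e h
    obtain ⟨h1, h2⟩ := hw _ (hf _ h).1
    have h1' : d < s := by exact_mod_cast h1
    have h2' : s < d + n := by exact_mod_cast h2
    exact ⟨(s - d).toNat, by rw [Finset.mem_range]; omega, by omega⟩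
  have hsum : Summable f := by
    refine summable_of_hasFiniteSupport (Set.Finite.subset (((Finset.range n).biUnion fun j =>
      (Finset.Icc ⌈x ((d + j : ℤ)) - A / |ρ|⌉ ⌊x ((d + j : ℤ)) + A / |ρ|⌋).image
        fun e => ((d + j : ℤ), e)).finite_toSet) ?_)
    rintro ⟨s, e⟩ h
    obtain ⟨j, hj, rfl⟩ := hrow s e h
    rw [Finset.mem_coe, Finset.mem_biUnion]
    exact ⟨j, hj, Finset.mem_image.2 ⟨e, hcol _ _ h, rfl⟩⟩
  have hcs : ∀ s : ℤ, ∑' e : ℤ, f (s, e) =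
        ∑ e ∈ Finset.Icc ⌈x s - A / |ρ|⌉ ⌊x s + A / |ρ|⌋, f (s, e) := fun s =>
    tsum_eq_sum fun e he => by
      by_contra h
      exact he (hcol _ _ h)
  refine ⟨hsum, ?_, hcs⟩
  rw [hsum.tsum_prod]
  rw [tsum_eq_sum (s := (Finset.range n).image fun j : ℕ => d + (j : ℤ))]
  · rw [Finset.sum_image]
    intro i _ j _ h
    simpa using h
  · intro s hs
    refine (tsum_congr fun e => ?_).trans tsum_zero
    by_contra h
    obtain ⟨j, hj, rfl⟩ := hrow s e h
    exact hs (Finset.mem_image.2 ⟨j, hj, rfl⟩)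

theorem abs_strip_tsum_le {f : ℤ × ℤ → ℝ} {A a b ρ E : ℝ} {x : ℝ → ℝ} (hρ : ρ ≠ 0) (hA : 0 < A)
    {d : ℤ} {n : ℕ} (hw : ∀ s : ℝ, |a * s + b| ≤ A → (d : ℝ) < s ∧ s < d + n)
    (hf : ∀ p : ℤ × ℤ, f p ≠ 0 → |a * p.1 + b| ≤ A ∧ |ρ * (p.2 - x p.1)| ≤ A)
    (hE : ∀ p, |f p| ≤ E) : |∑' p, f p| ≤ n * ((2 * A / |ρ| + 1) * E) := by
  obtain ⟨-, h1, h2⟩ := strip_tsum hρ hw hf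
  have hE0 : 0 ≤ E := (abs_nonneg _).trans (hE 0)
  rw [h1]
  refine (Finset.abs_sum_le_sum_abs _ _).trans ?_
  calc _ ≤ ∑ j ∈ Finset.range n, (2 * A / |ρ| + 1) * E := by
        refine Finset.sum_le_sum fun j _ => ?_
        rw [h2]
        refine (Finset.abs_sum_le_sum_abs _ _).trans ?_
        refine (Finset.sum_le_card_nsmul _ _ E fun e _ => hE _).trans ?_
        rw [nsmul_eq_mul]
        have h3 : 0 ≤ A / |ρ| := by positivity
        have := card_Icc_int_le (l := x ((d + j : ℤ)) - A / |ρ|) (r := x ((d + j : ℤ)) + A / |ρ|)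
          (by linarith)
        gcongr
        refine this.trans (le_of_eq ?_)
        ring
    _ = _ := by simp

theorem abs_strip_integral_le {f : ℝ × ℝ → ℝ} {A a b ρ E : ℝ} {x : ℝ → ℝ} (ha : a ≠ 0)
    (hρ : ρ ≠ 0) (hA : 0 < A) (hi : MeasureTheory.Integrable f)
    (hf : ∀ z : ℝ × ℝ, f z ≠ 0 → |a * z.1 + b| ≤ A ∧ |ρ * (z.2 - x z.1)| ≤ A)
    (hE : ∀ z, |f z| ≤ E) : |∫ z, f z| ≤ E * (2 * A / |ρ|) * (2 * A / |a|) := by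
  rw [MeasureTheory.Measure.volume_eq_prod, MeasureTheory.integral_prod f hi]
  refine abs_integral_le_of_support (b := b) ha hA (fun s hs => ?_) fun s => ?_
  · have : ∀ y, f (s, y) = 0 := fun y => by
      by_contra h
      exact absurd (hf _ h).1 (not_le.2 hs)
    simp [this]
  · refine abs_integral_le_of_support (b := -(ρ * x s)) hρ hA (fun y hy => ?_) fun y => hE _
    by_contra h
    have := (hf _ h).2
    refine absurd this (not_le.2 ?_)
    have e : ρ * (y - x s) = ρ * y + -(ρ * x s) := by ring
    rwa [e]

/-- The sum over `ℤ²` of a smooth weight localized near a parabola is close to its integral. -/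
theorem LipBump.abs_tsum_sub_integral_le {B K L : ℝ} {F : ℝ → ℝ → ℝ} (hF : LipBump B K L F)
    (hK : 0 ≤ K) (hL : 0 ≤ L) {A D₀ D₁ D₂ : ℝ} {φ : ℝ → ℝ}
    (hφ : SmoothBump A D₀ D₁ D₂ φ) (hA : 0 < A) {σ₁ σ₂ A₁ ρ α : ℝ} (h1 : 0 < σ₁) (h2 : 0 < σ₂)
    (hA₁ : 0 < A₁) (hρ : ρ ≠ 0) (hα : α ≠ 0) (A₀ β γ : ℝ) :
    (Summable fun p : ℤ × ℤ => F (σ₁ * p.1) (σ₂ * p.2) *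
      (φ (A₁ * p.1 + A₀) * φ (ρ * (p.2 - (α * (p.1 : ℝ) ^ 2 + β * p.1 + γ))))) ∧
    |∑' p : ℤ × ℤ, F (σ₁ * p.1) (σ₂ * p.2) *
      (φ (A₁ * p.1 + A₀) * φ (ρ * (p.2 - (α * (p.1 : ℝ) ^ 2 + β * p.1 + γ))))
      - ∫ z : ℝ × ℝ, F (σ₁ * z.1) (σ₂ * z.2) *
        (φ (A₁ * z.1 + A₀) * φ (ρ * (z.2 - (α * z.1 ^ 2 + β * z.1 + γ))))|
      ≤ (2 * A / A₁ + 2) * (4 * A / |ρ| + 1) * (L * σ₂ * (A / |ρ|) * D₀ ^ 2)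
        + (D₀ * (L * (6 * (K + 1))) + B * (D₁ * (2 * (A + 1)))) *
          (2 * A * D₀ / |ρ| + |ρ| * A * D₂ * (4 * ((2 * A / A₁ + 2) * √(2 * |α|)
            + 1 / √(2 * |α|)) * √(3 / 2 + max 0 (Real.log (1 / (2 * |α|))))) *
              ∑' ν : ℤ, |(ν : ℝ)| ^ (-(3 / 2) : ℝ)) := by
  obtain ⟨d, n, hn, hw⟩ := exists_integer_window hA₁ hA A₀
  set x : ℝ → ℝ := fun s => α * s ^ 2 + β * s + γ with hx
  have hφc : Continuous φ := hφ.smooth.continuous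
  have hFc := hF.continuous
  have hD0 : 0 ≤ D₀ := (abs_nonneg _).trans (hφ.bound 0)
  set V := D₀ * (L * (6 * (K + 1))) + B * (D₁ * (2 * (A + 1))) with hV
  -- The weight frozen along the parabola, a function of the first variable only.
  set G : ℝ → ℝ := fun s => F (σ₁ * s) (σ₂ * x s) * φ (A₁ * s + A₀) with hG
  have hGV : VariationLE G V :=
    VariationLE.mul (fun s => hF.bound _ _) (fun s => hφ.bound _)
      (hF.variationLE hK hL h1 h2 hα β γ) (hφ.variationLE hA hA₁.le A₀)
  have hV0 : 0 ≤ V := by simpa using hGV (fun _ => 0) monotone_const 0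
  have hxc : Continuous x := by fun_prop
  have hGc : Continuous G :=
    (hFc.comp (by fun_prop : Continuous fun s : ℝ => (σ₁ * s, σ₂ * x s))).mul (by fun_prop)
  have hG0 : ∀ s, A < |A₁ * s + A₀| → G s = 0 := fun s hs => by
    simp only [hG]; rw [hφ.support _ hs, mul_zero]
  set θ : ℝ × ℝ → ℝ := fun z => F (σ₁ * z.1) (σ₂ * z.2) *
    (φ (A₁ * z.1 + A₀) * φ (ρ * (z.2 - x z.1))) with hθ
  set θ0 : ℝ × ℝ → ℝ := fun z => F (σ₁ * z.1) (σ₂ * x z.1) *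
    (φ (A₁ * z.1 + A₀) * φ (ρ * (z.2 - x z.1))) with hθ0
  have hi : MeasureTheory.Integrable θ :=
    integrable_strip (hFc.comp (by fun_prop : Continuous fun z : ℝ × ℝ => (σ₁ * z.1, σ₂ * z.2)))
      hφc hφ.support hxc hA₁.ne' hρ A₀
  have hi0 : MeasureTheory.Integrable θ0 :=
    integrable_strip (hFc.comp (by fun_prop : Continuous fun z : ℝ × ℝ => (σ₁ * z.1, σ₂ * x z.1)))
      hφc hφ.support hxc hA₁.ne' hρ A₀
  have hsupp : ∀ z : ℝ × ℝ, φ (A₁ * z.1 + A₀) * φ (ρ * (z.2 - x z.1)) ≠ 0 →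
      |A₁ * z.1 + A₀| ≤ A ∧ |ρ * (z.2 - x z.1)| ≤ A := fun z hz =>
    ⟨not_lt.1 fun h => left_ne_zero_of_mul hz (hφ.support _ h),
      not_lt.1 fun h => right_ne_zero_of_mul hz (hφ.support _ h)⟩
  -- The cost of freezing at one point: Lipschitz constant times the half-width A/|ρ| of the strip,
  -- times the bound for the two cutoffs.
  set E := L * σ₂ * (A / |ρ|) * D₀ ^ 2 with hE
  have hE0 : 0 ≤ E := by positivity
  have hsub : ∀ z, θ z - θ0 z = (F (σ₁ * z.1) (σ₂ * z.2) - F (σ₁ * z.1) (σ₂ * x z.1)) *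
      (φ (A₁ * z.1 + A₀) * φ (ρ * (z.2 - x z.1))) := fun z => by
    simp only [hθ, hθ0]; ring
  have hdiff : ∀ z, |θ z - θ0 z| ≤ E := by
    intro z
    rw [hsub]
    by_cases h : φ (A₁ * z.1 + A₀) * φ (ρ * (z.2 - x z.1)) = 0
    · rw [h, mul_zero, abs_zero]; exact hE0
    have h3 := (hsupp z h).2
    rw [abs_mul, mul_comm, ← le_div_iff₀ (abs_pos.2 hρ)] at h3
    have h4 := hF.lip (σ₁ * z.1) (σ₂ * z.2) (σ₁ * z.1) (σ₂ * x z.1)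
    rw [sub_self, abs_zero, zero_add, ← mul_sub, abs_mul, abs_of_pos h2] at h4
    rw [abs_mul, abs_mul (φ _)]
    calc _ ≤ (L * (σ₂ * (A / |ρ|))) * (D₀ * D₀) := by
          gcongr
          · exact h4.trans (by gcongr)
          · exact hφ.bound _
          · exact hφ.bound _
      _ = E := by rw [hE]; ring
  have t1 := strip_tsum (f := fun p : ℤ × ℤ => θ (p.1, p.2)) (x := x) hρ hw
    (fun p hp => hsupp (p.1, p.2) (right_ne_zero_of_mul hp))
  have t2 := strip_tsum (f := fun p : ℤ × ℤ => θ0 (p.1, p.2)) (x := x) hρ hw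
    (fun p hp => hsupp (p.1, p.2) (right_ne_zero_of_mul hp))
  have hd1 := abs_strip_tsum_le (f := fun p : ℤ × ℤ => θ (p.1, p.2) - θ0 (p.1, p.2)) (x := x)
    hρ hA hw (fun p hp => hsupp (p.1, p.2) (by
      rw [hsub] at hp; exact right_ne_zero_of_mul hp)) (fun p => hdiff _)
  rw [t1.1.tsum_sub t2.1] at hd1
  have hd2 := abs_strip_integral_le (f := fun z => θ z - θ0 z) (x := x) (b := A₀) hA₁.ne'
    hρ hA (hi.sub hi0) (fun z hz => hsupp z (by
      rw [hsub] at hz; exact right_ne_zero_of_mul hz)) hdiff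
  rw [MeasureTheory.integral_sub hi hi0, abs_of_pos hA₁] at hd2
  -- With F frozen, each column sum is a periodization of φ, to which Poisson summation applies.
  have e1 : ∑' p : ℤ × ℤ, θ0 (p.1, p.2) = ∑ j ∈ Finset.range n, G (d + j) *
      (∑' e : ℤ, φ (ρ * (e - x (d + j)))) := by
    rw [t2.2.1]
    refine Finset.sum_congr rfl fun j _ => ?_
    rw [← tsum_mul_left]
    refine tsum_congr fun e => ?_
    simp only [hθ0, hG]
    push_cast
    ring
  have e2 : ∫ z, θ0 z = (∫ s in (d : ℝ)..(d + n), G s) * ∫ y, φ (ρ * y) := by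
    rw [MeasureTheory.Measure.volume_eq_prod, MeasureTheory.integral_prod θ0 hi0]
    have : ∀ s, ∫ y, θ0 (s, y) = G s * ∫ y, φ (ρ * y) := by
      intro s
      simp only [hθ0, hG, ← mul_assoc]
      rw [MeasureTheory.integral_const_mul]
      congr 1
      exact MeasureTheory.integral_sub_right_eq_self (fun y => φ (ρ * y)) (x s)
    simp only [this]
    rw [MeasureTheory.integral_mul_const, intervalIntegral.integral_of_le (by simp),
      MeasureTheory.setIntegral_eq_integral_of_forall_compl_eq_zero]
    intro s hs
    refine hG0 s (not_le.1 fun h => hs ?_)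
    exact ⟨(hw s h).1, (hw s h).2.le⟩
  have hGn : G (d + n) = 0 := hG0 _ (not_le.1 fun h => (hw _ h).2.ne rfl)
  have m1 := abs_sum_periodized_sub_le hφ hA hρ hGV hGn hα β γ hn
  have m2 := abs_sum_sub_integral_le_of_variation hGV hGc (d : ℝ) n
  have m3 : |∫ y, φ (ρ * y)| ≤ D₀ * (2 * A / |ρ|) :=
    abs_integral_le_of_support (b := 0) hρ hA (fun y hy => hφ.support _ (by simpa using hy))
      fun y => hφ.bound _
  refine ⟨t1.1, ?_⟩
  change |∑' p : ℤ × ℤ, θ (p.1, p.2) - ∫ z, θ z| ≤ _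
  change |∑ j ∈ Finset.range n, G (d + j) * (∑' e : ℤ, φ (ρ * (e - x (d + j))))
    - (∑ j ∈ Finset.range n, G (d + j)) * ∫ y, φ (ρ * y)| ≤ _ at m1
  rw [← e1] at m1
  have m4 : |(∑ j ∈ Finset.range n, G (d + j)) * (∫ y, φ (ρ * y)) - ∫ z, θ0 z|
      ≤ V * (D₀ * (2 * A / |ρ|)) := by
    rw [e2, ← sub_mul, abs_mul]
    gcongr
  set U := 4 * ((2 * A / A₁ + 2) * √(2 * |α|)
            + 1 / √(2 * |α|)) * √(3 / 2 + max 0 (Real.log (1 / (2 * |α|)))) with hU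
  set Z := ∑' ν : ℤ, |(ν : ℝ)| ^ (-(3 / 2) : ℝ) with hZ
  have hq : 0 ≤ A / |ρ| := by positivity
  have b1 : (n : ℝ) * ((2 * A / |ρ| + 1) * E) ≤ (2 * A / A₁ + 2) * ((2 * A / |ρ| + 1) * E) := by
    gcongr
  have b2 : E * (2 * A / |ρ|) * (2 * A / A₁) ≤ E * (2 * A / |ρ|) * (2 * A / A₁ + 2) := by
    gcongr; linarith
  -- The chain is: sum, frozen sum, zero frequency, frozen integral, integral.
  have tri : ∀ S S0 T I I0 : ℝ, |S - I| ≤ |S - S0| + |S0 - T| + |T - I0| + |I - I0| := by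
    intro S S0 T I I0
    have a1 := abs_sub_le S S0 I
    have a2 := abs_sub_le S0 T I
    have a3 := abs_sub_le T I0 I
    rw [abs_sub_comm I0 I] at a3
    linarith
  refine (tri _ _ _ _ _).trans ((add_le_add (add_le_add (add_le_add (hd1.trans b1) m1) m4)
    (hd2.trans b2)).trans (le_of_eq ?_))
  ring

/-! ### Coordinates on the fibre -/

theorem R0_pos {C X a b c : ℝ} (hC : 0 < C) (hX : 0 < X) (ha : a ≠ 0) (hH : semiH a b c ≠ 0) :
    0 < R0 C X a b c := by
  unfold R0
  split_ifs with h1 h2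
  · have h3 : 0 ≤ 4 * C / 3 * |a * X / semiH a b c| := by positivity
    have h4 : 0 < X - semiH a b c ^ 2 / (48 * a ^ 2) := by linarith
    exact Real.sqrt_pos.2 (by positivity)
  · exact one_pos
  · have h4 : 0 < X + semiH a b c ^ 2 / (48 * a ^ 2) := by positivity
    exact Real.sqrt_pos.2 (abs_pos.2 (by positivity))

/-- The formulas for d and e are homogeneous, so the scalings of a, b, c, R, I by powers of t and √X
induce the scalings 1/(t²√X) of d and 1/(t⁴√X) of e. -/
theorem upsilonInv_rescaled {a t q : ℝ} (b c s y : ℝ) (ha : a ≠ 0) (ht : t ≠ 0) (hq : q ≠ 0) :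
    upsilonInv (a * t ^ 4 / q) (b * t ^ 2 / q) (c / q)
      ((b ^ 3 - 4 * a * b * c + 8 * a ^ 2 * s) * t ^ 6 / q ^ 3)
      ((c ^ 2 - 3 * b * s + 12 * a * y) / q ^ 2)
      = ⟨a * t ^ 4 / q, b * t ^ 2 / q, c / q, 1 / (t ^ 2 * q) * s, 1 / (t ^ 4 * q) * y⟩ := by
  have h : dCoeff (a * t ^ 4 / q) (b * t ^ 2 / q) (c / q)
      ((b ^ 3 - 4 * a * b * c + 8 * a ^ 2 * s) * t ^ 6 / q ^ 3) = 1 / (t ^ 2 * q) * s := by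
    unfold dCoeff
    field_simp
    ring
  unfold upsilonInv
  rw [h]
  congr 1
  field_simp
  ring

/-- Substituting for R and I makes the height condition affine in y and quadratic in s: the
coefficient of y is 3H·12a/(4aCX) = 9H/(CX), and the leading coefficient of the parabola is
27·64a⁴/(48a²H)/(12a) = 3a/H. -/
theorem theta_fibre (i : Kind) (η : PGL(2, ℝ) → ℝ) (w : ℝ × ℝ → ℝ) (φ : ℝ → ℝ) (u : ℝ)
    {C X t a b c : ℝ} (hC : 0 < C) (hX : 0 < X) (ht : t ≠ 0) (ha : a ≠ 0)
    (hH : semiH a b c ≠ 0) (s y : ℝ) :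
    theta i η w C φ X t u a b c (b ^ 3 - 4 * a * b * c + 8 * a ^ 2 * s)
      (c ^ 2 - 3 * b * s + 12 * a * y)
      = Psi i η w ((unip u)⁻¹ • ⟨a * t ^ 4 / √X, b * t ^ 2 / √X, c / √X,
          1 / (t ^ 2 * √X) * s, 1 / (t ^ 4 * √X) * y⟩) *
        (φ (8 * a ^ 2 / R0 C X a b c * s + (b ^ 3 - 4 * a * b * c) / R0 C X a b c) *
          φ (9 * semiH a b c / (C * X) * (y - (3 * a / semiH a b c * s ^ 2
            + (9 * (b ^ 3 - 4 * a * b * c) / semiH a b c + 3 * b) / (12 * a) * s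
            + (27 * (b ^ 3 - 4 * a * b * c) ^ 2 / (48 * a ^ 2 * semiH a b c)
                + semiH a b c ^ 2 / (48 * a ^ 2) - c ^ 2) / (12 * a))))) := by
  have hq : √X ≠ 0 := (Real.sqrt_pos.2 hX).ne'
  have hR := (R0_pos hC hX ha hH).ne'
  unfold theta psi smoothHeight
  rw [upsilonInv_rescaled b c s y ha ht hq]
  unfold Gam
  congr 3
  · field_simp
    ring
  · field_simp
    ring

/-- The parametrization of the fibre lattice by the last two coefficients. -/
def fibreLatticeEquiv {a : ℤ} (ha : a ≠ 0) (b c : ℤ) : ℤ × ℤ ≃ fibreLattice a b c :=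
  have h8 : (8 * a ^ 2 : ℤ) ≠ 0 := by positivity
  have h12 : (12 * a : ℤ) ≠ 0 := by positivity
  have hdiv : ∀ d : ℤ, (b ^ 3 - 4 * a * b * c + 8 * a ^ 2 * d - b ^ 3 + 4 * a * b * c)
      / (8 * a ^ 2) = d := fun d => by
    rw [show b ^ 3 - 4 * a * b * c + 8 * a ^ 2 * d - b ^ 3 + 4 * a * b * c
      = 8 * a ^ 2 * d by ring]
    exact Int.mul_ediv_cancel_left _ h8
  Equiv.ofBijective
    (fun p => ⟨(b ^ 3 - 4 * a * b * c + 8 * a ^ 2 * p.1, c ^ 2 - 3 * b * p.1 + 12 * a * p.2),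
      by
        refine ⟨?_, ?_⟩
        · exact (Int.modEq_iff_dvd.2 ⟨-p.1, by ring⟩)
        · simp only [hdiv]
          exact (Int.modEq_iff_dvd.2 ⟨-p.2, by ring⟩)⟩)
    ⟨by
      rintro ⟨d, e⟩ ⟨d', e'⟩ h
      have h1 := congrArg (fun q : fibreLattice a b c => q.1.1) h
      have h2 := congrArg (fun q : fibreLattice a b c => q.1.2) h
      simp only at h1 h2
      have h3 : d = d' := mul_left_cancel₀ h8 (by linarith)
      subst h3
      have h4 : e = e' := mul_left_cancel₀ h12 (by linarith)
      rw [h4],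
    by
      rintro ⟨⟨R, I⟩, h1, h2⟩
      obtain ⟨d, hd⟩ := Int.modEq_iff_dvd.1 h1
      simp only at hd h2
      have hR : R = b ^ 3 - 4 * a * b * c + 8 * a ^ 2 * -d := by linarith
      rw [hR, hdiv] at h2
      obtain ⟨e, he⟩ := Int.modEq_iff_dvd.1 h2
      refine ⟨(-d, -e), ?_⟩
      exact Subtype.ext (Prod.ext hR.symm (by simp only; linarith))⟩

theorem fibreLatticeEquiv_apply {a : ℤ} (ha : a ≠ 0) (b c : ℤ) (p : ℤ × ℤ) :
    (fibreLatticeEquiv ha b c p : ℤ × ℤ)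
      = (b ^ 3 - 4 * a * b * c + 8 * a ^ 2 * p.1, c ^ 2 - 3 * b * p.1 + 12 * a * p.2) := rfl

/-- By Fubini the term g(s) is a translation in the inner integral, so only the factors k and l
enter the Jacobian. -/
theorem integral_comp_shear {f : ℝ × ℝ → ℝ} (hf : MeasureTheory.Integrable f) {k l : ℝ}
    (r : ℝ) (g : ℝ → ℝ)
    (hf' : MeasureTheory.Integrable fun z : ℝ × ℝ => f (r + k * z.1, g z.1 + l * z.2)) :
    ∫ z : ℝ × ℝ, f (r + k * z.1, g z.1 + l * z.2) = |k⁻¹| * (|l⁻¹| * ∫ z, f z) := by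
  rw [MeasureTheory.Measure.volume_eq_prod, MeasureTheory.integral_prod _ hf,
    MeasureTheory.integral_prod _ hf']
  have h1 : ∀ s, ∫ y, f (r + k * s, g s + l * y) = |l⁻¹| * ∫ y, f (r + k * s, y) := by
    intro s
    rw [MeasureTheory.Measure.integral_comp_mul_left (fun y => f (r + k * s, g s + y)) l,
      MeasureTheory.integral_add_left_eq_self (fun y => f (r + k * s, y)) (g s), smul_eq_mul]
  simp only [h1]
  rw [MeasureTheory.integral_const_mul,
    MeasureTheory.Measure.integral_comp_mul_left (fun s => ∫ y, f (r + s, y)) k,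
    MeasureTheory.integral_add_left_eq_self (fun s => ∫ y, f (s, y)) r, smul_eq_mul]
  ring

/-- The strip estimate transported to (R, I), by the lattice bijection for the sum and by the shear
for the integral. -/
theorem theta_tsum_sub_integral_le {i : Kind} {η : PGL(2, ℝ) → ℝ} {w : ℝ × ℝ → ℝ} {B K L : ℝ}
    {u : ℝ} (hF : ∀ a b c, LipBump B K L fun d e => Psi i η w ((unip u)⁻¹ • ⟨a, b, c, d, e⟩))
    (hK : 0 ≤ K) (hL : 0 ≤ L) {A D₀ D₁ D₂ : ℝ} {φ : ℝ → ℝ} (hφ : SmoothBump A D₀ D₁ D₂ φ)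
    (hA : 0 < A) {C X t : ℝ} (hC : 0 < C) (hX : 0 < X) (ht : 0 < t) {a b c : ℤ} (ha : a ≠ 0)
    {H R : ℝ} (hHdef : H = semiH a b c) (hRdef : R = R0 C X a b c) (hH : H ≠ 0) :
    (Summable fun p : fibreLattice a b c =>
      theta i η w C φ X t u a b c (p.1.1 : ℝ) (p.1.2 : ℝ)) ∧
    (MeasureTheory.Integrable fun z : ℝ × ℝ => theta i η w C φ X t u a b c z.1 z.2) ∧
    |∑' p : fibreLattice a b c, theta i η w C φ X t u a b c (p.1.1 : ℝ) (p.1.2 : ℝ)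
        - 1 / |8 * (a : ℝ) ^ 2 * (12 * a)|
          * ∫ z : ℝ × ℝ, theta i η w C φ X t u a b c z.1 z.2|
      ≤ (2 * A / (8 * (a : ℝ) ^ 2 / R) + 2) * (4 * A / |9 * H / (C * X)| + 1) *
          (L * (1 / (t ^ 4 * √X)) * (A / |9 * H / (C * X)|) * D₀ ^ 2)
        + (D₀ * (L * (6 * (K + 1))) + B * (D₁ * (2 * (A + 1)))) *
          (2 * A * D₀ / |9 * H / (C * X)| + |9 * H / (C * X)| * A * D₂ *
            (4 * ((2 * A / (8 * (a : ℝ) ^ 2 / R) + 2) * √(2 * |3 * (a : ℝ) / H|)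
            + 1 / √(2 * |3 * (a : ℝ) / H|)) *
              √(3 / 2 + max 0 (Real.log (1 / (2 * |3 * (a : ℝ) / H|))))) *
              ∑' ν : ℤ, |(ν : ℝ)| ^ (-(3 / 2) : ℝ)) := by
  have ha' : (a : ℝ) ≠ 0 := by exact_mod_cast ha
  have hH' : semiH a b c ≠ 0 := hHdef ▸ hH
  have hR : 0 < R := hRdef ▸ R0_pos hC hX ha' hH'
  have hq : 0 < √X := Real.sqrt_pos.2 hX
  have hfib := theta_fibre i η w φ u hC hX ht.ne' ha' hH'
  rw [← hHdef, ← hRdef] at hfib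
  set F : ℝ → ℝ → ℝ := fun d e => Psi i η w
    ((unip u)⁻¹ • ⟨a * t ^ 4 / √X, b * t ^ 2 / √X, c / √X, d, e⟩) with hFdef
  have hFb : LipBump B K L F := hF _ _ _
  set r : ℝ := (b : ℝ) ^ 3 - 4 * a * b * c with hr
  set β := (9 * r / H + 3 * b) / (12 * (a : ℝ)) with hβ
  set γ := (27 * r ^ 2 / (48 * (a : ℝ) ^ 2 * H) + H ^ 2 / (48 * (a : ℝ) ^ 2) - (c : ℝ) ^ 2) /
    (12 * (a : ℝ)) with hγ
  have hρ : 9 * H / (C * X) ≠ 0 := by positivity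
  obtain ⟨hs, hmain⟩ := hFb.abs_tsum_sub_integral_le hK hL hφ hA
    (σ₁ := 1 / (t ^ 2 * √X)) (σ₂ := 1 / (t ^ 4 * √X)) (A₁ := 8 * (a : ℝ) ^ 2 / R)
    (ρ := 9 * H / (C * X)) (α := 3 * (a : ℝ) / H) (by positivity) (by positivity) (by positivity)
    hρ (by positivity) (r / R) β γ
  have hφc : Continuous φ := hφ.smooth.continuous
  have hFc := hFb.continuous
  have hlat : ∀ p : ℤ × ℤ, theta i η w C φ X t u a b c
      ((fibreLatticeEquiv ha b c p : ℤ × ℤ).1 : ℝ) ((fibreLatticeEquiv ha b c p : ℤ × ℤ).2 : ℝ)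
      = F (1 / (t ^ 2 * √X) * p.1) (1 / (t ^ 4 * √X) * p.2) *
      (φ (8 * (a : ℝ) ^ 2 / R * p.1 + r / R) * φ (9 * H / (C * X) *
        (p.2 - (3 * (a : ℝ) / H * (p.1 : ℝ) ^ 2 + β * p.1 + γ)))) := by
    intro p
    rw [fibreLatticeEquiv_apply]
    push_cast
    exact hfib p.1 p.2
  have hint : MeasureTheory.Integrable fun z : ℝ × ℝ => theta i η w C φ X t u a b c z.1 z.2 := by
    have hs : Continuous fun z : ℝ × ℝ => (1 / (t ^ 2 * √X) * ((z.1 - r) / (8 * (a : ℝ) ^ 2)),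
        1 / (t ^ 4 * √X) * ((z.2 - (c : ℝ) ^ 2 + 3 * b * ((z.1 - r) / (8 * (a : ℝ) ^ 2))) /
          (12 * a))) := by fun_prop
    -- In the variables (R, I) the support is again a strip around a parabola, with slopes 1/R₀ and
    -- ρ/(12a).
    have h1 := integrable_strip (hFc.comp hs) hφc hφ.support
      (x := fun s => 12 * a * (3 * (a : ℝ) / H * ((s - r) / (8 * (a : ℝ) ^ 2)) ^ 2
        + β * ((s - r) / (8 * (a : ℝ) ^ 2)) + γ) + (c : ℝ) ^ 2
        - 3 * b * ((s - r) / (8 * (a : ℝ) ^ 2)))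
      (by fun_prop) (a := 1 / R) (ρ := 9 * H / (C * X) / (12 * a)) (by positivity) (by positivity) 0
    refine h1.congr (Filter.Eventually.of_forall fun z => ?_)
    have h2 := hfib ((z.1 - r) / (8 * (a : ℝ) ^ 2))
      ((z.2 - (c : ℝ) ^ 2 + 3 * b * ((z.1 - r) / (8 * (a : ℝ) ^ 2))) / (12 * a))
    have e1 : r + 8 * (a : ℝ) ^ 2 * ((z.1 - r) / (8 * (a : ℝ) ^ 2)) = z.1 := by
      field_simp; ring
    have e2 : ((c : ℝ) ^ 2 - 3 * b * ((z.1 - r) / (8 * (a : ℝ) ^ 2)) + 12 * a *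
      ((z.2 - (c : ℝ) ^ 2 + 3 * b * ((z.1 - r) / (8 * (a : ℝ) ^ 2))) / (12 * a))) = z.2 := by
      rw [mul_div_cancel₀ _ (by positivity)]; ring
    rw [e1, e2] at h2
    simp only [h2]
    simp only [Function.comp, hFdef]
    congr 3
    · field_simp
      ring
    · rw [div_mul_eq_mul_div, mul_div_assoc]
      congr 1
      rw [div_eq_iff (by positivity), sub_mul, div_mul_cancel₀ _ (by positivity)]
      ring
  have hint2 := integrable_strip (hFc.comp (by fun_prop : Continuous fun z : ℝ × ℝ =>
      (1 / (t ^ 2 * √X) * z.1, 1 / (t ^ 4 * √X) * z.2))) hφc hφ.support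
      (x := fun s => 3 * (a : ℝ) / H * s ^ 2 + β * s + γ) (by fun_prop)
      (a := 8 * (a : ℝ) ^ 2 / R) (by positivity) hρ (r / R)
  have hfib2 : ∀ z : ℝ × ℝ, theta i η w C φ X t u a b c (r + 8 * (a : ℝ) ^ 2 * z.1)
      ((c : ℝ) ^ 2 - 3 * b * z.1 + 12 * a * z.2)
      = F (1 / (t ^ 2 * √X) * z.1) (1 / (t ^ 4 * √X) * z.2) *
      (φ (8 * (a : ℝ) ^ 2 / R * z.1 + r / R) * φ (9 * H / (C * X) *
        (z.2 - (3 * (a : ℝ) / H * z.1 ^ 2 + β * z.1 + γ)))) := fun z => hfib z.1 z.2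
  have hshear := integral_comp_shear hint (k := 8 * (a : ℝ) ^ 2) (l := 12 * a) r
    (fun s => (c : ℝ) ^ 2 - 3 * b * s) (by
      simp only [hfib2]
      exact hint2)
  simp only [hfib2] at hshear
  refine ⟨?_, hint, ?_⟩
  · rw [← (fibreLatticeEquiv ha b c).summable_iff]
    refine hs.congr fun p => (hlat p).symm
  · rw [← (fibreLatticeEquiv ha b c).tsum_eq]
    simp only [hlat]
    rw [hshear] at hmain
    rw [abs_inv, abs_inv, ← mul_assoc] at hmain
    have e : 1 / |8 * (a : ℝ) ^ 2 * (12 * a)| = |8 * (a : ℝ) ^ 2|⁻¹ * |12 * (a : ℝ)|⁻¹ := by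
      rw [abs_mul, one_div, mul_inv]
    rw [e]
    exact hmain

/-! ### Sizes on the restricted box -/

/-- For H > 0 the subtracted square only decreases the radicand, unless R₀ = 1; for H < 0 the added
square contributes the term |H|^(3/2). -/
theorem R0_le {C X a b c : ℝ} (hX : 0 < X) (ha : a ≠ 0) :
    R0 C X a b c ≤ 2 * |a| * √|semiH a b c| * √X + √|semiH a b c| ^ 3 + 1 := by
  have hk : √|semiH a b c| ^ 2 = |semiH a b c| := Real.sq_sqrt (abs_nonneg _)
  have hq : √X ^ 2 = X := Real.sq_sqrt hX.le
  set k := √|semiH a b c| with hkdef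
  set q := √X with hqdef
  have hk0 : 0 ≤ k := Real.sqrt_nonneg _
  have hq0 : 0 ≤ q := Real.sqrt_nonneg _
  have ha2 : |a| ^ 2 = a ^ 2 := sq_abs a
  have hsq : (2 * |a| * k * q) ^ 2 = 4 * a ^ 2 * |semiH a b c| * X := by
    rw [mul_pow, mul_pow, mul_pow, ha2, hk, hq]; ring
  have hsq3 : (k ^ 3) ^ 2 = |semiH a b c| ^ 3 := by rw [← hk]; ring
  have hnn : 0 ≤ 2 * |a| * k * q := by positivity
  have hnn3 : 0 ≤ k ^ 3 := by positivity
  unfold R0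
  split_ifs with h1 h2
  · rw [abs_of_pos h1] at hsq
    have : √(48 * a ^ 2 * semiH a b c / 27 * (X - semiH a b c ^ 2 / (48 * a ^ 2)))
        ≤ 2 * |a| * k * q := by
      refine Real.sqrt_le_iff.2 ⟨hnn, ?_⟩
      rw [hsq]
      have h3 : 0 ≤ semiH a b c ^ 2 / (48 * a ^ 2) := by positivity
      have h4 : 0 ≤ a ^ 2 * semiH a b c := by positivity
      nlinarith [mul_nonneg h4 h3, mul_nonneg h4 hX.le]
    linarith
  · linarith
  · have : √|48 * a ^ 2 * semiH a b c / 27 * (X + semiH a b c ^ 2 / (48 * a ^ 2))|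
        ≤ 2 * |a| * k * q + k ^ 3 := by
      refine Real.sqrt_le_iff.2 ⟨by positivity, ?_⟩
      have h3 : 0 ≤ X + semiH a b c ^ 2 / (48 * a ^ 2) := by positivity
      rw [abs_mul, abs_of_nonneg h3, abs_div, abs_mul, abs_of_nonneg (by positivity :
        0 ≤ 48 * a ^ 2), abs_of_pos (by norm_num : (0 : ℝ) < 27), ← sq_abs (semiH a b c)]
      have e : 48 * a ^ 2 * |semiH a b c| / 27 * (X + |semiH a b c| ^ 2 / (48 * a ^ 2))
          = 16 / 9 * (a ^ 2 * |semiH a b c| * X) + |semiH a b c| ^ 3 / 27 := by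
        field_simp
        ring
      rw [e, add_sq, hsq, hsq3]
      have h4 : 0 ≤ a ^ 2 * |semiH a b c| * X := by positivity
      have h5 : 0 ≤ |semiH a b c| ^ 3 := by positivity
      have h6 : 0 ≤ 2 * (2 * |a| * k * q) * k ^ 3 := by positivity
      linarith
    linarith

theorem abs_semiH_le {a b c q : ℝ} (ha : |a| ≤ q) (hb : |b| ≤ q) (hc : |c| ≤ q) :
    |semiH a b c| ≤ (4 * q) ^ 2 := by
  have h0 : 0 ≤ q := (abs_nonneg _).trans ha
  have h1 : |a * c| ≤ q * q := by rw [abs_mul]; gcongr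
  have h2 : b ^ 2 ≤ q ^ 2 := by rw [← sq_abs]; gcongr
  unfold semiH
  rw [abs_le] at h1 ⊢
  constructor <;> nlinarith [h1.1, h1.2, sq_nonneg b, sq_nonneg q]

/-- The sizes of `a` and `H` on the restricted box, in the normalization `p = √X / √|H|` and
`r = √X / |a|`. -/
theorem restrictedBox_ranges {M X δ : ℝ} (hM : 0 < M) (hX : 1 ≤ X) (hδ : 0 < δ)
    (hδ' : δ < 1 / 28) {a b c : ℤ} (h : (a, b, c) ∈ restrictedBox M X δ) :
    ∃ p r : ℝ, 0 < p ∧ 0 < r ∧ √X = (X ^ (1 / 4 : ℝ)) ^ 2 ∧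
      |(a : ℝ)| = (X ^ (1 / 4 : ℝ)) ^ 2 / r ∧
      √|semiH a b c| = (X ^ (1 / 4 : ℝ)) ^ 2 / p ∧ |semiH a b c| = (X ^ (1 / 4 : ℝ)) ^ 4 / p ^ 2 ∧
      p ≤ (X ^ δ) ^ 14 ∧ r ≤ (X ^ δ) ^ 6 ∧ 1 ≤ 4 * M * p ∧ 1 ≤ M * r ∧
      (X ^ δ) ^ 7 ≤ X ^ (1 / 4 : ℝ) ∧ a ≠ 0 ∧ semiH a b c ≠ 0 := by
  have hX0 : 0 < X := by linarith
  obtain ⟨⟨ha1, ha2, -, hc2, -, hb2, hH0⟩, hH⟩ := h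
  simp only at ha1 ha2 hc2 hb2 hH0 hH
  have es : √X = (X ^ (1 / 4 : ℝ)) ^ 2 := by
    rw [Real.sqrt_eq_rpow, ← Real.rpow_natCast, ← Real.rpow_mul hX0.le]; norm_num
  have es' : X ^ (1 / 2 : ℝ) = (X ^ (1 / 4 : ℝ)) ^ 2 := by
    rw [← Real.rpow_natCast, ← Real.rpow_mul hX0.le]; norm_num
  have es4 : X = (X ^ (1 / 4 : ℝ)) ^ 4 := by
    rw [← Real.rpow_natCast, ← Real.rpow_mul hX0.le]; norm_num
  have ea : X ^ (1 / 2 - 6 * δ) * (X ^ δ) ^ 6 = (X ^ (1 / 4 : ℝ)) ^ 2 := by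
    rw [← es', ← Real.rpow_natCast, ← Real.rpow_mul hX0.le, ← Real.rpow_add hX0]
    congr 1; push_cast; ring
  have eh : X ^ (1 - 28 * δ) * (X ^ δ) ^ 28 = (X ^ (1 / 4 : ℝ)) ^ 4 := by
    rw [← es4, ← Real.rpow_natCast, ← Real.rpow_mul hX0.le, ← Real.rpow_add hX0]
    conv_rhs => rw [← Real.rpow_one X]
    congr 1; push_cast; ring
  -- This is where δ < 1/28 enters: 7δ ≤ 1/4.
  have hsy : (X ^ δ) ^ 7 ≤ X ^ (1 / 4 : ℝ) := by
    rw [← Real.rpow_natCast, ← Real.rpow_mul hX0.le]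
    refine Real.rpow_le_rpow_of_exponent_le hX ?_
    push_cast; linarith
  have hs0 : 0 < X ^ (1 / 4 : ℝ) := by positivity
  have hy0 : 0 < X ^ δ := by positivity
  have ha0 : 0 < |(a : ℝ)| := lt_of_lt_of_le (by positivity) ha1
  have hh0 : 0 < |semiH a b c| := abs_pos.2 hH0
  have hk0 : 0 < √|semiH a b c| := Real.sqrt_pos.2 hh0
  rw [es'] at ha2 hb2 hc2
  have hHle := abs_semiH_le ha2 hb2 hc2
  set s := X ^ (1 / 4 : ℝ) with hs
  set y := X ^ δ with hy
  set k := √|semiH a b c| with hk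
  have hkk : k ^ 2 = |semiH a b c| := Real.sq_sqrt hh0.le
  have hkle : k ≤ 4 * (M * s ^ 2) := Real.sqrt_le_iff.2 ⟨by positivity, hHle⟩
  have hkge : s ^ 2 ≤ y ^ 14 * k := by
    refine le_of_sq_le_sq ?_ (by positivity)
    calc (s ^ 2) ^ 2 = X ^ (1 - 28 * δ) * y ^ 28 := by rw [eh]; ring
      _ ≤ |semiH a b c| * y ^ 28 := by gcongr
      _ = (y ^ 14 * k) ^ 2 := by rw [← hkk]; ring
  refine ⟨s ^ 2 / k, s ^ 2 / |(a : ℝ)|, by positivity, by positivity, es, by field_simp,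
    by field_simp, ?_, ?_, ?_, ?_, ?_, hsy, by simpa using ha0, hH0⟩
  · rw [← hkk]; field_simp
  · rwa [div_le_iff₀ hk0]
  · rw [div_le_iff₀ ha0, ← ea, mul_comm]
    gcongr
  · rw [← mul_div_assoc, le_div_iff₀ hk0]; linarith
  · rw [← mul_div_assoc, le_div_iff₀ ha0]; linarith

/-! ### Elementary estimates of the error terms, with s = X^(1/4) and y = X^δ -/

theorem window_le {A s p r R : ℝ} (hA : 0 < A) (hs : 0 < s) (hp : 0 < p) (hr : 0 < r)
    (hR0 : 0 < R) (hR : R ≤ 2 * (s ^ 2 / r) * (s ^ 2 / p) * s ^ 2 + (s ^ 2 / p) ^ 3 + 1)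
    (ha : 1 ≤ s ^ 2 / r) :
    2 * A / (8 * (s ^ 2 / r) ^ 2 / R) + 2
      ≤ (A + 2) * (s ^ 2 * r / p + s ^ 2 * r ^ 2 / p ^ 3 + 1) := by
  -- The number of values of d is governed by R₀/a²; the last term uses |a| ≥ 1.
  have h1 : R / (s ^ 2 / r) ^ 2 ≤ 2 * (s ^ 2 * r / p) + s ^ 2 * r ^ 2 / p ^ 3 + 1 := by
    rw [div_le_iff₀ (by positivity)]
    have e : (2 * (s ^ 2 * r / p) + s ^ 2 * r ^ 2 / p ^ 3 + 1) * (s ^ 2 / r) ^ 2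
        = 2 * (s ^ 2 / r) * (s ^ 2 / p) * s ^ 2 + (s ^ 2 / p) ^ 3 + (s ^ 2 / r) ^ 2 := by
      field_simp
    rw [e]
    have := one_le_pow₀ ha (n := 2)
    linarith
  have e2 : 2 * A / (8 * (s ^ 2 / r) ^ 2 / R) = A / 4 * (R / (s ^ 2 / r) ^ 2) := by
    field_simp; ring
  rw [e2]
  have h2 : 0 ≤ s ^ 2 * r / p := by positivity
  have h3 : 0 ≤ s ^ 2 * r ^ 2 / p ^ 3 := by positivity
  calc A / 4 * (R / (s ^ 2 / r) ^ 2) + 2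
      ≤ A / 4 * (2 * (s ^ 2 * r / p) + s ^ 2 * r ^ 2 / p ^ 3 + 1) + 2 := by gcongr
    _ ≤ _ := by nlinarith [mul_nonneg hA.le h2, mul_nonneg hA.le h3]

/-- The freezing error is of size window · width² / √X, the width being of order p². Its worst term
is rp³ ≤ y^(6+42), the source of the largest power of X^δ in the theorem. -/
theorem window_mul_pow_le {s p r y : ℝ} (hp : 0 < p) (hr : 0 < r) (hy : 1 ≤ y)
    (hpy : p ≤ y ^ 14) (hry : r ≤ y ^ 6) (hsy : y ^ 7 ≤ s) :
    (s ^ 2 * r / p + s ^ 2 * r ^ 2 / p ^ 3 + 1) * (p ^ 4 / s ^ 2) ≤ 3 * y ^ 48 := by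
  have hs : 0 < s := lt_of_lt_of_le (by positivity) hsy
  have e : (s ^ 2 * r / p + s ^ 2 * r ^ 2 / p ^ 3 + 1) * (p ^ 4 / s ^ 2)
      = r * p ^ 3 + r ^ 2 * p + p ^ 4 / s ^ 2 := by field_simp
  rw [e]
  have h1 : r * p ^ 3 ≤ y ^ 48 := by
    calc r * p ^ 3 ≤ y ^ 6 * (y ^ 14) ^ 3 := by gcongr
      _ = y ^ 48 := by ring
  have h2 : r ^ 2 * p ≤ y ^ 48 := by
    calc r ^ 2 * p ≤ (y ^ 6) ^ 2 * y ^ 14 := by gcongr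
      _ = y ^ 26 := by ring
      _ ≤ y ^ 48 := pow_le_pow_right₀ hy (by norm_num)
  have h3 : p ^ 4 / s ^ 2 ≤ y ^ 48 := by
    rw [div_le_iff₀ (by positivity)]
    calc p ^ 4 ≤ (y ^ 14) ^ 4 := by gcongr
      _ = y ^ 42 * (y ^ 7) ^ 2 := by ring
      _ ≤ y ^ 48 * s ^ 2 := by
        have := pow_le_pow_right₀ hy (show 42 ≤ 48 by norm_num)
        gcongr
  linarith

/-- Weyl's bound with 2|α| = 6p²/(rs²): both the window times √|α| and 1/√|α| have size s = X^(1/4)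
up to powers of y. The lower bounds on p and r, which come from |a| and |H| being at most their
maximal sizes, absorb the negative powers. -/
theorem window_mul_sqrt_le {M m s p r y : ℝ} (hM : 0 < M) (hm : 0 < m) (hp : 0 < p) (hr : 0 < r)
    (hy : 1 ≤ y) (hs : 1 ≤ s) (hpy : p ≤ y ^ 14) (hry : r ≤ y ^ 6) (hpm : 1 ≤ m * p)
    (hrM : 1 ≤ M * r) {N c : ℝ} (hc : 0 ≤ c)
    (hN : N ≤ c * (s ^ 2 * r / p + s ^ 2 * r ^ 2 / p ^ 3 + 1)) :
    N * √(6 * p ^ 2 / (r * s ^ 2)) + 1 / √(6 * p ^ 2 / (r * s ^ 2))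
      ≤ (c * √(6 * M) * (2 + m ^ 2) + m) * (s * y ^ 14) := by
  have hs0 : 0 < s := by linarith
  have hy0 : 0 < y := by linarith
  set μ := √(6 * M) with hμ
  have hμ0 : 0 ≤ μ := Real.sqrt_nonneg _
  have hμ2 : μ ^ 2 = 6 * M := Real.sq_sqrt (by positivity)
  have h1 : √(6 * p ^ 2 / (r * s ^ 2)) ≤ μ * p / s := by
    refine Real.sqrt_le_iff.2 ⟨by positivity, ?_⟩
    rw [div_pow, mul_pow, hμ2, div_le_div_iff₀ (by positivity) (by positivity)]
    have : 0 ≤ 6 * p ^ 2 * s ^ 2 := by positivity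
    nlinarith
  have h2 : 1 / √(6 * p ^ 2 / (r * s ^ 2)) ≤ m * (s * y ^ 3) := by
    rw [← Real.sqrt_one, ← Real.sqrt_div zero_le_one]
    refine Real.sqrt_le_iff.2 ⟨by positivity, ?_⟩
    rw [one_div_div, div_le_iff₀ (by positivity)]
    have h3 : 1 ≤ (m * p) ^ 2 := one_le_pow₀ hpm
    calc r * s ^ 2 ≤ y ^ 6 * s ^ 2 * 1 := by nlinarith [sq_nonneg s]
      _ ≤ y ^ 6 * s ^ 2 * (6 * (m * p) ^ 2) := by gcongr; linarith
      _ = (m * (s * y ^ 3)) ^ 2 * (6 * p ^ 2) := by ring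
  have hy14 : y ^ 6 ≤ y ^ 14 := pow_le_pow_right₀ hy (by norm_num)
  have hy12 : y ^ 12 ≤ y ^ 14 := pow_le_pow_right₀ hy (by norm_num)
  have hy3 : y ^ 3 ≤ y ^ 14 := pow_le_pow_right₀ hy (by norm_num)
  have h4 : (s ^ 2 * r / p + s ^ 2 * r ^ 2 / p ^ 3 + 1) * (μ * p / s)
      ≤ μ * (2 + m ^ 2) * (s * y ^ 14) := by
    have e : (s ^ 2 * r / p + s ^ 2 * r ^ 2 / p ^ 3 + 1) * (μ * p / s)
        = μ * (s * r + s * (r ^ 2 * (1 / p) ^ 2) + p / s) := by field_simp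
    have h5 : 1 / p ≤ m := by rw [div_le_iff₀ hp]; exact hpm
    have h6 : p / s ≤ s * y ^ 14 := by
      rw [div_le_iff₀ hs0]
      calc p ≤ 1 * y ^ 14 * 1 := by linarith
        _ ≤ s * y ^ 14 * s := by gcongr
    have h7 : s * r ≤ s * y ^ 14 := by gcongr; linarith
    have h8 : s * (r ^ 2 * (1 / p) ^ 2) ≤ s * (y ^ 14 * m ^ 2) := by
      gcongr
      calc r ^ 2 ≤ (y ^ 6) ^ 2 := by gcongr
        _ = y ^ 12 := by ring
        _ ≤ y ^ 14 := hy12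
    rw [e, mul_assoc]
    gcongr
    linarith
  have h9 : 0 ≤ s ^ 2 * r / p + s ^ 2 * r ^ 2 / p ^ 3 + 1 := by positivity
  calc N * √(6 * p ^ 2 / (r * s ^ 2)) + 1 / √(6 * p ^ 2 / (r * s ^ 2))
      ≤ c * (s ^ 2 * r / p + s ^ 2 * r ^ 2 / p ^ 3 + 1) * (μ * p / s) + m * (s * y ^ 3) := by
        gcongr
    _ = c * ((s ^ 2 * r / p + s ^ 2 * r ^ 2 / p ^ 3 + 1) * (μ * p / s)) + m * (s * y ^ 3) := by ring
    _ ≤ c * (μ * (2 + m ^ 2) * (s * y ^ 14)) + m * (s * y ^ 14) := by gcongr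
    _ = _ := by ring

/-- The reciprocal of the leading coefficient is at most a constant times X, and the logarithm of X
is at most X^δ/δ. -/
theorem sqrt_log_le {X δ m s p r y : ℝ} (hX : 1 ≤ X) (hδ : 0 < δ) (hm : 0 < m) (hp : 0 < p)
    (hr : 0 < r) (hy : y = X ^ δ) (hsX : s ^ 4 = X) (hry : r ≤ y ^ 6) (hpm : 1 ≤ m * p)
    (hsy : y ^ 7 ≤ s) (hs : 1 ≤ s) :
    √(3 / 2 + max 0 (Real.log (1 / (6 * p ^ 2 / (r * s ^ 2)))))
      ≤ (3 / 2 + |Real.log (m ^ 2)| + 1 / δ) * y := by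
  have hX0 : 0 < X := by linarith
  have hy1 : 1 ≤ y := hy ▸ Real.one_le_rpow hX hδ.le
  have h1 : 1 / (6 * p ^ 2 / (r * s ^ 2)) ≤ m ^ 2 * X := by
    rw [one_div_div, div_le_iff₀ (by positivity)]
    have h3 : 1 ≤ (m * p) ^ 2 := one_le_pow₀ hpm
    have h4 : r ≤ s ^ 2 := by
      calc r ≤ y ^ 6 := hry
        _ ≤ y ^ 7 := pow_le_pow_right₀ hy1 (by norm_num)
        _ ≤ s := hsy
        _ ≤ s ^ 2 := by nlinarith
    calc r * s ^ 2 ≤ s ^ 2 * s ^ 2 := by gcongr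
      _ = X * 1 := by rw [← hsX]; ring
      _ ≤ X * (6 * (m * p) ^ 2) := by gcongr; linarith
      _ = m ^ 2 * X * (6 * p ^ 2) := by ring
  have h2 : Real.log (1 / (6 * p ^ 2 / (r * s ^ 2))) ≤ |Real.log (m ^ 2)| + 1 / δ * y := by
    refine (Real.log_le_log (by positivity) h1).trans ?_
    rw [Real.log_mul (by positivity) hX0.ne']
    have h5 := Real.log_le_rpow_div hX0.le hδ
    rw [← hy] at h5
    have h6 := le_abs_self (Real.log (m ^ 2))
    have h7 : 1 / δ * y = y / δ := by ring
    linarith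
  have h3 : 3 / 2 + max 0 (Real.log (1 / (6 * p ^ 2 / (r * s ^ 2))))
      ≤ (3 / 2 + |Real.log (m ^ 2)| + 1 / δ) * y := by
    have h4 : 0 ≤ |Real.log (m ^ 2)| := abs_nonneg _
    have h5 : 0 ≤ 1 / δ * y := by positivity
    have : max 0 (Real.log (1 / (6 * p ^ 2 / (r * s ^ 2)))) ≤ |Real.log (m ^ 2)| + 1 / δ * y :=
      max_le (by positivity) h2
    nlinarith
  have h1' : 1 ≤ (3 / 2 + |Real.log (m ^ 2)| + 1 / δ) * y := by
    have : 1 ≤ 3 / 2 + max 0 (Real.log (1 / (6 * p ^ 2 / (r * s ^ 2)))) := by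
      linarith [le_max_left 0 (Real.log (1 / (6 * p ^ 2 / (r * s ^ 2))))]
    linarith
  refine Real.sqrt_le_iff.2 ⟨by linarith, h3.trans ?_⟩
  nlinarith

/-- The constant is chosen before anything is known about the sign of `D`: non-negativity only
follows once a good approximation exists, so it is quantified after `E`. Here z stands for X^(δs),
and the Fourier part costs z² from the variation times z⁴ from the second derivative. -/
theorem exists_error_bound {A B C K L M m Z δ : ℝ} {D : ℕ → ℝ} (hA : 0 < A) (hB : 0 ≤ B)
    (hC : 0 < C) (hK : 0 ≤ K) (hL : 0 ≤ L) (hM : 0 < M) (hm : 0 < m) (hZ : 0 ≤ Z) (hδ : 0 < δ) :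
    ∃ E : ℝ, ∀ X s y z p r R t : ℝ, (∀ k, 0 ≤ D k) → 1 ≤ X → s ^ 4 = X → y = X ^ δ → 1 ≤ z →
      0 < p → 0 < r → p ≤ y ^ 14 → r ≤ y ^ 6 → 1 ≤ m * p → 1 ≤ M * r → y ^ 7 ≤ s →
      1 ≤ s ^ 2 / r → 0 < R → R ≤ 2 * (s ^ 2 / r) * (s ^ 2 / p) * s ^ 2 + (s ^ 2 / p) ^ 3 + 1 →
      3 / 4 ≤ t ^ 4 →
      (2 * A / (8 * (s ^ 2 / r) ^ 2 / R) + 2) * (4 * A / (9 / (C * p ^ 2)) + 1) *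
          (L * (1 / (t ^ 4 * s ^ 2)) * (A / (9 / (C * p ^ 2))) * D 0 ^ 2)
        + (D 0 * (L * (6 * (K + 1))) + B * (D 1 * z ^ 2 * (2 * (A + 1)))) *
          (2 * A * D 0 / (9 / (C * p ^ 2)) + 9 / (C * p ^ 2) * A * (D 2 * z ^ 4) *
            (4 * ((2 * A / (8 * (s ^ 2 / r) ^ 2 / R) + 2) * √(6 * p ^ 2 / (r * s ^ 2))
            + 1 / √(6 * p ^ 2 / (r * s ^ 2))) *
              √(3 / 2 + max 0 (Real.log (1 / (6 * p ^ 2 / (r * s ^ 2)))))) * Z)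
        ≤ E * (s * z ^ 12 * y ^ 50) := by
  set c₁ := (A + 2) * √(6 * M) * (2 + m ^ 2) + m with hc₁
  set c₂ := 3 / 2 + |Real.log (m ^ 2)| + 1 / δ with hc₂
  have hc₁0 : 0 ≤ c₁ := by positivity
  have hc₂0 : 0 ≤ c₂ := by positivity
  refine ⟨(A + 2) * 3 * (4 * A * C / 9 + m ^ 2) * (L * (4 / 3) * (A * C / 9) * D 0 ^ 2)
    + (D 0 * (L * (6 * (K + 1))) + B * (D 1 * (2 * (A + 1)))) *
      (2 * A * D 0 * (C / 9) + 9 * m ^ 2 / C * A * D 2 * (4 * c₁ * c₂) * Z), ?_⟩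
  intro X s y z p r R t hD hX hsX hyX hz hp hr hpy hry hpm hrM hsy ha hR0 hR ht
  have hy : 1 ≤ y := hyX ▸ Real.one_le_rpow hX hδ.le
  have hs : 1 ≤ s := (one_le_pow₀ hy).trans hsy
  have hs0 : 0 < s := by linarith
  have hy0 : 0 < y := by linarith
  have hz0 : 0 < z := by linarith
  have ht0 : 0 < t ^ 4 := by linarith
  have hD0 := hD 0
  have hD1 := hD 1
  have hD2 := hD 2
  have hN := window_le hA hs0 hp hr hR0 hR ha
  have hU := window_mul_sqrt_le hM hm hp hr hy hs hpy hry hpm hrM (by positivity) hN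
  have hlog := sqrt_log_le hX hδ hm hp hr hyX hsX hry hpm hsy hs
  have hW := window_mul_pow_le hp hr hy hpy hry hsy
  set N := 2 * A / (8 * (s ^ 2 / r) ^ 2 / R) + 2 with hNdef
  have hN0 : 0 ≤ N := by positivity
  set W := s ^ 2 * r / p + s ^ 2 * r ^ 2 / p ^ 3 + 1 with hWdef
  set S := √(3 / 2 + max 0 (Real.log (1 / (6 * p ^ 2 / (r * s ^ 2))))) with hS
  set U := N * √(6 * p ^ 2 / (r * s ^ 2)) + 1 / √(6 * p ^ 2 / (r * s ^ 2)) with hUdef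
  have hU0 : 0 ≤ U := by positivity
  have hS0 : 0 ≤ S := Real.sqrt_nonneg _
  have hmp : 1 ≤ (m * p) ^ 2 := one_le_pow₀ hpm
  have e1 : 4 * A / (9 / (C * p ^ 2)) + 1 ≤ (4 * A * C / 9 + m ^ 2) * p ^ 2 := by
    have : 4 * A / (9 / (C * p ^ 2)) = 4 * A * C / 9 * p ^ 2 := by field_simp
    rw [this, add_mul, ← mul_pow]
    linarith
  have e2 : A / (9 / (C * p ^ 2)) = A * C / 9 * p ^ 2 := by field_simp
  have e3 : 1 / (t ^ 4 * s ^ 2) ≤ 4 / 3 / s ^ 2 := by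
    rw [div_le_div_iff₀ (by positivity) (by positivity)]
    have := mul_le_mul_of_nonneg_right ht (sq_nonneg s)
    linarith
  have hy48 : y ^ 48 ≤ s * z ^ 12 * y ^ 50 := by
    calc y ^ 48 ≤ y ^ 50 := pow_le_pow_right₀ hy (by norm_num)
      _ = 1 * 1 * y ^ 50 := by ring
      _ ≤ s * z ^ 12 * y ^ 50 := by
        have := one_le_pow₀ hz (n := 12)
        gcongr
  have near : N * (4 * A / (9 / (C * p ^ 2)) + 1) *
          (L * (1 / (t ^ 4 * s ^ 2)) * (A / (9 / (C * p ^ 2))) * D 0 ^ 2)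
      ≤ (A + 2) * 3 * (4 * A * C / 9 + m ^ 2) * (L * (4 / 3) * (A * C / 9) * D 0 ^ 2) *
        (s * z ^ 12 * y ^ 50) := by
    rw [e2]
    calc _ ≤ ((A + 2) * W) * ((4 * A * C / 9 + m ^ 2) * p ^ 2) *
          (L * (4 / 3 / s ^ 2) * (A * C / 9 * p ^ 2) * D 0 ^ 2) := by gcongr
      _ = (A + 2) * (4 * A * C / 9 + m ^ 2) * (L * (4 / 3) * (A * C / 9) * D 0 ^ 2) *
          (W * (p ^ 4 / s ^ 2)) := by field_simp
      _ ≤ (A + 2) * (4 * A * C / 9 + m ^ 2) * (L * (4 / 3) * (A * C / 9) * D 0 ^ 2) *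
          (3 * (s * z ^ 12 * y ^ 50)) :=
          mul_le_mul_of_nonneg_left (by linarith) (by positivity)
      _ = _ := by ring
  have v1 : D 0 * (L * (6 * (K + 1))) + B * (D 1 * z ^ 2 * (2 * (A + 1)))
      ≤ (D 0 * (L * (6 * (K + 1))) + B * (D 1 * (2 * (A + 1)))) * z ^ 2 := by
    have h1 : 1 ≤ z ^ 2 := one_le_pow₀ hz
    have h2 := le_mul_of_one_le_right (by positivity : 0 ≤ D 0 * (L * (6 * (K + 1)))) h1
    linarith
  have f1 : 2 * A * D 0 / (9 / (C * p ^ 2)) ≤ 2 * A * D 0 * (C / 9) * (z ^ 4 * (s * y ^ 28)) := by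
    have e4 : 2 * A * D 0 / (9 / (C * p ^ 2)) = 2 * A * D 0 * (C / 9) * p ^ 2 := by field_simp
    rw [e4]
    gcongr
    calc p ^ 2 ≤ (y ^ 14) ^ 2 := by gcongr
      _ = 1 * (1 * y ^ 28) := by ring
      _ ≤ z ^ 4 * (s * y ^ 28) := by
        have := one_le_pow₀ hz (n := 4)
        gcongr
  have f2 : 9 / (C * p ^ 2) ≤ 9 * m ^ 2 / C := by
    rw [div_le_div_iff₀ (by positivity) hC]
    have := mul_le_mul_of_nonneg_left hmp (by positivity : 0 ≤ 9 * C)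
    linarith
  have f3 : 9 / (C * p ^ 2) * A * (D 2 * z ^ 4) * (4 * U * S) * Z
      ≤ 9 * m ^ 2 / C * A * D 2 * (4 * c₁ * c₂) * Z * (z ^ 4 * (s * y ^ 28)) := by
    calc _ ≤ 9 * m ^ 2 / C * A * (D 2 * z ^ 4) * (4 * (c₁ * (s * y ^ 14)) * (c₂ * y)) * Z := by
          gcongr
      _ = 9 * m ^ 2 / C * A * D 2 * (4 * c₁ * c₂) * Z * (z ^ 4 * (s * y ^ 15)) := by ring
      _ ≤ _ := by
        have := pow_le_pow_right₀ hy (show 15 ≤ 28 by norm_num)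
        gcongr
  have hzy : z ^ 2 * (z ^ 4 * (s * y ^ 28)) ≤ s * z ^ 12 * y ^ 50 := by
    have h1 := pow_le_pow_right₀ hz (show 6 ≤ 12 by norm_num)
    have h2 := pow_le_pow_right₀ hy (show 28 ≤ 50 by norm_num)
    calc z ^ 2 * (z ^ 4 * (s * y ^ 28)) = s * z ^ 6 * y ^ 28 := by ring
      _ ≤ _ := by gcongr
  have hsum := add_le_add f1 f3
  rw [← add_mul] at hsum
  refine (add_le_add near ?_).trans_eq (add_mul _ _ _).symm
  refine (mul_le_mul v1 hsum (by positivity) (by positivity)).trans ?_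
  rw [mul_mul_mul_comm]
  gcongr

end BinaryQuartic

end

/-! ### Conclusion: the constants inserted -/

theorem mainTheorem6 (i : Kind)
    (η : PGL(2, ℝ) → ℝ) (hη_smooth : SmoothOnPGL η) (hη_supp : CompactlySupportedOnPGL η)
    (w : ℝ × ℝ → ℝ) (hw_smooth : ContDiff ℝ ∞ w) (hw_compact : HasCompactSupport w)
    (hw_supp : tsupport w ⊆ unitRegion i)
    (C M : ℝ) (hC : 0 < C) (hM : 0 < M)
    (δ δs : ℝ) (hδ : 0 < δ) (hδ' : δ < 1 / 28) (hδs : 0 < δs)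
    (A : ℝ) (D : ℕ → ℝ) (hA : 0 < A) :
    ∃ K X₀ : ℝ, 1 ≤ X₀ ∧ ∀ X : ℝ, X₀ ≤ X →
      ∀ φ : ℝ → ℝ, GoodApprox A D (X ^ (-δs)) φ →
      ∀ t u : ℝ, (3 : ℝ) ^ (1 / 4 : ℝ) / √2 ≤ t → t ≤ X ^ δ → |u| ≤ 1 / 2 →
      ∀ a b c : ℤ, (a, b, c) ∈ restrictedBox M X δ →
        (Summable fun p : fibreLattice a b c =>
          theta i η w C φ X t u a b c (p.1.1 : ℝ) (p.1.2 : ℝ)) ∧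
        (MeasureTheory.Integrable fun z : ℝ × ℝ => theta i η w C φ X t u a b c z.1 z.2) ∧
        |∑' p : fibreLattice a b c, theta i η w C φ X t u a b c (p.1.1 : ℝ) (p.1.2 : ℝ)
            - 1 / |8 * (a : ℝ) ^ 2 * (12 * a)|
              * ∫ z : ℝ × ℝ, theta i η w C φ X t u a b c z.1 z.2|
          ≤ K * X ^ (1 / 4 + 12 * δs + 50 * δ) := by
  obtain ⟨B, K, L, hB, hK, hL, hF⟩ :=
    exists_lipBump (i := i) hη_smooth hη_supp hw_smooth hw_compact hw_supp
  have hZ : 0 ≤ ∑' ν : ℤ, |(ν : ℝ)| ^ (-(3 / 2) : ℝ) := tsum_nonneg fun ν => by positivity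
  obtain ⟨E, hE⟩ := exists_error_bound (D := D) (m := 4 * M) hA hB hC hK hL hM (by positivity)
    hZ hδ
  refine ⟨E, 1, le_rfl, fun X hX φ hφ t u ht _ hu a b c habc => ?_⟩
  have hX0 : 0 < X := by linarith
  obtain ⟨p, r, hp, hr, hq, ha, hk, hH, hpy, hry, hpm, hrM, hsy, ha0, hH0⟩ :=
    restrictedBox_ranges hM hX hδ hδ' habc
  have ha0' : (a : ℝ) ≠ 0 := by exact_mod_cast ha0
  have hs4 : (X ^ (1 / 4 : ℝ)) ^ 4 = X := by
    rw [← Real.rpow_natCast, ← Real.rpow_mul hX0.le]; norm_num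
  have hs0 : 0 < X ^ (1 / 4 : ℝ) := by positivity
  have hDnn : ∀ k, 0 ≤ D k := fun k => by
    have h1 := (abs_nonneg _).trans (hφ.deriv_le k 0)
    have h2 : 0 < (((X ^ (-δs)) ^ (2 * k))⁻¹ : ℝ) := by positivity
    exact nonneg_of_mul_nonneg_left h1 h2
  have hz1 : 1 ≤ X ^ δs := Real.one_le_rpow hX hδs.le
  have hbump := hφ.smoothBump
  -- The factors ε⁻² and ε⁻⁴ become the powers z² and z⁴ of z = X^(δs).
  rw [Real.rpow_neg hX0.le, inv_pow, inv_inv, inv_pow, inv_inv] at hbump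
  have ht34 : 3 / 4 ≤ t ^ 4 := by
    have h1 : ((3 : ℝ) ^ (1 / 4 : ℝ) / √2) ^ 4 = 3 / 4 := by
      rw [div_pow, ← Real.rpow_natCast, ← Real.rpow_mul (by norm_num),
        show √2 ^ 4 = (√2 ^ 2) ^ 2 by ring, Real.sq_sqrt (by norm_num)]
      norm_num
    rw [← h1]
    gcongr
  have ht0 : 0 < t := lt_of_lt_of_le (by positivity) ht
  have ha1 : 1 ≤ (X ^ (1 / 4 : ℝ)) ^ 2 / r := by
    rw [← ha]; exact_mod_cast Int.one_le_abs ha0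
  have hR0 := R0_pos (C := C) (X := X) (b := b) (c := c) hC hX0 ha0' hH0
  have hR := R0_le (C := C) (b := b) (c := c) hX0 ha0'
  rw [ha, hk, hq] at hR
  obtain ⟨h1, h2, h3⟩ := theta_tsum_sub_integral_le (fun a b c => hF u a b c hu) hK hL hbump hA
    hC hX0 ht0 (b := b) (c := c) ha0 rfl rfl hH0
  refine ⟨h1, h2, h3.trans ?_⟩
  have e1 : |9 * semiH a b c / (C * X)| = 9 / (C * p ^ 2) := by
    rw [abs_div, abs_mul, hH, abs_of_pos (by positivity : 0 < C * X), hs4,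
      abs_of_pos (by norm_num : (0 : ℝ) < 9)]
    field_simp
  have e2 : 2 * |3 * (a : ℝ) / semiH a b c| = 6 * p ^ 2 / (r * (X ^ (1 / 4 : ℝ)) ^ 2) := by
    rw [abs_div, abs_mul, hH, ha, abs_of_pos (by norm_num : (0 : ℝ) < 3)]
    field_simp
    norm_num
  rw [e1, e2, ← sq_abs (a : ℝ), ha, hq]
  refine (hE X _ _ _ p r _ t hDnn hX hs4 rfl hz1 hp hr hpy hry hpm hrM hsy ha1 hR0 hR ht34).trans
    (le_of_eq ?_)
  rw [Real.rpow_add hX0, Real.rpow_add hX0, ← Real.rpow_natCast (X ^ δs), ← Real.rpow_mul hX0.le,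
    ← Real.rpow_natCast (X ^ δ), ← Real.rpow_mul hX0.le, mul_comm δs, mul_comm δ]
  norm_num
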